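/- Let $K$ be a commutative $\mathbb{Q}$-algebra and $G$ a finite abelian group. Let $K\langle\langle X\rangle\rangle$ be the algebra of noncommutative power series in $x_0$ and $x_g$ ($g\in G$), let $(\Psi|w)$ be the coefficient of the word $w$ in $\Psi$, let $\hat\Delta$ be the continuous algebra coproduct for which all letters are primitive, and let $\mathcal{G}=\{\Psi\in K\langle\langle X\rangle\rangle^\times:\hat\Delta(\Psi)=\Psi\otimes\Psi\}$. Let $t_g$ be the continuous automorphism with $x_0\mapsto x_0$, $x_h\mapsto x_{gh}$, and for $\Psi\in\mathcal{G}$ let $\mathrm{aut}_\Psi$ be the continuous endomorphism with $x_0\mapsto x_0$, $x_g\mapsto t_g(\Psi)^{-1}x_g\,t_g(\Psi)$. Put $\Psi\circledast\Phi=\Psi\,\mathrm{aut}_\Psi(\Phi)$; this makes $\mathcal{G}$ a group. Let $\hat{\mathcal V}$ be the complete graded $K$-algebra generated by $e_0,e_1$ (of degree $1$) and the elements of $G$ (of degree $0$) with the relations $g\times h=gh$, $1=1_G$ and $ge_0=e_0g$ for $g,h\in G$; let $\hat{\mathcal W}=K\oplus\hat{\mathcal V}e_1$, a subalgebra of $\hat{\mathcal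 V}$, and $\hat{\mathcal M}=\hat{\mathcal V}/(\hat{\mathcal V}e_0+\sum_{g\neq1}\hat{\mathcal V}(g-1))$, a left $\hat{\mathcal V}$-module; let $1_{\mathcal M}$ be the class of $1$. With $z_{n,g}=-e_0^{n-1}ge_1$ ($n\ge1$, $g\in G$), there is a unique continuous $K$-algebra morphism $\hat\Delta^{\mathcal W}:\hat{\mathcal W}\to\hat{\mathcal W}^{\hat\otimes2}$ with $$\hat\Delta^{\mathcal W}(z_{n,g})=z_{n,g}\otimes1+1\otimes z_{n,g}+\sum_{k=1}^{n-1}\sum_{h\in G}z_{k,h}\otimes z_{n-k,gh^{-1}}\qquad(n\ge1,\ g\in G),$$ and a unique continuous $K$-linear map $\hat\Delta^{\mathcal M}:\hat{\mathcal M}\to\hat{\mathcal M}^{\hat\otimes2}$ with $\hat\Delta^{\mathcal M}(w\cdot1_{\mathcal M})=\hat\Delta^{\mathcal W}(w)\cdot(1_{\mathcal M}\otimes 1_{\mathcal M})$ for all $w\in\hat{\mathcal W}$. Let $\beta:K\langle\langle X\rangle\rangle\to\hat{\mathcal V}$ be the continuous algebra morphism with $x_0\mapsto e_0$, $x_g\mapsto-ge_1g^{-1}$.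 For $\Psi\in\mathcal{G}$ let $a_\Psi$ be the continuous algebra endomorphism of $\hat{\mathcal V}$ with $e_0\mapsto e_0$, $e_1\mapsto\beta(\Psi)^{-1}e_1\beta(\Psi)$, $g\mapsto g$; let $\Gamma_\Psi(x)=\exp\big(\sum_{n\ge2}\frac{(-1)^{n-1}}{n}(\Psi|x_0^{n-1}x_1)x^n\big)\in K[[x]]^\times$, where $x_1$ is the letter $x_g$ for $g=1_G$, and $\gamma_\Psi=\Gamma_\Psi(-e_1)\in\hat{\mathcal V}^\times$. Let $A_\Psi^{\mathcal W}$ be the restriction to $\hat{\mathcal W}$ of $v\mapsto\gamma_\Psi^{-1}\beta(\Psi)\,a_\Psi(v)\,\beta(\Psi)^{-1}\gamma_\Psi$, which preserves $\hat{\mathcal W}$, and let $A_\Psi^{\mathcal M}$ be the $K$-linear endomorphism of $\hat{\mathcal M}$ induced by $v\mapsto\gamma_\Psi^{-1}\beta(\Psi)\,a_\Psi(v)$. Then $$\mathrm{Stab}(\hat\Delta^{\mathcal M})=\{\Psi\in\mathcal{G}:(A_\Psi^{\mathcal M})^{\otimes2}\circ\hat\Delta^{\mathcal M}=\hat\Delta^{\mathcal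 M}\circ A_\Psi^{\mathcal M}\}\quad\text{and}\quad\mathrm{Stab}(\hat\Delta^{\mathcal W})=\{\Psi\in\mathcal{G}:(A_\Psi^{\mathcal W})^{\otimes2}\circ\hat\Delta^{\mathcal W}=\hat\Delta^{\mathcal W}\circ A_\Psi^{\mathcal W}\}$$ are subgroups of $(\mathcal{G},\circledast)$, and $\mathrm{Stab}(\hat\Delta^{\mathcal M})\subset\mathrm{Stab}(\hat\Delta^{\mathcal W})$. -/

import Mathlib

open scoped TensorProduct

namespace DoubleShuffle

noncomputable section

/-! ### Inverse limits and completions -/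

section Completion

variable {K : Type*} [CommRing K]

section Limit

variable {D : Type*} [Ring D] [Algebra K D] {C : ℕ → Type*} [∀ n, Ring (C n)]
  [∀ n, Algebra K (C n)] (p : ∀ n, D →ₐ[K] C n)

/-- The sequences in `∏ n, C n` that agree, up to any given index, with the image of an element of
`D`. If the maps `p n` are surjective with decreasing kernels, this is the inverse limit of the
algebras `C n`. -/
def limAlg : Subalgebra K (∀ n, C n) where
  carrier := {x | ∀ N, ∃ d, ∀ n ≤ N, x n = p n d}
  mul_mem' := by
    intro x y hx hy N
    obtain ⟨a, ha⟩ := hx N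
    obtain ⟨b, hb⟩ := hy N
    exact ⟨a * b, fun n hn => by simp [ha n hn, hb n hn]⟩
  add_mem' := by
    intro x y hx hy N
    obtain ⟨a, ha⟩ := hx N
    obtain ⟨b, hb⟩ := hy N
    exact ⟨a + b, fun n hn => by simp [ha n hn, hb n hn]⟩
  algebraMap_mem' := fun r N => ⟨algebraMap K D r, fun n _ => by simp⟩

/-- The projection of the limit to its component of index `n`. -/
def limProj (n : ℕ) : limAlg p →ₐ[K] C n := (Pi.evalAlgHom K C n).comp (limAlg p).val

/-- The canonical map from `D` to the limit. -/
def limOf : D →ₐ[K] limAlg p :=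
  AlgHom.codRestrict (AlgHom.pi p) (limAlg p) fun d _ => ⟨d, fun _ _ => rfl⟩

end Limit

/-- The two-sided ideal generated by a set. -/
def genIdeal {A : Type*} [Ring A] (s : Set A) : Ideal A := (TwoSidedIdeal.span s).asIdeal

instance {A : Type*} [Ring A] (s : Set A) : (genIdeal s).IsTwoSided :=
  inferInstanceAs (TwoSidedIdeal.span s).asIdeal.IsTwoSided

/-- The powers of the two-sided ideal generated by a set. -/
def adic {A : Type*} [Ring A] (s : Set A) (n : ℕ) : Ideal A := genIdeal s ^ n

instance {A : Type*} [Ring A] (s : Set A) (n : ℕ) : (adic s n).IsTwoSided :=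
  inferInstanceAs (genIdeal s ^ n).IsTwoSided

/-- The completion `lim A / I ^ n`, where `I` is the two-sided ideal generated by `s`. If `A` is a
graded algebra generated by `s`, in degree `1`, and by elements of degree `0`, then `I ^ n` is the
part of degree at least `n`, and this is the completion of `A` with respect to its grading. -/
def Compl (K : Type*) [CommRing K] {A : Type*} [Ring A] [Algebra K A] (s : Set A) : Type _ :=
  limAlg (K := K) fun n => Ideal.Quotient.mkₐ K (adic s n)

namespace Compl

variable {A : Type*} [Ring A] [Algebra K A] {s : Set A}

instance : Ring (Compl K s) :=
  inferInstanceAs (Ring (limAlg (K := K) fun n => Ideal.Quotient.mkₐ K (adic s n)))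

instance : Algebra K (Compl K s) :=
  inferInstanceAs (Algebra K (limAlg (K := K) fun n => Ideal.Quotient.mkₐ K (adic s n)))

/-- The canonical map from `A` to its completion. -/
def of (s : Set A) : A →ₐ[K] Compl K s := limOf (K := K) fun n => Ideal.Quotient.mkₐ K (adic s n)

/-- The projection of the completion to `A / I ^ n`. -/
def proj (s : Set A) (n : ℕ) : Compl K s →ₐ[K] A ⧸ adic s n :=
  limProj (K := K) (fun n => Ideal.Quotient.mkₐ K (adic s n)) n

/-- The filtration of the completion: the elements of degree at least `n`. -/
def filt (K : Type*) [CommRing K] {A : Type*} [Ring A] [Algebra K A] (s : Set A) (n : ℕ) :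
    Ideal (Compl K s) := RingHom.ker (proj s n : Compl K s →ₐ[K] A ⧸ adic s n)

instance (n : ℕ) : (filt K s n).IsTwoSided :=
  inferInstanceAs (RingHom.ker (proj s n : Compl K s →ₐ[K] A ⧸ adic s n)).IsTwoSided

theorem mem_filt {n : ℕ} {x : Compl K s} : x ∈ filt K s n ↔ proj s n x = 0 := Iff.rfl

theorem exists_lift (x : Compl K s) (N : ℕ) :
    ∃ a : A, ∀ n ≤ N, proj s n x = Ideal.Quotient.mk (adic s n) a := x.2 N

theorem mk_eq_zero {n : ℕ} {a : A} : Ideal.Quotient.mk (adic s n) a = 0 ↔ a ∈ genIdeal s ^ n :=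
  Ideal.Quotient.eq_zero_iff_mem

theorem filt_zero (x : Compl K s) : x ∈ filt K s 0 := by
  obtain ⟨b, hb⟩ := exists_lift x 0
  rw [mem_filt, hb 0 le_rfl, mk_eq_zero, Submodule.pow_zero]
  simp

theorem filt_anti {m n : ℕ} (h : m ≤ n) {x : Compl K s} (hx : x ∈ filt K s n) :
    x ∈ filt K s m := by
  obtain ⟨b, hb⟩ := exists_lift x n
  rw [mem_filt, hb n le_rfl, mk_eq_zero] at hx
  rw [mem_filt, hb m h, mk_eq_zero]
  exact Ideal.pow_le_pow_right h hx

theorem filt_mul {i j : ℕ} {x y : Compl K s} (hx : x ∈ filt K s i) (hy : y ∈ filt K s j) :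
    x * y ∈ filt K s (i + j) := by
  obtain ⟨a, ha⟩ := exists_lift x (i + j)
  obtain ⟨b, hb⟩ := exists_lift y (i + j)
  rw [mem_filt, ha i (by omega), mk_eq_zero] at hx
  rw [mem_filt, hb j (by omega), mk_eq_zero] at hy
  rw [mem_filt, map_mul, ha _ le_rfl, hb _ le_rfl, ← map_mul, mk_eq_zero,
    Ideal.IsTwoSided.pow_add]
  exact Ideal.mul_mem_mul hx hy

theorem filt_pow {b : Compl K s} (hb : b ∈ filt K s 1) (n : ℕ) : b ^ n ∈ filt K s n := by
  induction n with
  | zero => exact filt_zero _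
  | succ n ih => rw [pow_succ]; exact filt_mul ih hb

theorem of_mem_filt {a : A} (ha : a ∈ s) : (of s a : Compl K s) ∈ filt K s 1 := by
  rw [mem_filt]
  change Ideal.Quotient.mk (adic s 1) a = 0
  rw [mk_eq_zero, Submodule.pow_one]
  exact TwoSidedIdeal.mem_asIdeal.2 (TwoSidedIdeal.subset_span ha)

end Compl

theorem map_genIdeal_pow {A B : Type*} [Ring A] [Algebra K A] [Ring B] [Algebra K B]
    (f : A →ₐ[K] B) (s : Set A) (H : ℕ → Submodule K B) (h0 : H 0 = ⊤)
    (hmul : ∀ i j, ∀ x ∈ H i, ∀ y ∈ H j, x * y ∈ H (i + j)) (hs : ∀ a ∈ s, f a ∈ H 1) (n : ℕ) :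
    ∀ a ∈ adic s n, f a ∈ H n := by
  have top : ∀ x, x ∈ H 0 := fun x => h0 ▸ Submodule.mem_top
  have h1 : ∀ a ∈ genIdeal s, f a ∈ H 1 := by
    let J : TwoSidedIdeal A := TwoSidedIdeal.mk' {a | f a ∈ H 1} (by simp)
      (fun {x y} hx hy => by simpa using add_mem hx hy) (fun {x} hx => by simpa using hx)
      (fun {x y} hy => by simpa using hmul 0 1 _ (top (f x)) _ hy)
      (fun {x y} hx => by simpa using hmul 1 0 _ hx _ (top (f y)))
    have hJ : TwoSidedIdeal.span s ≤ J :=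
      TwoSidedIdeal.span_le.2 fun a ha => by simpa [J] using hs a ha
    intro a ha
    simpa [J] using hJ (TwoSidedIdeal.mem_asIdeal.1 ha)
  induction n with
  | zero => intro a _; exact top _
  | succ n ih =>
    intro a ha
    rw [adic, Submodule.pow_succ] at ha
    refine Submodule.smul_induction_on ha (fun r hr t ht => ?_) (fun x y hx hy => ?_)
    · simpa using hmul n 1 _ (ih r hr) _ (h1 t ht)
    · simpa using add_mem hx hy

/-- The extension by continuity, from `A` to its completion, of an algebra morphism `f` from `A` to
a limit, when the component of index `n` of `f` vanishes on the power `σ n` of the ideal. -/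
def extend {A : Type*} [Ring A] [Algebra K A] (s : Set A)
    {D : Type*} [Ring D] [Algebra K D] {C : ℕ → Type*} [∀ n, Ring (C n)]
    [∀ n, Algebra K (C n)] {p : ∀ n, D →ₐ[K] C n} (f : A →ₐ[K] limAlg p) (σ : ℕ → ℕ)
    (hσ : Monotone σ) (h : ∀ n, ∀ a ∈ adic s (σ n), limProj p n (f a) = 0) :
    Compl K s →ₐ[K] limAlg p :=
  AlgHom.codRestrict
    (AlgHom.pi fun n =>
      (Ideal.Quotient.liftₐ (adic s (σ n)) ((limProj p n).comp f) (h n)).comp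
        (Compl.proj s (σ n)))
    (limAlg p) (by
      intro x N
      obtain ⟨a, ha⟩ := Compl.exists_lift x (σ N)
      obtain ⟨d, hd⟩ := (f a).2 N
      refine ⟨d, fun n hn => ?_⟩
      rw [← hd n hn]
      change Ideal.Quotient.liftₐ (adic s (σ n)) ((limProj p n).comp f) (h n)
        (Compl.proj s (σ n) x) = _
      rw [ha _ (hσ hn)]
      rfl)

theorem extendAdic_aux {A : Type*} [Ring A] [Algebra K A] {s : Set A} {B : Type*} [Ring B]
    [Algebra K B] {t : Set B} {f : A →ₐ[K] Compl K t} (hf : ∀ a ∈ s, f a ∈ Compl.filt K t 1)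
    (n : ℕ) : ∀ a ∈ adic s n, f a ∈ Compl.filt K t n :=
  map_genIdeal_pow f s (fun k => (Compl.filt K t k).restrictScalars K)
    (by
      ext x
      simpa using Compl.filt_zero x)
    (fun _ _ _ hx _ hy => Compl.filt_mul hx hy) hf n

/-- The extension by continuity, from `A` to its completion, of an algebra morphism `f` from `A` to
another completion that sends the elements of `s` to elements of degree at least `1`. -/
def extendAdic {A : Type*} [Ring A] [Algebra K A] (s : Set A) {B : Type*} [Ring B] [Algebra K B]
    (t : Set B) (f : A →ₐ[K] Compl K t) (hf : ∀ a ∈ s, f a ∈ Compl.filt K t 1) :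
    Compl K s →ₐ[K] Compl K t :=
  extend s f id monotone_id (extendAdic_aux hf)

theorem extendAdic_of {A : Type*} [Ring A] [Algebra K A] (s : Set A) {B : Type*} [Ring B]
    [Algebra K B] (t : Set B) (f : A →ₐ[K] Compl K t)
    (hf : ∀ a ∈ s, f a ∈ Compl.filt K t 1) (a : A) :
    extendAdic s t f hf (Compl.of s a) = f a := rfl

theorem extendAdic_filt {A : Type*} [Ring A] [Algebra K A] (s : Set A) {B : Type*} [Ring B]
    [Algebra K B] (t : Set B) (f : A →ₐ[K] Compl K t)
    (hf : ∀ a ∈ s, f a ∈ Compl.filt K t 1) {n : ℕ} {x : Compl K s}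
    (hx : x ∈ Compl.filt K s n) : extendAdic s t f hf x ∈ Compl.filt K t n := by
  have h : ∃ φ : (A ⧸ adic s n) →ₐ[K] (B ⧸ adic t n),
      Compl.proj t n (extendAdic s t f hf x) = φ (Compl.proj s n x) :=
    ⟨Ideal.Quotient.liftₐ (adic s n) ((Compl.proj t n).comp f) (extendAdic_aux hf n), rfl⟩
  obtain ⟨φ, hφ⟩ := h
  rw [Compl.mem_filt] at *
  rw [hφ, hx, map_zero]

/-- The morphism `Ad_u : a ↦ u a u⁻¹`. -/
def Ad {A : Type*} [Ring A] [Algebra K A] (u : Aˣ) : A →ₐ[K] A where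
  toFun a := u * a * (u⁻¹ : Aˣ)
  map_one' := by simp
  map_mul' a b := by simp [mul_assoc]
  map_zero' := by simp
  map_add' a b := by simp [mul_add, add_mul]
  commutes' r := by
    rw [← Algebra.commutes, mul_assoc, Units.mul_inv, mul_one]

/-! ### Evaluation of power series -/

section Eval

variable {A : Type*} [Ring A] [Algebra K A]

theorem aeval_trunc (c : A) (n : ℕ) (hc : c ^ n = 0) (q : Polynomial K) :
    Polynomial.aeval c (PowerSeries.trunc n (q : PowerSeries K)) = Polynomial.aeval c q := by
  have : Polynomial.X ^ n ∣ q - PowerSeries.trunc n (q : PowerSeries K) := by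
    rw [Polynomial.X_pow_dvd_iff]
    intro d hd
    simp [PowerSeries.coeff_trunc, hd]
  obtain ⟨r, hr⟩ := this
  have h2 := congrArg (Polynomial.aeval c) hr
  simp only [map_sub, map_mul, map_pow, Polynomial.aeval_X, hc, zero_mul] at h2
  exact (sub_eq_zero.1 h2).symm

/-- The evaluation `f ↦ f(c)` of power series at an element `c` with `c ^ n = 0`. -/
def evalNil (c : A) (n : ℕ) (hc : c ^ n = 0) : PowerSeries K →ₐ[K] A where
  toFun f := Polynomial.aeval c (PowerSeries.trunc n f)
  map_one' := by
    have := aeval_trunc (K := K) c n hc 1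
    simpa using this
  map_mul' f g := by
    rw [← map_mul, ← PowerSeries.trunc_trunc_mul_trunc,
      ← Polynomial.coe_mul, aeval_trunc c n hc]
  map_zero' := by simp
  map_add' f g := by simp
  commutes' r := by
    have := aeval_trunc (K := K) c n hc (Polynomial.C r)
    simpa using this

theorem proj_pow_eq_zero {s : Set A} {b : Compl K s} (hb : b ∈ Compl.filt K s 1) (n : ℕ) :
    Compl.proj s n b ^ n = 0 := by
  rw [← map_pow]
  exact Compl.filt_pow hb n

/-- The evaluation `f ↦ f(b)` of power series at an element `b` of degree at least `1`. -/
def evalSeries {s : Set A} (b : Compl K s) (hb : b ∈ Compl.filt K s 1) :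
    PowerSeries K →ₐ[K] Compl K s :=
  AlgHom.codRestrict
    (AlgHom.pi fun n => evalNil (Compl.proj s n b) n (proj_pow_eq_zero hb n)) _ (by
      intro f N
      obtain ⟨d, hd⟩ := Compl.exists_lift b N
      refine ⟨Polynomial.aeval d (PowerSeries.trunc N f), fun n hn => ?_⟩
      rw [← Polynomial.aeval_algHom_apply]
      change Polynomial.aeval (Compl.proj s n b) (PowerSeries.trunc n f) =
        Polynomial.aeval (Ideal.Quotient.mk (adic s n) d) (PowerSeries.trunc N f)
      rw [← hd n hn, ← aeval_trunc (Compl.proj s n b) n (proj_pow_eq_zero hb n)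
        (PowerSeries.trunc N f), PowerSeries.trunc_trunc_of_le _ hn])

theorem evalSeries_X {s : Set A} (b : Compl K s) (hb : b ∈ Compl.filt K s 1) :
    evalSeries b hb PowerSeries.X = b := by
  apply Subtype.ext
  funext n
  change Polynomial.aeval (Compl.proj s n b) (PowerSeries.trunc n PowerSeries.X) =
    Compl.proj s n b
  rw [← Polynomial.coe_X, aeval_trunc _ n (proj_pow_eq_zero hb n), Polynomial.aeval_X]

end Eval

/-! ### Completed tensor squares -/

section Tensor

variable {S A S' B : Type*} [Ring S] [Algebra K S] [AddCommGroup A] [Module K A] [Module S A]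
  [IsScalarTower K S A] [Ring S'] [Algebra K S'] [AddCommGroup B] [Module K B] [Module S' B]
  [IsScalarTower K S' B]

/-- The quotient map `A → A / P`, as a `K`-linear map. -/
def quotMk (K : Type*) [CommRing K] [Algebra K S] [Module K A] [IsScalarTower K S A]
    (P : Submodule S A) : A →ₗ[K] A ⧸ P :=
  P.mkQ.restrictScalars K

/-- The `K`-linear map on `A / P` induced by a `K`-linear map on `A` that vanishes on `P`. -/
def quotLift {N : Type*} [AddCommGroup N] [Module K N] (P : Submodule S A) (f : A →ₗ[K] N)
    (h : ∀ a ∈ P, f a = 0) : (A ⧸ P) →ₗ[K] N :=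
  (Submodule.liftQ (P.restrictScalars K) f fun a ha => h a ha).comp
    (Submodule.Quotient.restrictScalarsEquiv K P).symm.toLinearMap

/-- The `K`-linear map `A / P → B / Q` induced by a `K`-linear map `A → B`. -/
def quotMap (P : Submodule S A) (Q : Submodule S' B) (f : A →ₗ[K] B)
    (h : ∀ a ∈ P, f a ∈ Q) : (A ⧸ P) →ₗ[K] (B ⧸ Q) :=
  quotLift P ((quotMk K Q).comp f) fun a ha => (Submodule.Quotient.mk_eq_zero Q).2 (h a ha)

/-- The product of the modules `A / F n ⊗ A / F n`, which contains the completed tensor square. -/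
abbrev TensorSeq (K : Type*) [CommRing K] [Algebra K S] [Module K A] [IsScalarTower K S A]
    (F : ℕ → Submodule S A) : Type _ :=
  ∀ n, (A ⧸ F n) ⊗[K] (A ⧸ F n)

/-- The completed tensor square of a module `A` with a decreasing filtration `F`, that is, the
inverse limit of the modules `A / F n ⊗ A / F n`. -/
def complTensor (K : Type*) [CommRing K] [Algebra K S] [Module K A] [IsScalarTower K S A]
    (F : ℕ → Submodule S A) : Submodule K (TensorSeq K F) where
  carrier := {x | ∀ N, ∃ t : A ⊗[K] A, ∀ n ≤ N,
    x n = TensorProduct.map (quotMk K (F n)) (quotMk K (F n)) t}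
  zero_mem' := fun N => ⟨0, fun n _ => by simp⟩
  add_mem' := by
    intro x y hx hy N
    obtain ⟨a, ha⟩ := hx N
    obtain ⟨b, hb⟩ := hy N
    exact ⟨a + b, fun n hn => by simp [ha n hn, hb n hn]⟩
  smul_mem' := by
    intro c x hx N
    obtain ⟨a, ha⟩ := hx N
    exact ⟨c • a, fun n hn => by simp [ha n hn]⟩

/-- The map `f ⊗ f` on (sequences of components of) completed tensor squares, for a `K`-linear map
`f` that respects the filtrations. -/
def tensorSqMap {F : ℕ → Submodule S A} {F' : ℕ → Submodule S' B} (f : A →ₗ[K] B)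
    (h : ∀ n, ∀ a ∈ F n, f a ∈ F' n) : TensorSeq K F →ₗ[K] TensorSeq K F' :=
  LinearMap.pi fun n =>
    (TensorProduct.map (quotMap (F n) (F' n) f (h n)) (quotMap (F n) (F' n) f (h n))).comp
      (LinearMap.proj n)

end Tensor

section TensorAlg

variable {A : Type*} [Ring A] [Algebra K A] (F : ℕ → Ideal A) [∀ n, (F n).IsTwoSided]

/-- The completed tensor square of an algebra `A` with a decreasing filtration `F` by two-sided
ideals, as an algebra. -/
abbrev complTensorAlg (K : Type*) [CommRing K] {A : Type*} [Ring A] [Algebra K A]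
    (F : ℕ → Ideal A) [∀ n, (F n).IsTwoSided] :
    Subalgebra K (∀ n, (A ⧸ F n) ⊗[K] (A ⧸ F n)) :=
  limAlg fun n =>
    Algebra.TensorProduct.map (Ideal.Quotient.mkₐ K (F n)) (Ideal.Quotient.mkₐ K (F n))

theorem mem_complTensorAlg (x : TensorSeq K F) :
    x ∈ complTensorAlg K F ↔ x ∈ complTensor K F := Iff.rfl

/-- The element `a ⊗ b` of the completed tensor square. -/
def tmulHat (a b : A) : complTensorAlg K F := limOf _ (a ⊗ₜ[K] b)

end TensorAlg

end Completion

/-! ### Noncommutative power series -/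

section Series

/-- The free algebra `K⟨X⟩`; the letter `x₀` is `none` and the letter `x_g` is `some g`. -/
abbrev FreeX (K : Type*) [CommRing K] (G : Type*) : Type _ := FreeAlgebra K (Option G)

/-- The set of letters. -/
abbrev lettersX (K : Type*) [CommRing K] (G : Type*) : Set (FreeX K G) :=
  Set.range (FreeAlgebra.ι K)

/-- The algebra `K⟨⟨X⟩⟩` of noncommutative power series. -/
abbrev NCSeries (K : Type*) [CommRing K] (G : Type*) : Type _ := Compl K (lettersX K G)

/-- The filtration of `K⟨⟨X⟩⟩` by the degree. -/
abbrev filtX (K : Type*) [CommRing K] (G : Type*) (n : ℕ) : Ideal (NCSeries K G) :=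
  Compl.filt K (lettersX K G) n

variable {K : Type*} [CommRing K] {G : Type*}

/-- The letters `x₀` and `x_g`, as elements of `K⟨⟨X⟩⟩`. -/
def letter (K : Type*) [CommRing K] {G : Type*} (i : Option G) : NCSeries K G :=
  Compl.of _ (FreeAlgebra.ι K i)

theorem letter_mem (i : Option G) : letter K i ∈ filtX K G 1 :=
  Compl.of_mem_filt (Set.mem_range_self i)

/-- The continuous algebra morphism from `K⟨⟨X⟩⟩` to a completion with given values, of degree at
least `1`, on the letters. -/
def substSeries {B : Type*} [Ring B] [Algebra K B] {t : Set B} (b : Option G → Compl K t)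
    (hb : ∀ i, b i ∈ Compl.filt K t 1) : NCSeries K G →ₐ[K] Compl K t :=
  extendAdic _ t (FreeAlgebra.lift K b) (by
    rintro _ ⟨i, rfl⟩
    rw [FreeAlgebra.lift_ι_apply]
    exact hb i)

theorem word_coeff_eq_zero (w : FreeMonoid (Option G)) :
    ∀ a ∈ adic (lettersX K G) (w.length + 1),
      (FreeAlgebra.equivMonoidAlgebraFreeMonoid a).coeff w = 0 := by
  let H : ℕ → Submodule K (MonoidAlgebra K (FreeMonoid (Option G))) := fun k =>
    Submodule.span K {x | ∃ u : FreeMonoid (Option G), k ≤ u.length ∧ x = MonoidAlgebra.of K _ u}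
  have h0 : H 0 = ⊤ := by
    rw [eq_top_iff]
    intro x _
    induction x using MonoidAlgebra.induction_on with
    | of u => exact Submodule.subset_span ⟨u, Nat.zero_le _, rfl⟩
    | add x y hx hy => exact add_mem (hx trivial) (hy trivial)
    | smul c x hx => exact Submodule.smul_mem _ _ (hx trivial)
  have hmul : ∀ i j, ∀ x ∈ H i, ∀ y ∈ H j, x * y ∈ H (i + j) := by
    intro i j x hx y hy
    have hxy := Submodule.mul_mem_mul hx hy
    rw [Submodule.span_mul_span] at hxy
    refine Submodule.span_le.2 ?_ hxy
    rintro _ ⟨_, ⟨u, hu, rfl⟩, _, ⟨v, hv, rfl⟩, rfl⟩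
    refine Submodule.subset_span ⟨u * v, ?_, (map_mul _ _ _).symm⟩
    rw [FreeMonoid.length_mul]
    omega
  intro a ha
  have key := map_genIdeal_pow FreeAlgebra.equivMonoidAlgebraFreeMonoid.toAlgHom (lettersX K G) H
    h0 hmul (by
      rintro _ ⟨i, rfl⟩
      exact Submodule.subset_span ⟨FreeMonoid.of i, by simp,
        by simp [FreeAlgebra.equivMonoidAlgebraFreeMonoid]⟩) _ a ha
  have hle : H (w.length + 1) ≤
      LinearMap.ker ((Finsupp.lapply w).comp (MonoidAlgebra.coeffLinearEquiv K).toLinearMap) := by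
    refine Submodule.span_le.2 ?_
    rintro _ ⟨u, hu, rfl⟩
    have hne : u ≠ w := by
      rintro rfl
      omega
    simp [hne]
  exact hle key

/-- The coefficient `(Ψ | w)` of the word `w`. -/
def coeffX (w : FreeMonoid (Option G)) : NCSeries K G →ₗ[K] K :=
  (quotLift (adic (lettersX K G) (w.length + 1))
    ((Finsupp.lapply w).comp
      ((MonoidAlgebra.coeffLinearEquiv K).toLinearMap.comp
        FreeAlgebra.equivMonoidAlgebraFreeMonoid.toLinearMap))
    (word_coeff_eq_zero w)).comp (Compl.proj _ (w.length + 1)).toLinearMap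

theorem deltaX_eq_zero (n : ℕ) :
    ∀ a ∈ adic (lettersX K G) (2 * n),
      limProj _ n (FreeAlgebra.lift K (fun i =>
        tmulHat (filtX K G) (letter K i) 1 + tmulHat (K := K) (filtX K G) 1 (letter K i)) a) = 0 := by
  let H : ℕ → Submodule K ((NCSeries K G ⧸ filtX K G n) ⊗[K] (NCSeries K G ⧸ filtX K G n)) :=
    fun k => Submodule.span K {x | ∃ i j a b, i + j = k ∧ a ∈ filtX K G i ∧ b ∈ filtX K G j ∧
      x = Ideal.Quotient.mk (filtX K G n) a ⊗ₜ[K] Ideal.Quotient.mk (filtX K G n) b}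
  have h0 : H 0 = ⊤ := by
    rw [eq_top_iff, ← TensorProduct.span_tmul_eq_top]
    refine Submodule.span_mono ?_
    rintro _ ⟨a, b, rfl⟩
    obtain ⟨a, rfl⟩ := Ideal.Quotient.mk_surjective a
    obtain ⟨b, rfl⟩ := Ideal.Quotient.mk_surjective b
    exact ⟨0, 0, a, b, rfl, Compl.filt_zero a, Compl.filt_zero b, rfl⟩
  have hmul : ∀ i j, ∀ x ∈ H i, ∀ y ∈ H j, x * y ∈ H (i + j) := by
    intro i j x hx y hy
    have hxy := Submodule.mul_mem_mul hx hy
    rw [Submodule.span_mul_span] at hxy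
    refine Submodule.span_le.2 ?_ hxy
    rintro _ ⟨_, ⟨i₁, j₁, a, b, h, ha, hb, rfl⟩, _, ⟨i₂, j₂, c, d, h', hc, hd, rfl⟩, rfl⟩
    refine Submodule.subset_span ⟨i₁ + i₂, j₁ + j₂, a * c, b * d, by omega,
      Compl.filt_mul ha hc, Compl.filt_mul hb hd, ?_⟩
    rw [map_mul, map_mul]
    exact Algebra.TensorProduct.tmul_mul_tmul _ _ _ _
  have hbot : H (2 * n) ≤ ⊥ := by
    refine Submodule.span_le.2 ?_
    rintro _ ⟨i, j, a, b, h, ha, hb, rfl⟩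
    obtain hi | hj : n ≤ i ∨ n ≤ j := by omega
    · rw [Ideal.Quotient.eq_zero_iff_mem.2 (Compl.filt_anti hi ha), TensorProduct.zero_tmul]
      exact zero_mem _
    · rw [Ideal.Quotient.eq_zero_iff_mem.2 (Compl.filt_anti hj hb), TensorProduct.tmul_zero]
      exact zero_mem _
  intro a ha
  refine (Submodule.mem_bot K).1 (hbot (map_genIdeal_pow ((limProj _ n).comp (FreeAlgebra.lift K
    (fun i => tmulHat (filtX K G) (letter K i) 1 + tmulHat (K := K) (filtX K G) 1 (letter K i))))
    (lettersX K G) H h0 hmul ?_ _ a ha))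
  rintro _ ⟨i, rfl⟩
  rw [AlgHom.comp_apply, FreeAlgebra.lift_ι_apply, map_add]
  exact add_mem
    (Submodule.subset_span ⟨1, 0, letter K i, 1, rfl, letter_mem i, Compl.filt_zero _, rfl⟩)
    (Submodule.subset_span ⟨0, 1, 1, letter K i, rfl, Compl.filt_zero _, letter_mem i, rfl⟩)

/-- The coproduct of `K⟨⟨X⟩⟩`, for which the letters are primitive. -/
def DeltaX : NCSeries K G →ₐ[K] complTensorAlg K (filtX K G) :=
  extend (lettersX K G)
    (FreeAlgebra.lift K fun i =>
      tmulHat (filtX K G) (letter K i) 1 + tmulHat (filtX K G) 1 (letter K i))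
    (fun n => 2 * n) (fun _ _ h => Nat.mul_le_mul_left 2 h) deltaX_eq_zero

/-- The set of grouplike elements of `K⟨⟨X⟩⟩`. -/
def GrpLike (K : Type*) [CommRing K] (G : Type*) : Type _ :=
  {Ψ : (NCSeries K G)ˣ //
    DeltaX (Ψ : NCSeries K G) = tmulHat (filtX K G) (Ψ : NCSeries K G) (Ψ : NCSeries K G)}

variable [CommGroup G]

/-- The action `t_g` of `g` on `K⟨⟨X⟩⟩`: it fixes `x₀` and sends `x_h` to `x_{gh}`. -/
def tAct (g : G) : NCSeries K G →ₐ[K] NCSeries K G :=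
  substSeries (fun i => letter K (i.map (g * ·))) fun _ => letter_mem _

/-- The values of `aut_Ψ` on the letters: `x₀ ↦ x₀` and `x_g ↦ Ad_{t_g(Ψ⁻¹)}(x_g)`. -/
def autXLetter (Ψ : (NCSeries K G)ˣ) : Option G → NCSeries K G
  | none => letter K none
  | some g => Ad (K := K) (Units.map (tAct (K := K) g).toMonoidHom Ψ⁻¹) (letter K (some g))

theorem autXLetter_mem (Ψ : (NCSeries K G)ˣ) : ∀ i, autXLetter Ψ i ∈ filtX K G 1
  | none => letter_mem _
  | some _ => Ideal.mul_mem_right _ _ (Ideal.mul_mem_left _ _ (letter_mem _))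

/-- The endomorphism `aut_Ψ` of `K⟨⟨X⟩⟩`. -/
def autX (Ψ : (NCSeries K G)ˣ) : NCSeries K G →ₐ[K] NCSeries K G :=
  substSeries (autXLetter Ψ) (autXLetter_mem Ψ)

/-- The product `Ψ ⊛ Φ = Ψ aut_Ψ(Φ)`. -/
def circledast (Ψ Φ : (NCSeries K G)ˣ) : NCSeries K G := Ψ * autX Ψ Φ

end Series

section Gamma

variable {K : Type*} [CommRing K] [Algebra ℚ K] {G : Type*} [CommGroup G]

/-- The series `∑_{n ≥ 2} ((-1) ^ (n - 1) / n) (Ψ | x₀ ^ (n - 1) x₁) x ^ n`. -/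
def logGamma (Ψ : NCSeries K G) : PowerSeries K :=
  PowerSeries.mk fun n =>
    if 2 ≤ n then
      algebraMap ℚ K ((-1) ^ (n - 1) / n) *
        coeffX (FreeMonoid.of none ^ (n - 1) * FreeMonoid.of (some 1)) Ψ
    else 0

theorem constantCoeff_gamma (Ψ : NCSeries K G) :
    PowerSeries.constantCoeff ((PowerSeries.exp K).subst (logGamma Ψ)) = 1 := by
  have h : PowerSeries.constantCoeff (logGamma Ψ) = 0 := by
    rw [← PowerSeries.coeff_zero_eq_constantCoeff_apply, logGamma, PowerSeries.coeff_mk]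
    simp
  refine (PowerSeries.constantCoeff_subst
    (PowerSeries.HasSubst.of_constantCoeff_zero' h) _).trans ?_
  have h' : MvPowerSeries.constantCoeff (logGamma Ψ) = 0 := h
  rw [finsum_eq_single _ 0]
  · simp
  · intro d hd
    simp [h', hd]

/-- The invertible power series `Γ_Ψ(x) = exp(∑_{n ≥ 2} ...)`. -/
def Gamma (Ψ : NCSeries K G) : (PowerSeries K)ˣ where
  val := (PowerSeries.exp K).subst (logGamma Ψ)
  inv := PowerSeries.invOfUnit ((PowerSeries.exp K).subst (logGamma Ψ)) 1
  val_inv := PowerSeries.mul_invOfUnit _ _ (constantCoeff_gamma Ψ)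
  inv_val := by
    rw [mul_comm]
    exact PowerSeries.mul_invOfUnit _ _ (constantCoeff_gamma Ψ)

end Gamma

/-! ### The algebra `V`, the subalgebra `W` and the module `M` -/

section Crossed

/-- The generators `e₀`, `e₁` and `g`, for `g ∈ G`. -/
inductive Gen (G : Type*) : Type _
  | e0 : Gen G
  | e1 : Gen G
  | of (g : G) : Gen G

/-- The relations `g × h = gh`, `1 = 1_G` and `g × e₀ = e₀ × g`. -/
inductive Rel (K : Type*) [CommRing K] (G : Type*) [CommGroup G] :
    FreeAlgebra K (Gen G) → FreeAlgebra K (Gen G) → Prop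
  | mul (g h : G) : Rel K G (FreeAlgebra.ι K (.of g) * FreeAlgebra.ι K (.of h))
      (FreeAlgebra.ι K (.of (g * h)))
  | one : Rel K G 1 (FreeAlgebra.ι K (.of 1))
  | comm (g : G) : Rel K G (FreeAlgebra.ι K (.of g) * FreeAlgebra.ι K .e0)
      (FreeAlgebra.ι K .e0 * FreeAlgebra.ι K (.of g))

/-- The algebra with these generators and relations, before completion. -/
def VAlg (K : Type*) [CommRing K] (G : Type*) [CommGroup G] : Type _ := RingQuot (Rel K G)

variable {K : Type*} [CommRing K] {G : Type*} [CommGroup G]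

instance : Ring (VAlg K G) := inferInstanceAs (Ring (RingQuot (Rel K G)))

instance : Algebra K (VAlg K G) := inferInstanceAs (Algebra K (RingQuot (Rel K G)))

/-- The quotient map onto `VAlg`. -/
def VAlg.mk : FreeAlgebra K (Gen G) →ₐ[K] VAlg K G := RingQuot.mkAlgHom K (Rel K G)

/-- The algebra morphism on `VAlg` with given values on the generators. -/
def VAlg.lift {B : Type*} [Ring B] [Algebra K B] (f : Gen G → B)
    (h : ∀ a b, Rel K G a b → FreeAlgebra.lift K f a = FreeAlgebra.lift K f b) :
    VAlg K G →ₐ[K] B :=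
  RingQuot.liftAlgHom K ⟨FreeAlgebra.lift K f, fun {a b} => h a b⟩

/-- The generators of `VAlg`. -/
def VAlg.gen (K : Type*) [CommRing K] {G : Type*} [CommGroup G] (x : Gen G) : VAlg K G :=
  VAlg.mk (FreeAlgebra.ι K x)

theorem VAlg.lift_gen {B : Type*} [Ring B] [Algebra K B] (f : Gen G → B)
    (h : ∀ a b, Rel K G a b → FreeAlgebra.lift K f a = FreeAlgebra.lift K f b) (x : Gen G) :
    VAlg.lift f h (VAlg.gen K x) = f x :=
  (RingQuot.liftAlgHom_mkAlgHom_apply ..).trans (FreeAlgebra.lift_ι_apply ..)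

theorem VAlg.mk_rel {a b : FreeAlgebra K (Gen G)} (h : Rel K G a b) :
    (VAlg.mk a : VAlg K G) = VAlg.mk b := RingQuot.mkAlgHom_rel K h

/-- The generators of degree `1`. -/
def degOne (K : Type*) [CommRing K] (G : Type*) [CommGroup G] : Set (VAlg K G) :=
  {VAlg.gen K .e0, VAlg.gen K .e1}

/-- The complete graded algebra `V` generated by `e₀`, `e₁` of degree `1` and by `G`, of degree `0`,
with the relations above. -/
abbrev VHat (K : Type*) [CommRing K] (G : Type*) [CommGroup G] : Type _ := Compl K (degOne K G)

/-- The filtration of `V` by the degree. -/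
abbrev filtV (K : Type*) [CommRing K] (G : Type*) [CommGroup G] (n : ℕ) : Ideal (VHat K G) :=
  Compl.filt K (degOne K G) n

/-- The generators of `V`. -/
def genV (K : Type*) [CommRing K] {G : Type*} [CommGroup G] (x : Gen G) : VHat K G :=
  Compl.of _ (VAlg.gen K x)

/-- The element `e₀` of `V`. -/
abbrev e0 (K : Type*) [CommRing K] (G : Type*) [CommGroup G] : VHat K G := genV K .e0

/-- The element `e₁` of `V`. -/
abbrev e1 (K : Type*) [CommRing K] (G : Type*) [CommGroup G] : VHat K G := genV K .e1

/-- The element `g` of `V`. -/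
abbrev gV (K : Type*) [CommRing K] {G : Type*} [CommGroup G] (g : G) : VHat K G := genV K (.of g)

theorem e0_mem : e0 K G ∈ filtV K G 1 := Compl.of_mem_filt (by simp [degOne])

theorem e1_mem : e1 K G ∈ filtV K G 1 := Compl.of_mem_filt (by simp [degOne])

theorem neg_e1_mem : -e1 K G ∈ filtV K G 1 := neg_mem e1_mem

theorem genV_rel {a b : FreeAlgebra K (Gen G)} (h : Rel K G a b) :
    FreeAlgebra.lift K (genV K) a = FreeAlgebra.lift K (genV K) b := by
  have key : FreeAlgebra.lift K (genV K (G := G)) =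
      (Compl.of (degOne K G)).comp (VAlg.mk (K := K) (G := G)) := by
    apply FreeAlgebra.hom_ext
    funext x
    simp [genV, VAlg.gen]
  rw [key, AlgHom.comp_apply, AlgHom.comp_apply, VAlg.mk_rel h]

theorem gV_mul (g h : G) : gV K g * gV K h = gV K (g * h) := by
  simpa using genV_rel (K := K) (Rel.mul g h)

theorem gV_one : gV K (1 : G) = 1 := by
  simpa using (genV_rel (K := K) (G := G) Rel.one).symm

theorem gV_comm (g : G) : gV K g * e0 K G = e0 K G * gV K g := by
  simpa using genV_rel (K := K) (Rel.comm g)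

/-- The values on the letters of the morphism below. -/
def betaLetter (K : Type*) [CommRing K] {G : Type*} [CommGroup G] : Option G → VHat K G
  | none => e0 K G
  | some g => -(gV K g * e1 K G * gV K g⁻¹)

theorem betaLetter_mem : ∀ i : Option G, betaLetter K i ∈ filtV K G 1
  | none => e0_mem
  | some _ => neg_mem (Ideal.mul_mem_right _ _ (Ideal.mul_mem_left _ _ e1_mem))

/-- The continuous morphism `a ↦ β(a ⊗ 1)` from `K⟨⟨X⟩⟩` to `V`, `x₀ ↦ e₀`, `x_g ↦ -g e₁ g⁻¹`. -/
def beta : NCSeries K G →ₐ[K] VHat K G := substSeries (betaLetter K) betaLetter_mem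

/-- The unit `β(Ψ ⊗ 1)` of `V`. -/
def betaU (Ψ : (NCSeries K G)ˣ) : (VHat K G)ˣ := Units.map (beta (K := K)).toMonoidHom Ψ

/-- The values of `aut^{V,(0)}_Ψ` on the generators:
`e₀ ↦ e₀`, `e₁ ↦ β(Ψ⁻¹ ⊗ 1) e₁ β(Ψ ⊗ 1)` and `g ↦ g`. -/
def autV0Gen (Ψ : (NCSeries K G)ˣ) : Gen G → VHat K G
  | .e0 => e0 K G
  | .e1 => ((betaU Ψ)⁻¹ : (VHat K G)ˣ) * e1 K G * betaU Ψ
  | .of g => gV K g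

theorem autV0Gen_rel (Ψ : (NCSeries K G)ˣ) (a b : FreeAlgebra K (Gen G)) (h : Rel K G a b) :
    FreeAlgebra.lift K (autV0Gen Ψ) a = FreeAlgebra.lift K (autV0Gen Ψ) b := by
  obtain ⟨g, h⟩ | _ | g := h
  · simpa [autV0Gen] using gV_mul g h
  · simpa [autV0Gen] using gV_one.symm
  · simpa [autV0Gen] using gV_comm g

theorem autV0Gen_mem (Ψ : (NCSeries K G)ˣ) :
    ∀ a ∈ degOne K G, VAlg.lift (autV0Gen Ψ) (autV0Gen_rel Ψ) a ∈ filtV K G 1 := by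
  rintro a (rfl | rfl)
  · rw [VAlg.lift_gen]
    exact e0_mem
  · rw [VAlg.lift_gen]
    exact Ideal.mul_mem_right _ _ (Ideal.mul_mem_left _ _ e1_mem)

/-- The continuous algebra endomorphism `aut^{V,(0)}_Ψ` of `V`. -/
def autV0 (Ψ : (NCSeries K G)ˣ) : VHat K G →ₐ[K] VHat K G :=
  extendAdic _ _ (VAlg.lift (autV0Gen Ψ) (autV0Gen_rel Ψ)) (autV0Gen_mem Ψ)

theorem autV0_gen (Ψ : (NCSeries K G)ˣ) (x : Gen G) : autV0 Ψ (genV K x) = autV0Gen Ψ x :=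
  (extendAdic_of ..).trans (VAlg.lift_gen ..)

theorem autV0_filt (Ψ : (NCSeries K G)ˣ) {n : ℕ} {x : VHat K G} (hx : x ∈ filtV K G n) :
    autV0 Ψ x ∈ filtV K G n := extendAdic_filt _ _ _ _ hx

/-- `aut^{V,(1)}_Ψ = Ad_{β(Ψ ⊗ 1)} ∘ aut^{V,(0)}_Ψ`. -/
def autV1 (Ψ : (NCSeries K G)ˣ) : VHat K G →ₐ[K] VHat K G := (Ad (betaU Ψ)).comp (autV0 Ψ)

theorem autV1_e1 (Ψ : (NCSeries K G)ˣ) : autV1 Ψ (e1 K G) = e1 K G := by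
  change (betaU Ψ : VHat K G) * autV0 Ψ (e1 K G) * ((betaU Ψ)⁻¹ : (VHat K G)ˣ) = _
  rw [autV0_gen]
  simp [autV0Gen, mul_assoc]

/-- `aut^{V,(10)}_Ψ = ℓ_{β(Ψ ⊗ 1)} ∘ aut^{V,(0)}_Ψ`. -/
def autV10 (Ψ : (NCSeries K G)ˣ) : VHat K G →ₗ[K] VHat K G :=
  (LinearMap.mulLeft K (betaU Ψ : VHat K G)).comp (autV0 Ψ).toLinearMap

/-- The subalgebra `W = K ⊕ V e₁` of `V`. -/
def WHat (K : Type*) [CommRing K] (G : Type*) [CommGroup G] : Subalgebra K (VHat K G) where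
  carrier := {w | ∃ (c : K) (v : VHat K G), w = algebraMap K (VHat K G) c + v * e1 K G}
  mul_mem' := by
    rintro _ _ ⟨c, v, rfl⟩ ⟨d, u, rfl⟩
    refine ⟨c * d, algebraMap K _ c * u + v * algebraMap K _ d + v * e1 K G * u, ?_⟩
    have := Algebra.commutes d (e1 K G)
    simp only [mul_add, add_mul, map_mul, mul_assoc, this]
    abel
  add_mem' := by
    rintro _ _ ⟨c, v, rfl⟩ ⟨d, u, rfl⟩
    refine ⟨c + d, v + u, ?_⟩
    simp only [add_mul, map_add]
    abel
  algebraMap_mem' := fun c => ⟨c, 0, by simp⟩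

/-- The filtration of `W` by the degree. -/
def filtW (K : Type*) [CommRing K] (G : Type*) [CommGroup G] (n : ℕ) : Ideal (WHat K G) :=
  (filtV K G n).comap (WHat K G).val

instance (n : ℕ) : (filtW K G n).IsTwoSided :=
  inferInstanceAs ((filtV K G n).comap (WHat K G).val).IsTwoSided

/-- The element `z_{n,g} = -e₀ ^ (n - 1) g e₁` of `W`, for `n ≥ 1`. -/
def zW (K : Type*) [CommRing K] {G : Type*} [CommGroup G] (n : ℕ) (g : G) : WHat K G :=
  ⟨-(e0 K G ^ (n - 1) * gV K g * e1 K G), 0, -(e0 K G ^ (n - 1) * gV K g), by simp⟩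

/-- The left ideal `V e₀ + ∑_{g ≠ 1} V (g - 1)` of `V`. -/
def relM (K : Type*) [CommRing K] (G : Type*) [CommGroup G] : Submodule (VHat K G) (VHat K G) :=
  Submodule.span (VHat K G) ({e0 K G} ∪ {x | ∃ g : G, g ≠ 1 ∧ x = gV K g - 1})

/-- The left `V`-module `M = V / (V e₀ + ∑_{g ≠ 1} V (g - 1))`. -/
abbrev MHat (K : Type*) [CommRing K] (G : Type*) [CommGroup G] : Type _ := VHat K G ⧸ relM K G

/-- The class `1_M` of `1` in `M`. -/
def oneM (K : Type*) [CommRing K] (G : Type*) [CommGroup G] : MHat K G := (relM K G).mkQ 1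

/-- The filtration of `M` by the degree. -/
def filtM (K : Type*) [CommRing K] (G : Type*) [CommGroup G] (n : ℕ) :
    Submodule (VHat K G) (MHat K G) :=
  Submodule.map (relM K G).mkQ (filtV K G n)

/-- The map `ℓ_a : m ↦ a m` of `M`. -/
def lmulM (a : VHat K G) : MHat K G →ₗ[K] MHat K G := Algebra.lsmul K K (MHat K G) a

/-- The `K`-linear map `- · 1_M : W → M`. -/
def actOneM (K : Type*) [CommRing K] (G : Type*) [CommGroup G] : WHat K G →ₗ[K] MHat K G :=
  ((LinearMap.toSpanSingleton (VHat K G) (MHat K G) (oneM K G)).restrictScalars K).comp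
    (WHat K G).val.toLinearMap

theorem actOneM_apply (w : WHat K G) : actOneM K G w = (w : VHat K G) • oneM K G := rfl

theorem actOneM_filt (n : ℕ) (w : WHat K G) (hw : w ∈ filtW K G n) :
    actOneM K G w ∈ filtM K G n := by
  refine ⟨w, hw, ?_⟩
  change (relM K G).mkQ (w : VHat K G) = (w : VHat K G) • (relM K G).mkQ 1
  rw [← map_smul, smul_eq_mul, mul_one]

theorem autV0_relM (Ψ : (NCSeries K G)ˣ) {x : VHat K G} (hx : x ∈ relM K G) :
    autV0 Ψ x ∈ relM K G := by
  induction hx using Submodule.span_induction with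
  | mem x hx =>
    obtain rfl | ⟨g, hg, rfl⟩ := hx
    · rw [autV0_gen]
      exact Submodule.subset_span (Or.inl rfl)
    · rw [map_sub, map_one, autV0_gen]
      exact Submodule.subset_span (Or.inr ⟨g, hg, rfl⟩)
  | zero => simp
  | add x y _ _ hx hy => simpa using add_mem hx hy
  | smul a x _ hx =>
    rw [smul_eq_mul, map_mul]
    exact (relM K G).smul_mem _ hx

/-- The map `aut^{M,(10)}_Ψ` of `M` induced by `aut^{V,(10)}_Ψ`. -/
def autM10 (Ψ : (NCSeries K G)ˣ) : MHat K G →ₗ[K] MHat K G :=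
  quotMap (relM K G) (relM K G) (autV10 Ψ) fun _ hx => (relM K G).smul_mem _ (autV0_relM Ψ hx)

theorem autM10_mk (Ψ : (NCSeries K G)ˣ) (v : VHat K G) :
    autM10 Ψ ((relM K G).mkQ v) = (relM K G).mkQ (autV10 Ψ v) := rfl

theorem autM10_filt (Ψ : (NCSeries K G)ˣ) (n : ℕ) {m : MHat K G} (hm : m ∈ filtM K G n) :
    autM10 Ψ m ∈ filtM K G n := by
  obtain ⟨v, hv, rfl⟩ := hm
  rw [autM10_mk]
  exact ⟨_, Ideal.mul_mem_left _ _ (autV0_filt Ψ hv), rfl⟩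

theorem eval_commute_e1 (f : PowerSeries K) :
    Commute (evalSeries (-e1 K G) neg_e1_mem f) (e1 K G) := by
  have h : Commute (evalSeries (-e1 K G) neg_e1_mem f)
      (evalSeries (-e1 K G) neg_e1_mem PowerSeries.X) := (Commute.all f PowerSeries.X).map _
  rw [evalSeries_X] at h
  simpa using h.neg_right

variable [Algebra ℚ K]

/-- The unit `Γ_Ψ(-e₁)` of `V`. -/
def gammaU (Ψ : (NCSeries K G)ˣ) : (VHat K G)ˣ :=
  Units.map (evalSeries (K := K) (-e1 K G) neg_e1_mem).toMonoidHom (Gamma (Ψ : NCSeries K G))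

/-- The twisted endomorphism `^Γ aut^{V,(1)}_Ψ = Ad_{Γ_Ψ⁻¹(-e₁)} ∘ aut^{V,(1)}_Ψ` of `V`. -/
def gammaAutV1 (Ψ : (NCSeries K G)ˣ) : VHat K G →ₐ[K] VHat K G :=
  (Ad (gammaU Ψ)⁻¹).comp (autV1 Ψ)

theorem gammaAutV1_e1 (Ψ : (NCSeries K G)ˣ) : gammaAutV1 Ψ (e1 K G) = e1 K G := by
  change ((gammaU Ψ)⁻¹ : (VHat K G)ˣ) * autV1 Ψ (e1 K G) * (((gammaU Ψ)⁻¹)⁻¹ : (VHat K G)ˣ) = _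
  have h : Commute (gammaU Ψ : VHat K G) (e1 K G) := eval_commute_e1 _
  rw [autV1_e1, inv_inv, mul_assoc, ← h.eq, Units.inv_mul_cancel_left]

theorem gammaAutV1_mem (Ψ : (NCSeries K G)ˣ) (w : WHat K G) :
    gammaAutV1 Ψ (w : VHat K G) ∈ WHat K G := by
  obtain ⟨c, v, h⟩ := w.2
  refine ⟨c, gammaAutV1 Ψ v, ?_⟩
  rw [h, map_add, map_mul, gammaAutV1_e1, AlgHom.commutes]

/-- The restriction `^Γ aut^{W,(1)}_Ψ` of `^Γ aut^{V,(1)}_Ψ` to `W`. -/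
def gammaAutW1 (Ψ : (NCSeries K G)ˣ) : WHat K G →ₐ[K] WHat K G :=
  ((gammaAutV1 Ψ).comp (WHat K G).val).codRestrict (WHat K G) (gammaAutV1_mem Ψ)

theorem gammaAutW1_filt (Ψ : (NCSeries K G)ˣ) (n : ℕ) (w : WHat K G) (hw : w ∈ filtW K G n) :
    gammaAutW1 Ψ w ∈ filtW K G n :=
  Ideal.mul_mem_right _ (filtV K G n) (Ideal.mul_mem_left _ _
    (Ideal.mul_mem_right _ _ (Ideal.mul_mem_left _ _ (autV0_filt Ψ hw))))

/-- The twisted map `^Γ aut^{M,(10)}_Ψ = ℓ_{Γ_Ψ⁻¹(-e₁)} ∘ aut^{M,(10)}_Ψ` of `M`. -/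
def gammaAutM10 (Ψ : (NCSeries K G)ˣ) : MHat K G →ₗ[K] MHat K G :=
  (lmulM ((gammaU Ψ)⁻¹ : (VHat K G)ˣ)).comp (autM10 Ψ)

theorem gammaAutM10_filt (Ψ : (NCSeries K G)ˣ) (n : ℕ) (m : MHat K G) (hm : m ∈ filtM K G n) :
    gammaAutM10 Ψ m ∈ filtM K G n :=
  (filtM K G n).smul_mem _ (autM10_filt Ψ n hm)

end Crossed

/-! ### The coproducts and their stabilizers -/

section Coproducts

variable {K : Type*} [CommRing K] {G : Type*} [CommGroup G]

/-- `D` is the coproduct of `W`: a continuous algebra morphism with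
`z_{n,g} ↦ z_{n,g} ⊗ 1 + 1 ⊗ z_{n,g} + ∑_{0 < k < n, h ∈ G} z_{k,h} ⊗ z_{n-k,gh⁻¹}`. -/
def IsDeltaW [Fintype G] (D : WHat K G →ₐ[K] complTensorAlg K (filtW K G)) : Prop :=
  (∀ n, ∃ m, ∀ w ∈ filtW K G m, (D w).1 n = 0) ∧
    ∀ (n : ℕ) (g : G), 1 ≤ n →
      D (zW K n g) = tmulHat (filtW K G) (zW K n g) 1 + tmulHat (filtW K G) 1 (zW K n g) +
        ∑ k ∈ Finset.Ico 1 n, ∑ h : G,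
          tmulHat (filtW K G) (zW K k h) (zW K (n - k) (g * h⁻¹))

/-- `D` is the coproduct of `M` induced by the coproduct `DW` of `W`: a continuous `K`-linear map
with `D(w · 1_M) = DW(w) · (1_M ⊗ 1_M)` for `w ∈ W`. -/
def IsDeltaM (DW : WHat K G →ₐ[K] complTensorAlg K (filtW K G))
    (D : MHat K G →ₗ[K] complTensor K (filtM K G)) : Prop :=
  (∀ n, ∃ m, ∀ x ∈ filtM K G m, (D x).1 n = 0) ∧
    ∀ w : WHat K G, (D (actOneM K G w)).1 = tensorSqMap (actOneM K G) actOneM_filt (DW w).1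

variable [Algebra ℚ K]

/-- The stabilizer of the coproduct `DW` of `W` for the twisted action: the set of the `Ψ` with
`(^Γ aut^{W,(1)}_Ψ)^{⊗ 2} ∘ DW = DW ∘ ^Γ aut^{W,(1)}_Ψ`. -/
def stabW (DW : WHat K G →ₐ[K] complTensorAlg K (filtW K G)) : Set (GrpLike K G) :=
  {Ψ | ∀ w : WHat K G,
    tensorSqMap (gammaAutW1 Ψ.1).toLinearMap (gammaAutW1_filt Ψ.1) (DW w).1 =
      (DW (gammaAutW1 Ψ.1 w)).1}

/-- The stabilizer of the coproduct `DM` of `M` for the twisted action: the set of the `Ψ` with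
`(^Γ aut^{M,(10)}_Ψ)^{⊗ 2} ∘ DM = DM ∘ ^Γ aut^{M,(10)}_Ψ`. -/
def stabM (DM : MHat K G →ₗ[K] complTensor K (filtM K G)) : Set (GrpLike K G) :=
  {Ψ | ∀ m : MHat K G,
    tensorSqMap (gammaAutM10 Ψ.1) (gammaAutM10_filt Ψ.1) (DM m).1 =
      (DM (gammaAutM10 Ψ.1 m)).1}

end Coproducts

end

end DoubleShuffle

open DoubleShuffle

/-! Everything reduces to two facts: $\Psi\mapsto A_\Psi^{\mathcal W}$ and $\Psi\mapsto
A_\Psi^{\mathcal M}$ are actions of the group $(\mathcal G,\circledast)$, and under the isomorphism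
$w\mapsto w\cdot 1_{\mathcal M}$ from $\hat{\mathcal W}$ to $\hat{\mathcal M}$ the map
$A_\Psi^{\mathcal M}$ becomes $A_\Psi^{\mathcal W}$ followed by right multiplication by a unit.

Group law. Since $t_g$ commutes with $\mathrm{aut}_\Psi$, one has
$\mathrm{aut}_{\Psi\circledast\Phi}=\mathrm{aut}_\Psi\circ\mathrm{aut}_\Phi$ (`autX_circ`), whence
associativity. As $\mathrm{aut}_\Psi$ is the identity up to higher degree (`autX_sub_mem`), it is
bijective, and $\mathrm{aut}_\Psi^{-1}(\Psi^{-1})$ is a right inverse. For grouplike $\Psi$ the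
images of the letters are primitive, so $\mathrm{aut}_\Psi$ commutes with $\hat\Delta$ and preserves
grouplike series.

Actions. Put $\tau_\Psi=\gamma_\Psi^{-1}\beta(\Psi)$. Then $A_\Psi^{\mathcal
W}=\mathrm{Ad}_{\tau_\Psi}\circ a_\Psi$ and $A_\Psi^{\mathcal M}=\tau_\Psi\cdot a_\Psi$, so the
action laws follow from $a_{\Psi\circledast\Phi}=a_\Psi a_\Phi$ and the cocycle identity
$\tau_{\Psi\circledast\Phi}=\tau_\Psi\,a_\Psi(\tau_\Phi)$ (`twistU_circ`). The factor $\beta(\Psi)$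
is a cocycle because $a_\Psi\beta=\beta\,\mathrm{aut}_\Psi$. The factor $\gamma_\Psi$ is
multiplicative because the coefficients $(\Psi|x_0^{n-1}x_1)$ are additive for $\circledast$ once
the constant terms are $1$ (`depthOne_circ`), and it is a series in $e_1$, which
$\mathrm{Ad}_{\beta(\Psi)}a_\Psi$ fixes. The stabilizer of a coproduct for an action is a subgroup.

The algebra $\hat{\mathcal W}$ and the module $\hat{\mathcal M}$. Given elements $\varphi(n,g)$ of
suitable degree in an algebra $T$, an explicit $\hat{\mathcal V}$-module, free over $T$, yields a
linear map $F:\hat{\mathcal V}\to T$ that is an algebra morphism on $\hat{\mathcal W}$, sends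
$e_0^nge_1$ to $\varphi(n,g)$ and kills the left ideal defining $\hat{\mathcal M}$
(`exists_isCrossed`). With $T=\hat{\mathcal W}^{\hat\otimes2}$ this constructs $\hat\Delta^{\mathcal
W}$; with $T=\hat{\mathcal V}$ it gives a retraction showing that $\hat{\mathcal W}\to\hat{\mathcal
M}$ is injective. Surjectivity holds because the elements of positive degree form the left ideal
generated by $e_0$ and the $e_1g$.

Inclusion. Let $u\in\hat{\mathcal W}$ satisfy $u\cdot1_{\mathcal M}=A_\Psi^{\mathcal M}(1_{\mathcal
M})$; it is a unit because $\Psi$ is invertible for $\circledast$. Semilinearity gives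
$A_\Psi^{\mathcal M}(w\cdot1_{\mathcal M})=A_\Psi^{\mathcal W}(w)u\cdot1_{\mathcal M}$. If $\Psi$
stabilizes $\hat\Delta^{\mathcal M}$, then $(A_\Psi^{\mathcal W})^{\otimes2}(\hat\Delta^{\mathcal
W}(w))\,(u\otimes u)=\hat\Delta^{\mathcal W}(A_\Psi^{\mathcal W}(w))\,\hat\Delta^{\mathcal W}(u)$.
Taking $w=1$ gives $u\otimes u=\hat\Delta^{\mathcal W}(u)$, and this unit cancels. -/

namespace DoubleShuffle

noncomputable section

/-! ### Density and completeness -/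

section Approx

variable {K : Type*} [CommRing K] {A : Type*} [Ring A] [Algebra K A] {s : Set A}

namespace Compl

theorem of_mem_filt_iff {a : A} {n : ℕ} :
    (of s a : Compl K s) ∈ filt K s n ↔ a ∈ adic s n := by
  rw [mem_filt]
  exact mk_eq_zero

theorem exists_sub_of_mem (x : Compl K s) (N : ℕ) : ∃ a : A, x - of s a ∈ filt K s N := by
  obtain ⟨a, ha⟩ := exists_lift x N
  refine ⟨a, ?_⟩
  rw [mem_filt, map_sub, ha N le_rfl]
  exact sub_self _

theorem exists_mem_adic_sub_of_mem {n : ℕ} {x : Compl K s} (hx : x ∈ filt K s n) (N : ℕ) :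
    ∃ a ∈ adic s n, x - of s a ∈ filt K s N := by
  obtain ⟨a, ha⟩ := exists_sub_of_mem x (max n N)
  refine ⟨a, ?_, filt_anti (le_max_right _ _) ha⟩
  have h := sub_mem hx (filt_anti (le_max_left _ _) ha)
  rwa [sub_sub_cancel, of_mem_filt_iff] at h

theorem eq_of_proj_eq {x y : Compl K s} (h : ∀ n, proj s n x = proj s n y) : x = y :=
  Subtype.ext (funext h)

theorem eq_of_sub_mem {x y : Compl K s} (h : ∀ n, x - y ∈ filt K s n) : x = y := by
  refine eq_of_proj_eq fun n => ?_
  have := h n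
  rwa [mem_filt, map_sub, sub_eq_zero] at this

/-- Both maps factor through the quotient by degree at least `m`, where every class has a
representative in `A`. This is the form in which density is used: the continuity of a map to a limit
is checked one component at a time. -/
theorem linearMap_ext {C : Type*} [AddCommGroup C] [Module K C] (f g : Compl K s →ₗ[K] C) (m : ℕ)
    (hf : ∀ x ∈ filt K s m, f x = 0) (hg : ∀ x ∈ filt K s m, g x = 0)
    (h : ∀ a, f (of s a) = g (of s a)) : f = g := by
  ext x
  obtain ⟨a, ha⟩ := exists_sub_of_mem x m
  have h1 := hf _ ha
  have h2 := hg _ ha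
  rw [map_sub, sub_eq_zero] at h1 h2
  rw [h1, h2, h]

theorem endo_ext {B : Type*} [Ring B] [Algebra K B] {t : Set B}
    (f g : Compl K s →ₐ[K] Compl K t) (hf : ∀ n, ∀ x ∈ filt K s n, f x ∈ filt K t n)
    (hg : ∀ n, ∀ x ∈ filt K s n, g x ∈ filt K t n) (h : ∀ a, f (of s a) = g (of s a)) :
    f = g := by
  ext x
  refine eq_of_proj_eq fun n => ?_
  exact LinearMap.congr_fun (linearMap_ext ((proj t n).toLinearMap.comp f.toLinearMap)
    ((proj t n).toLinearMap.comp g.toLinearMap) n (hf n) (hg n)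
    fun a => congrArg (proj t n) (h a)) x

/-- Completeness: in each quotient the partial sums are eventually constant, and these constants
form a compatible sequence. -/
theorem exists_sum (y : ℕ → Compl K s) (hy : ∀ n, y n ∈ filt K s n) :
    ∃ x : Compl K s, ∀ n, x - ∑ i ∈ Finset.range n, y i ∈ filt K s n := by
  have key : ∀ n N, n ≤ N →
      proj s n (∑ i ∈ Finset.range N, y i) = proj s n (∑ i ∈ Finset.range n, y i) := by
    intro n N h
    induction N, h using Nat.le_induction with
    | base => rfl
    | succ N hN ih =>
      rw [Finset.sum_range_succ, map_add, ih, mem_filt.1 (filt_anti hN (hy N)), add_zero]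
  obtain ⟨x, hx⟩ : ∃ x : Compl K s, ∀ n, proj s n x = proj s n (∑ i ∈ Finset.range n, y i) := by
    refine ⟨⟨fun n => proj s n (∑ i ∈ Finset.range n, y i), fun N => ?_⟩, fun n => rfl⟩
    obtain ⟨a, ha⟩ := exists_lift (∑ i ∈ Finset.range N, y i) N
    exact ⟨a, fun n hn => (key n N hn).symm.trans (ha n hn)⟩
  refine ⟨x, fun n => ?_⟩
  rw [mem_filt, map_sub, sub_eq_zero, hx]

end Compl

theorem evalSeries_sub_mem (b : Compl K s) (hb : b ∈ Compl.filt K s 1) (f : PowerSeries K) (n : ℕ) :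
    evalSeries b hb f - Polynomial.aeval b (PowerSeries.trunc n f) ∈ Compl.filt K s n := by
  rw [Compl.mem_filt, map_sub, ← Polynomial.aeval_algHom_apply]
  exact sub_self _

/-- A filtered endomorphism fixing `b` fixes all polynomials in `b`, hence their limits. It is
applied to `b = -e₁`. -/
theorem map_evalSeries (b : Compl K s) (hb : b ∈ Compl.filt K s 1) (φ : Compl K s →ₐ[K] Compl K s)
    (hφ : ∀ n, ∀ x ∈ Compl.filt K s n, φ x ∈ Compl.filt K s n) (h : φ b = b)
    (f : PowerSeries K) : φ (evalSeries b hb f) = evalSeries b hb f := by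
  refine Compl.eq_of_sub_mem fun n => ?_
  have h1 := evalSeries_sub_mem b hb f n
  have h2 := hφ n _ h1
  rw [map_sub, ← Polynomial.aeval_algHom_apply, h] at h2
  simpa using sub_mem h2 h1

section Extend

variable {D : Type*} [Ring D] [Algebra K D] {C : ℕ → Type*} [∀ n, Ring (C n)]
    [∀ n, Algebra K (C n)] {p : ∀ n, D →ₐ[K] C n}

theorem limAlg_ext {x y : limAlg p} (h : ∀ n, limProj p n x = limProj p n y) : x = y :=
  Subtype.ext (funext h)

/-- The extension by continuity, from `A` to its completion, of a linear map `f` from `A` to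
a limit, when the component of index `n` of `f` vanishes on the power `σ n` of the ideal. -/
def extendLin (s : Set A) (f : A →ₗ[K] limAlg p) (σ : ℕ → ℕ)
    (hσ : Monotone σ) (h : ∀ n, ∀ a ∈ adic s (σ n), limProj p n (f a) = 0) :
    Compl K s →ₗ[K] limAlg p :=
  LinearMap.codRestrict (Subalgebra.toSubmodule (limAlg p))
    (LinearMap.pi fun n =>
      (quotLift (adic s (σ n)) ((limProj p n).toLinearMap.comp f) (h n)).comp
        (Compl.proj s (σ n)).toLinearMap) (by
      intro x N
      obtain ⟨a, ha⟩ := Compl.exists_lift x (σ N)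
      obtain ⟨d, hd⟩ := (f a).2 N
      refine ⟨d, fun n hn => ?_⟩
      rw [← hd n hn]
      change quotLift (adic s (σ n)) ((limProj p n).toLinearMap.comp f) (h n)
        (Compl.proj s (σ n) x) = _
      rw [ha _ (hσ hn)]
      rfl)

variable (f : A →ₗ[K] limAlg p) {σ : ℕ → ℕ} (hσ : Monotone σ)
  (h : ∀ n, ∀ a ∈ adic s (σ n), limProj p n (f a) = 0)

theorem extendLin_of (a : A) : extendLin s f σ hσ h (Compl.of s a) = f a := rfl

theorem limProj_extendLin {n : ℕ} {x : Compl K s} (hx : x ∈ Compl.filt K s (σ n)) :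
    limProj p n (extendLin s f σ hσ h x) = 0 := by
  change quotLift (adic s (σ n)) ((limProj p n).toLinearMap.comp f) (h n)
        (Compl.proj s (σ n) x) = 0
  rw [Compl.mem_filt.1 hx, map_zero]

theorem limProj_extend (f : A →ₐ[K] limAlg p) (h : ∀ n, ∀ a ∈ adic s (σ n), limProj p n (f a) = 0)
    {n : ℕ} {x : Compl K s} (hx : x ∈ Compl.filt K s (σ n)) :
    limProj p n (extend s f σ hσ h x) = 0 := by
  have h' : ∃ φ : (A ⧸ adic s (σ n)) →ₐ[K] C n,
      limProj p n (extend s f σ hσ h x) = φ (Compl.proj s (σ n) x) :=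
    ⟨Ideal.Quotient.liftₐ (adic s (σ n)) ((limProj p n).comp f) (h n), rfl⟩
  obtain ⟨φ, hφ⟩ := h'
  rw [hφ, Compl.mem_filt.1 hx, map_zero]

end Extend

end Approx

/-! ### Functoriality of completed tensor squares -/

section TensorSq

variable {K : Type*} [CommRing K]

section Module

variable {S₁ S₂ S₃ A₁ A₂ A₃ : Type*} [Ring S₁] [Algebra K S₁] [AddCommGroup A₁] [Module K A₁]
  [Module S₁ A₁] [IsScalarTower K S₁ A₁] [Ring S₂] [Algebra K S₂] [AddCommGroup A₂] [Module K A₂]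
  [Module S₂ A₂] [IsScalarTower K S₂ A₂] [Ring S₃] [Algebra K S₃] [AddCommGroup A₃] [Module K A₃]
  [Module S₃ A₃] [IsScalarTower K S₃ A₃] {F₁ : ℕ → Submodule S₁ A₁} {F₂ : ℕ → Submodule S₂ A₂}
  {F₃ : ℕ → Submodule S₃ A₃}

/-- Components of a tensor square are computed on a lift to `A₁ ⊗ A₁`; the existence of such lifts
is what defines the completed tensor square. -/
theorem tensorSqMap_apply_map_mk (f : A₁ →ₗ[K] A₂) (h : ∀ n, ∀ a ∈ F₁ n, f a ∈ F₂ n)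
    (x : TensorSeq K F₁) (n : ℕ) (t : A₁ ⊗[K] A₁)
    (ht : x n = TensorProduct.map (quotMk K (F₁ n)) (quotMk K (F₁ n)) t) :
    tensorSqMap f h x n =
      TensorProduct.map (quotMk K (F₂ n)) (quotMk K (F₂ n)) (TensorProduct.map f f t) := by
  change TensorProduct.map _ _ (x n) = _
  rw [ht, ← LinearMap.comp_apply, ← LinearMap.comp_apply, ← TensorProduct.map_comp,
    ← TensorProduct.map_comp]
  rfl

theorem tensorSqMap_mem (f : A₁ →ₗ[K] A₂) (h : ∀ n, ∀ a ∈ F₁ n, f a ∈ F₂ n)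
    {x : TensorSeq K F₁} (hx : x ∈ complTensor K F₁) : tensorSqMap f h x ∈ complTensor K F₂ := by
  intro N
  obtain ⟨t, ht⟩ := hx N
  exact ⟨TensorProduct.map f f t, fun n hn => tensorSqMap_apply_map_mk f h x n t (ht n hn)⟩

theorem tensorSqMap_tensorSqMap (f : A₁ →ₗ[K] A₂) (h : ∀ n, ∀ a ∈ F₁ n, f a ∈ F₂ n)
    (g : A₂ →ₗ[K] A₃) (hg : ∀ n, ∀ a ∈ F₂ n, g a ∈ F₃ n)
    (x : TensorSeq K F₁) : tensorSqMap g hg (tensorSqMap f h x) =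
      tensorSqMap (F := F₁) (F' := F₃) (g.comp f) (fun n a ha => hg n _ (h n a ha)) x := by
  funext n
  change TensorProduct.map _ _ (TensorProduct.map _ _ (x n)) = TensorProduct.map _ _ (x n)
  rw [← LinearMap.comp_apply, ← TensorProduct.map_comp]
  congr 2 <;>
  · refine LinearMap.ext fun a => ?_
    obtain ⟨a, rfl⟩ := Submodule.Quotient.mk_surjective _ a
    rfl

theorem tensorSqMap_of_eq_id (f : A₁ →ₗ[K] A₁) (h : ∀ n, ∀ a ∈ F₁ n, f a ∈ F₁ n)
    (hf : ∀ a, f a = a) (x : TensorSeq K F₁) : tensorSqMap f h x = x := by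
  funext n
  change TensorProduct.map _ _ (x n) = x n
  have : quotMap (F₁ n) (F₁ n) f (h n) = LinearMap.id := by
    refine LinearMap.ext fun a => ?_
    obtain ⟨a, rfl⟩ := Submodule.Quotient.mk_surjective _ a
    exact congrArg _ (hf a)
  rw [this, TensorProduct.map_id, LinearMap.id_apply]

theorem tensorSqMap_congr {f g : A₁ →ₗ[K] A₂} (hf : ∀ n, ∀ a ∈ F₁ n, f a ∈ F₂ n)
    (hg : ∀ n, ∀ a ∈ F₁ n, g a ∈ F₂ n) (h : f = g) (x : TensorSeq K F₁) :
    tensorSqMap f hf x = tensorSqMap g hg x := by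
  subst h
  rfl

end Module

section Alg

variable {A B : Type*} [Ring A] [Algebra K A] [Ring B] [Algebra K B] {F : ℕ → Ideal A}
  [∀ n, (F n).IsTwoSided] {F' : ℕ → Ideal B} [∀ n, (F' n).IsTwoSided]

theorem tmulHat_mul (a b c d : A) :
    tmulHat (K := K) F a b * tmulHat F c d = tmulHat F (a * c) (b * d) := by
  rw [tmulHat, tmulHat, ← map_mul, Algebra.TensorProduct.tmul_mul_tmul]
  rfl

theorem tmulHat_one : tmulHat (K := K) F 1 1 = 1 := map_one _

/-- The morphism `f ⊗ f` on completed tensor squares, for an algebra morphism `f` that respects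
the filtrations. -/
def tensorSqHom (f : A →ₐ[K] B) (h : ∀ n, ∀ a ∈ F n, f a ∈ F' n) :
    complTensorAlg K F →ₐ[K] complTensorAlg K F' where
  toFun x := ⟨tensorSqMap f.toLinearMap h x.1, tensorSqMap_mem f.toLinearMap h x.2⟩
  map_one' := by
    apply Subtype.ext
    funext n
    refine (tensorSqMap_apply_map_mk (F₁ := F) (F₂ := F') f.toLinearMap h _ n (1 ⊗ₜ 1) rfl).trans ?_
    change Ideal.Quotient.mk (F' n) (f 1) ⊗ₜ[K] Ideal.Quotient.mk (F' n) (f 1) = 1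
    rw [map_one, map_one]
    rfl
  map_mul' x y := by
    apply Subtype.ext
    funext n
    let φ := quotMap (F n) (F' n) f.toLinearMap (h n)
    change TensorProduct.map φ φ (x.1 n * y.1 n) =
      TensorProduct.map φ φ (x.1 n) * TensorProduct.map φ φ (y.1 n)
    induction x.1 n using TensorProduct.induction_on with
    | zero => simp
    | add a b ha hb => simp only [add_mul, map_add, ha, hb]
    | tmul a b =>
      induction y.1 n using TensorProduct.induction_on with
      | zero => simp
      | add a b ha hb => simp only [mul_add, map_add, ha, hb]
      | tmul c d =>
        obtain ⟨a, rfl⟩ := Ideal.Quotient.mk_surjective a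
        obtain ⟨b, rfl⟩ := Ideal.Quotient.mk_surjective b
        obtain ⟨c, rfl⟩ := Ideal.Quotient.mk_surjective c
        obtain ⟨d, rfl⟩ := Ideal.Quotient.mk_surjective d
        rw [Algebra.TensorProduct.tmul_mul_tmul, ← map_mul, ← map_mul]
        change Ideal.Quotient.mk (F' n) (f (a * c)) ⊗ₜ[K] Ideal.Quotient.mk (F' n) (f (b * d)) =
          (Ideal.Quotient.mk (F' n) (f a) ⊗ₜ[K] Ideal.Quotient.mk (F' n) (f b)) *
          (Ideal.Quotient.mk (F' n) (f c) ⊗ₜ[K] Ideal.Quotient.mk (F' n) (f d))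
        rw [Algebra.TensorProduct.tmul_mul_tmul, map_mul, map_mul, map_mul, map_mul]
  map_zero' := Subtype.ext (map_zero _)
  map_add' x y := Subtype.ext (map_add _ x.1 y.1)
  commutes' r := by
    apply Subtype.ext
    funext n
    have h1 : (algebraMap K (complTensorAlg K F) r).1 n =
        TensorProduct.map (quotMk K (F n)) (quotMk K (F n)) (algebraMap K A r ⊗ₜ 1) := rfl
    refine (tensorSqMap_apply_map_mk f.toLinearMap h _ n _ h1).trans ?_
    change Ideal.Quotient.mk (F' n) (f (algebraMap K A r)) ⊗ₜ[K]
      Ideal.Quotient.mk (F' n) (f 1) = _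
    rw [map_one, map_one, AlgHom.commutes]
    rfl

theorem tensorSqHom_val (f : A →ₐ[K] B) (h : ∀ n, ∀ a ∈ F n, f a ∈ F' n)
    (x : complTensorAlg K F) :
    (tensorSqHom f h x).1 = tensorSqMap (F := F) (F' := F') f.toLinearMap h x.1 := rfl

theorem tensorSqHom_tmulHat (f : A →ₐ[K] B) (h : ∀ n, ∀ a ∈ F n, f a ∈ F' n) (a b : A) :
    tensorSqHom f h (tmulHat F a b) = tmulHat F' (f a) (f b) := by
  apply Subtype.ext
  funext n
  exact tensorSqMap_apply_map_mk f.toLinearMap h _ n (a ⊗ₜ b) rfl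

theorem tensorSqHom_limProj_eq_zero (f : A →ₐ[K] B) (h : ∀ n, ∀ a ∈ F n, f a ∈ F' n)
    (x : complTensorAlg K F) {n : ℕ} (hx : limProj _ n x = 0) :
    limProj _ n (tensorSqHom f h x) = 0 := by
  change TensorProduct.map _ _ (x.1 n) = 0
  have : x.1 n = 0 := hx
  rw [this, map_zero]

/-- Multiplication by `u ⊗ u` on the right is the tensor square of the multiplication by `u`. -/
theorem tensorSqMap_mulRight (u : A) (h : ∀ n, ∀ a ∈ F n, LinearMap.mulRight K u a ∈ F n)
    (x : complTensorAlg K F) :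
    tensorSqMap (F := F) (F' := F) (LinearMap.mulRight K u) h x.1 = (x * tmulHat F u u).1 := by
  funext n
  change TensorProduct.map _ _ (x.1 n) = x.1 n * (tmulHat F u u).1 n
  induction x.1 n using TensorProduct.induction_on with
  | zero => simp
  | add a b ha hb => simp only [add_mul, map_add, ha, hb]
  | tmul a b =>
    obtain ⟨a, rfl⟩ := Ideal.Quotient.mk_surjective a
    obtain ⟨b, rfl⟩ := Ideal.Quotient.mk_surjective b
    change Ideal.Quotient.mk (F n) (a * u) ⊗ₜ[K] Ideal.Quotient.mk (F n) (b * u) =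
          (Ideal.Quotient.mk (F n) a ⊗ₜ[K] Ideal.Quotient.mk (F n) b) *
          (Ideal.Quotient.mk (F n) u ⊗ₜ[K] Ideal.Quotient.mk (F n) u)
    rw [Algebra.TensorProduct.tmul_mul_tmul, map_mul, map_mul]

end Alg

end TensorSq

/-! ### The group of grouplike series -/

section Ad

variable {K : Type*} [CommRing K] {A B : Type*} [Ring A] [Algebra K A] [Ring B] [Algebra K B]

theorem Ad_apply (u : Aˣ) (a : A) : Ad (K := K) u a = u * a * (u⁻¹ : Aˣ) := rfl

theorem Ad_mul (u v : Aˣ) (a : A) : Ad (K := K) (u * v) a = Ad (K := K) u (Ad (K := K) v a) := by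
  simp [Ad_apply, mul_assoc]

end Ad

section Series

variable {K : Type*} [CommRing K] {G : Type*}

theorem substSeries_letter {B : Type*} [Ring B] [Algebra K B] {t : Set B}
    (b : Option G → Compl K t) (hb : ∀ i, b i ∈ Compl.filt K t 1) (i : Option G) :
    substSeries b hb (letter K i) = b i :=
  (extendAdic_of ..).trans (FreeAlgebra.lift_ι_apply ..)

theorem substSeries_filt {B : Type*} [Ring B] [Algebra K B] {t : Set B}
    (b : Option G → Compl K t) (hb : ∀ i, b i ∈ Compl.filt K t 1) (n : ℕ) :
    ∀ x ∈ filtX K G n, substSeries b hb x ∈ Compl.filt K t n :=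
  fun _ hx => extendAdic_filt _ _ _ _ hx

theorem series_ext {B : Type*} [Ring B] [Algebra K B] {t : Set B}
    (f g : NCSeries K G →ₐ[K] Compl K t) (hf : ∀ n, ∀ x ∈ filtX K G n, f x ∈ Compl.filt K t n)
    (hg : ∀ n, ∀ x ∈ filtX K G n, g x ∈ Compl.filt K t n)
    (h : ∀ i, f (letter K i) = g (letter K i)) : f = g := by
  refine Compl.endo_ext f g hf hg fun a => ?_
  have : f.comp (Compl.of _) = g.comp (Compl.of _) := FreeAlgebra.hom_ext (funext h)
  exact DFunLike.congr_fun this a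

theorem comp_filt {A B C : Type*} [Ring A] [Algebra K A] [Ring B] [Algebra K B] [Ring C]
    [Algebra K C] {r : Set A} {s : Set B} {t : Set C} {f : Compl K s →ₐ[K] Compl K t}
    {g : Compl K r →ₐ[K] Compl K s} (hf : ∀ n, ∀ x ∈ Compl.filt K s n, f x ∈ Compl.filt K t n)
    (hg : ∀ n, ∀ x ∈ Compl.filt K r n, g x ∈ Compl.filt K s n) (n : ℕ) :
    ∀ x ∈ Compl.filt K r n, f.comp g x ∈ Compl.filt K t n :=
  fun x hx => hf n _ (hg n x hx)

theorem series_limAlg_ext {D : Type*} [Ring D] [Algebra K D] {C : ℕ → Type*} [∀ n, Ring (C n)]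
    [∀ n, Algebra K (C n)] {p : ∀ n, D →ₐ[K] C n}
    (f g : NCSeries K G →ₐ[K] limAlg p) (σ : ℕ → ℕ)
    (hf : ∀ n, ∀ x ∈ filtX K G (σ n), limProj p n (f x) = 0)
    (hg : ∀ n, ∀ x ∈ filtX K G (σ n), limProj p n (g x) = 0)
    (h : ∀ i, f (letter K i) = g (letter K i)) : f = g := by
  have : f.comp (Compl.of _) = g.comp (Compl.of _) := FreeAlgebra.hom_ext (funext h)
  refine AlgHom.ext fun x => limAlg_ext (p := p) fun n => ?_
  exact LinearMap.congr_fun (Compl.linearMap_ext ((limProj p n).toLinearMap.comp f.toLinearMap)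
    ((limProj p n).toLinearMap.comp g.toLinearMap) (σ n) (hf n) (hg n)
    fun a => congrArg (limProj p n) (DFunLike.congr_fun this a)) x

/-- The modulus is `2 * n` because a coproduct respects only the total degree: a tensor of total
degree at least `2 * n` has a factor of degree at least `n`, hence vanishes in the component of
index `n`. -/
theorem series_tensor_ext (f g : NCSeries K G →ₐ[K] complTensorAlg K (filtX K G))
    (hf : ∀ n, ∀ x ∈ filtX K G (2 * n), limProj _ n (f x) = 0)
    (hg : ∀ n, ∀ x ∈ filtX K G (2 * n), limProj _ n (g x) = 0)
    (h : ∀ i, f (letter K i) = g (letter K i)) : f = g :=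
  series_limAlg_ext f g (fun n => 2 * n) hf hg h

theorem exists_sub_algebraMap_mem (x : NCSeries K G) :
    ∃ c : K, x - algebraMap K _ c ∈ filtX K G 1 := by
  obtain ⟨a, ha⟩ := Compl.exists_sub_of_mem x 1
  suffices h : ∃ c : K, (Compl.of _ a : NCSeries K G) - algebraMap K _ c ∈ filtX K G 1 by
    obtain ⟨c, hc⟩ := h
    exact ⟨c, by simpa using add_mem ha hc⟩
  clear ha
  induction a using FreeAlgebra.induction with
  | grade0 r => exact ⟨r, by simp⟩
  | grade1 i => exact ⟨0, by rw [map_zero, sub_zero]; exact letter_mem i⟩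
  | mul a b ha hb =>
    obtain ⟨c, hc⟩ := ha
    obtain ⟨d, hd⟩ := hb
    refine ⟨c * d, ?_⟩
    have e : ∀ x y u v : NCSeries K G, x * y - u * v = (x - u) * y + u * (y - v) := by
      intros
      noncomm_ring
    rw [map_mul, map_mul, e]
    exact add_mem (Ideal.mul_mem_right _ _ hc) (Ideal.mul_mem_left _ _ hd)
  | add a b ha hb =>
    obtain ⟨c, hc⟩ := ha
    obtain ⟨d, hd⟩ := hb
    refine ⟨c + d, ?_⟩
    rw [map_add, map_add, add_sub_add_comm]
    exact add_mem hc hd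

theorem DeltaX_letter (i : Option G) : DeltaX (letter K i) =
    tmulHat (filtX K G) (letter K i) 1 + tmulHat (filtX K G) 1 (letter K i) :=
  FreeAlgebra.lift_ι_apply _ _

theorem limProj_DeltaX (n : ℕ) (x : NCSeries K G) (hx : x ∈ filtX K G (2 * n)) :
    limProj _ n (DeltaX x) = 0 :=
  limProj_extend _ _ _ hx

theorem limProj_DeltaX_comp (f : NCSeries K G →ₐ[K] NCSeries K G)
    (hf : ∀ n, ∀ x ∈ filtX K G n, f x ∈ filtX K G n) (n : ℕ) (x : NCSeries K G)
    (hx : x ∈ filtX K G (2 * n)) : limProj _ n (DeltaX.comp f x) = 0 := by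
  rw [AlgHom.comp_apply]
  exact limProj_DeltaX n _ (hf _ x hx)

theorem limProj_tensorSqHom_DeltaX (f : NCSeries K G →ₐ[K] NCSeries K G)
    (hf : ∀ n, ∀ x ∈ filtX K G n, f x ∈ filtX K G n) (n : ℕ) (x : NCSeries K G)
    (hx : x ∈ filtX K G (2 * n)) : limProj _ n ((tensorSqHom f hf).comp DeltaX x) = 0 := by
  rw [AlgHom.comp_apply]
  exact tensorSqHom_limProj_eq_zero f hf _ (limProj_DeltaX n x hx)

/-- Both sides are continuous algebra morphisms in `x`, so the comparison takes place on the
letters, where it says that their images are primitive. -/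
theorem DeltaX_map (f : NCSeries K G →ₐ[K] NCSeries K G)
    (hf : ∀ n, ∀ x ∈ filtX K G n, f x ∈ filtX K G n)
    (h : ∀ i, DeltaX (f (letter K i)) =
      tmulHat (filtX K G) (f (letter K i)) 1 + tmulHat (filtX K G) 1 (f (letter K i)))
    (x : NCSeries K G) : DeltaX (f x) = tensorSqHom f hf (DeltaX x) := by
  have h' : ∀ i, DeltaX (f (letter K i)) = tensorSqHom f hf (DeltaX (letter K i)) := fun i => by
    rw [h, DeltaX_letter, map_add, tensorSqHom_tmulHat, tensorSqHom_tmulHat, map_one]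
  have key : DeltaX.comp f = (tensorSqHom f hf).comp DeltaX :=
    series_tensor_ext (DeltaX.comp f) ((tensorSqHom f hf).comp DeltaX) (limProj_DeltaX_comp f hf)
      (limProj_tensorSqHom_DeltaX f hf) h'
  rw [← AlgHom.comp_apply, key, AlgHom.comp_apply]

/-- Grouplike series. -/
def IsGroupLike (x : NCSeries K G) : Prop := DeltaX x = tmulHat (filtX K G) x x

theorem IsGroupLike.one : IsGroupLike (1 : NCSeries K G) := by
  rw [IsGroupLike, map_one, tmulHat_one]

theorem IsGroupLike.mul {x y : NCSeries K G} (hx : IsGroupLike x) (hy : IsGroupLike y) :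
    IsGroupLike (x * y) := by
  rw [IsGroupLike, map_mul, hx, hy, tmulHat_mul]

/-- Both sides are inverses of `DeltaX u`. -/
theorem IsGroupLike.inv {u : (NCSeries K G)ˣ} (hu : IsGroupLike (u : NCSeries K G)) :
    IsGroupLike ((u⁻¹ : (NCSeries K G)ˣ) : NCSeries K G) := by
  have h1 : DeltaX ((u⁻¹ : (NCSeries K G)ˣ) : NCSeries K G) * DeltaX (u : NCSeries K G) = 1 := by
    rw [← map_mul, Units.inv_mul, map_one]
  rw [hu] at h1
  refine left_inv_eq_right_inv h1 ?_
  rw [tmulHat_mul, Units.mul_inv, tmulHat_one]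

variable [CommGroup G]

theorem tAct_letter (g : G) (i : Option G) :
    tAct g (letter K i) = letter K (i.map (g * ·)) := substSeries_letter _ _ _

theorem tAct_filt (g : G) (n : ℕ) : ∀ x ∈ filtX K G n, tAct g x ∈ filtX K G n :=
  substSeries_filt _ _ n

theorem tAct_one (x : NCSeries K G) : tAct 1 x = x := by
  refine DFunLike.congr_fun (series_ext (tAct (1 : G)) (AlgHom.id K _) (tAct_filt 1)
    (fun _ _ h => h) fun i => ?_) x
  rw [tAct_letter]
  cases i <;> simp

theorem tAct_tAct (g h : G) (x : NCSeries K G) : tAct g (tAct h x) = tAct (g * h) x := by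
  have key : (tAct (K := K) g).comp (tAct h) = tAct (g * h) := by
    refine series_ext _ _ (comp_filt (tAct_filt g) (tAct_filt h)) (tAct_filt _) fun i => ?_
    rw [AlgHom.comp_apply, tAct_letter, tAct_letter, tAct_letter]
    cases i <;> simp [mul_assoc]
  rw [← key, AlgHom.comp_apply]

theorem autX_letter (Ψ : (NCSeries K G)ˣ) (i : Option G) :
    autX Ψ (letter K i) = autXLetter Ψ i := substSeries_letter _ _ _

theorem autX_filt (Ψ : (NCSeries K G)ˣ) (n : ℕ) : ∀ x ∈ filtX K G n, autX Ψ x ∈ filtX K G n :=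
  substSeries_filt _ _ n

theorem autXLetter_none (Ψ : (NCSeries K G)ˣ) : autXLetter Ψ none = letter K none := rfl

theorem autXLetter_some (Ψ : (NCSeries K G)ˣ) (g : G) : autXLetter Ψ (some g) =
    tAct g ((Ψ⁻¹ : (NCSeries K G)ˣ) : NCSeries K G) * letter K (some g) *
      tAct g (Ψ : NCSeries K G) := rfl

/-- On `x_h` this is `t_g t_h = t_{gh}` applied to `Ψ` and `Ψ⁻¹`. -/
theorem tAct_autX (g : G) (Ψ : (NCSeries K G)ˣ) (x : NCSeries K G) :
    tAct g (autX Ψ x) = autX Ψ (tAct g x) := by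
  have key : (tAct g).comp (autX Ψ) = (autX Ψ).comp (tAct g) := by
    refine series_ext _ _ (comp_filt (tAct_filt g) (autX_filt Ψ))
      (comp_filt (autX_filt Ψ) (tAct_filt g)) fun i => ?_
    rw [AlgHom.comp_apply, AlgHom.comp_apply, tAct_letter, autX_letter, autX_letter]
    cases i with
    | none => rw [autXLetter_none, tAct_letter, Option.map_none, autXLetter_none]
    | some h =>
      rw [autXLetter_some, Option.map_some, autXLetter_some, map_mul, map_mul, tAct_letter,
        tAct_tAct, tAct_tAct, Option.map_some]
  rw [← AlgHom.comp_apply, key, AlgHom.comp_apply]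

/-- The product `Ψ aut_Ψ(Φ)` as a unit. -/
def circ (Ψ Φ : (NCSeries K G)ˣ) : (NCSeries K G)ˣ := Ψ * Units.map (autX Ψ).toMonoidHom Φ

theorem circ_val (Ψ Φ : (NCSeries K G)ˣ) :
    (circ Ψ Φ : NCSeries K G) = Ψ * autX Ψ Φ := rfl

theorem circ_inv_val (Ψ Φ : (NCSeries K G)ˣ) : (((circ Ψ Φ)⁻¹ : (NCSeries K G)ˣ) : NCSeries K G) =
    autX Ψ ((Φ⁻¹ : (NCSeries K G)ˣ) : NCSeries K G) * ((Ψ⁻¹ : (NCSeries K G)ˣ) : NCSeries K G) := by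
  rw [circ, mul_inv_rev]
  rfl

/-- On `x_g`, conjugation by `t_g(Ψ aut_Ψ(Φ))` splits into the conjugation by `t_g(Ψ)` coming from
`aut_Ψ(x_g)` and that by `t_g(aut_Ψ(Φ)) = aut_Ψ(t_g(Φ))`. -/
theorem autX_circ (Ψ Φ : (NCSeries K G)ˣ) (x : NCSeries K G) :
    autX (circ Ψ Φ) x = autX Ψ (autX Φ x) := by
  have key : autX (circ Ψ Φ) = (autX Ψ).comp (autX Φ) := by
    refine series_ext _ _ (autX_filt _) (comp_filt (autX_filt Ψ) (autX_filt Φ)) fun i => ?_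
    rw [AlgHom.comp_apply, autX_letter, autX_letter]
    cases i with
    | none => rw [autXLetter_none, autXLetter_none, autX_letter, autXLetter_none]
    | some g =>
      rw [autXLetter_some, autXLetter_some, map_mul, map_mul, autX_letter, autXLetter_some,
        circ_val, circ_inv_val, map_mul, map_mul, tAct_autX, tAct_autX]
      simp only [mul_assoc]
  rw [key, AlgHom.comp_apply]

theorem circ_assoc (Ψ Φ Θ : (NCSeries K G)ˣ) : circ (circ Ψ Φ) Θ = circ Ψ (circ Φ Θ) := by
  ext
  simp only [circ_val, autX_circ, map_mul, mul_assoc]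

theorem circ_one (Ψ : (NCSeries K G)ˣ) : circ Ψ 1 = Ψ := by
  rw [circ, map_one, mul_one]

/-- Unipotence of `aut_Ψ`: conjugation by a unit changes a letter only in degree at least `2`,
because the constant term of the unit is central. -/
theorem autX_sub_mem (Ψ : (NCSeries K G)ˣ) (n : ℕ) (x : NCSeries K G) (hx : x ∈ filtX K G n) :
    autX Ψ x - x ∈ filtX K G (n + 1) := by
  -- The elements for which the claim holds form a multiplicative filtration, so for the
  -- noncommutative polynomials it suffices to treat the letters.
  let H : ℕ → Submodule K (NCSeries K G) := fun n =>
    (filtX K G n).restrictScalars K ⊓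
      ((filtX K G (n + 1)).restrictScalars K).comap ((autX Ψ).toLinearMap - LinearMap.id)
  have hH : ∀ n x, x ∈ H n ↔ x ∈ filtX K G n ∧ autX Ψ x - x ∈ filtX K G (n + 1) :=
    fun n x => Iff.rfl
  have h0 : H 0 = ⊤ := by
    rw [eq_top_iff]
    intro x _
    refine ⟨Compl.filt_zero x, ?_⟩
    obtain ⟨c, hc⟩ := exists_sub_algebraMap_mem x
    have := sub_mem (autX_filt Ψ 1 _ hc) hc
    simpa using this
  have hmul : ∀ i j, ∀ x ∈ H i, ∀ y ∈ H j, x * y ∈ H (i + j) := by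
    intro i j x hx y hy
    obtain ⟨hx, hx'⟩ := (hH _ _).1 hx
    obtain ⟨hy, hy'⟩ := (hH _ _).1 hy
    refine (hH _ _).2 ⟨Compl.filt_mul hx hy, ?_⟩
    have e : autX Ψ (x * y) - x * y = (autX Ψ x - x) * autX Ψ y + x * (autX Ψ y - y) := by
      rw [map_mul]
      noncomm_ring
    rw [e]
    refine add_mem ?_ (Compl.filt_mul (i := i) (j := j + 1) hx hy')
    rw [add_right_comm]
    exact Compl.filt_mul hx' (autX_filt Ψ _ _ hy)
  have key := map_genIdeal_pow (Compl.of (K := K) (lettersX K G)) (lettersX K G) H h0 hmul (by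
    rintro _ ⟨i, rfl⟩
    change letter K i ∈ H 1
    refine (hH _ _).2 ⟨letter_mem i, ?_⟩
    rw [autX_letter]
    cases i with
    | none => simp [autXLetter]
    | some g =>
      rw [autXLetter, Ad_apply]
      set u := Units.map (tAct (K := K) g).toMonoidHom Ψ⁻¹
      set y := letter K (some g)
      obtain ⟨c, hc⟩ := exists_sub_algebraMap_mem (u : NCSeries K G)
      -- The difference is a commutator with `u` times `u⁻¹`, and in the commutator `u` can be
      -- replaced by `u - c`, which has positive degree.
      have e : (u : NCSeries K G) * y * (u⁻¹ : (NCSeries K G)ˣ) - y =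
          ((u - algebraMap K _ c) * y - y * (u - algebraMap K _ c)) *
            (u⁻¹ : (NCSeries K G)ˣ) := by
        rw [sub_mul _ _ y, mul_sub, Algebra.commutes c y, sub_sub_sub_cancel_right, sub_mul,
          mul_assoc y, Units.mul_inv, mul_one]
      rw [e]
      exact Ideal.mul_mem_right _ _ (sub_mem (Compl.filt_mul hc (letter_mem _))
        (Compl.filt_mul (letter_mem _) hc)))
  obtain ⟨a, ha, hxa⟩ := Compl.exists_mem_adic_sub_of_mem hx (n + 1)
  have := add_mem ((hH _ _).1 (key n a ha)).2 (sub_mem (autX_filt Ψ _ _ hxa) hxa)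
  convert this using 1
  rw [map_sub]
  abel

/-- If `x` has degree at least `m < n`, then `x = aut_Ψ(x) - (aut_Ψ(x) - x)` has degree at least `m
+ 1`. -/
theorem mem_filt_of_autX_mem (Ψ : (NCSeries K G)ˣ) {n : ℕ} {x : NCSeries K G}
    (hx : autX Ψ x ∈ filtX K G n) : x ∈ filtX K G n := by
  suffices h : ∀ m ≤ n, x ∈ filtX K G m from h n le_rfl
  intro m hm
  induction m with
  | zero => exact Compl.filt_zero x
  | succ m ih =>
    have := sub_mem (Compl.filt_anti hm hx) (autX_sub_mem Ψ m x (ih (by omega)))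
    simpa using this

theorem autX_bijective (Ψ : (NCSeries K G)ˣ) : Function.Bijective (autX Ψ) := by
  constructor
  · rw [injective_iff_map_eq_zero]
    intro x hx
    refine Compl.eq_of_sub_mem fun n => ?_
    rw [sub_zero]
    refine mem_filt_of_autX_mem Ψ ?_
    rw [hx]
    exact zero_mem _
  · intro y
    -- Neumann series: the preimage of `y` is the sum of the `(1 - aut_Ψ)^n (y)`, which converges by
    -- unipotence; the sum over `i < n` of the `aut_Ψ (z i)` telescopes to `y - z n`.
    let z : ℕ → NCSeries K G := fun n => (fun x => x - autX Ψ x)^[n] y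
    have hz : ∀ n, z (n + 1) = z n - autX Ψ (z n) := fun n => Function.iterate_succ_apply' _ _ _
    have hz' : ∀ n, z n ∈ filtX K G n := by
      intro n
      induction n with
      | zero => exact Compl.filt_zero _
      | succ n ih =>
        rw [hz, ← neg_sub]
        exact neg_mem (autX_sub_mem Ψ n _ ih)
    obtain ⟨x, hx⟩ := Compl.exists_sum z hz'
    refine ⟨x, Compl.eq_of_sub_mem fun n => ?_⟩
    have h1 : ∑ i ∈ Finset.range n, autX Ψ (z i) = y - z n := by
      induction n with
      | zero => simp [z]
      | succ n ih =>
        rw [Finset.sum_range_succ, ih, hz]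
        abel
    have h2 := autX_filt Ψ n _ (hx n)
    rw [map_sub, map_sum, h1] at h2
    convert sub_mem h2 (hz' n) using 1
    abel

/-- The inverse of the automorphism `aut_Ψ`. -/
def autXInv (Ψ : (NCSeries K G)ˣ) : NCSeries K G →ₐ[K] NCSeries K G :=
  (AlgEquiv.ofBijective (autX Ψ) (autX_bijective Ψ)).symm.toAlgHom

theorem autX_autXInv (Ψ : (NCSeries K G)ˣ) (x : NCSeries K G) : autX Ψ (autXInv Ψ x) = x :=
  (AlgEquiv.ofBijective (autX Ψ) (autX_bijective Ψ)).apply_symm_apply x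

theorem autXInv_autX (Ψ : (NCSeries K G)ˣ) (x : NCSeries K G) : autXInv Ψ (autX Ψ x) = x :=
  (AlgEquiv.ofBijective (autX Ψ) (autX_bijective Ψ)).symm_apply_apply x

theorem autXInv_filt (Ψ : (NCSeries K G)ˣ) (n : ℕ) (x : NCSeries K G) (hx : x ∈ filtX K G n) :
    autXInv Ψ x ∈ filtX K G n :=
  mem_filt_of_autX_mem Ψ (by rwa [autX_autXInv])

theorem DeltaX_tAct (g : G) (x : NCSeries K G) :
    DeltaX (tAct g x) = tensorSqHom (tAct g) (tAct_filt g) (DeltaX x) :=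
  DeltaX_map _ _ (fun i => by rw [tAct_letter, DeltaX_letter]) x

theorem IsGroupLike.tAct {x : NCSeries K G} (hx : IsGroupLike x) (g : G) :
    IsGroupLike (tAct g x) := by
  rw [IsGroupLike, DeltaX_tAct, hx, tensorSqHom_tmulHat]

theorem DeltaX_autXLetter {Ψ : (NCSeries K G)ˣ} (hΨ : IsGroupLike (Ψ : NCSeries K G))
    (i : Option G) : DeltaX (autXLetter Ψ i) =
      tmulHat (filtX K G) (autXLetter Ψ i) 1 + tmulHat (filtX K G) 1 (autXLetter Ψ i) := by
  cases i with
  | none => rw [autXLetter_none, DeltaX_letter]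
  | some g =>
    have h1 := hΨ.inv.tAct g
    have h2 := hΨ.tAct g
    have h3 : tAct g ((Ψ⁻¹ : (NCSeries K G)ˣ) : NCSeries K G) *
        tAct g (Ψ : NCSeries K G) = 1 := by
      rw [← map_mul, Units.inv_mul, map_one]
    rw [IsGroupLike] at h1 h2
    rw [autXLetter_some, map_mul, map_mul, DeltaX_letter, h1, h2, mul_add, add_mul, tmulHat_mul,
      tmulHat_mul, tmulHat_mul, tmulHat_mul, mul_one, h3]

/-- Conjugating a primitive letter by a grouplike series leaves it primitive. -/
theorem DeltaX_autX {Ψ : (NCSeries K G)ˣ} (hΨ : IsGroupLike (Ψ : NCSeries K G))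
    (x : NCSeries K G) :
    DeltaX (autX Ψ x) = tensorSqHom (autX Ψ) (autX_filt Ψ) (DeltaX x) :=
  DeltaX_map _ _ (fun i => by rw [autX_letter, DeltaX_autXLetter hΨ]) x

theorem IsGroupLike.circ {Ψ Φ : (NCSeries K G)ˣ} (hΨ : IsGroupLike (Ψ : NCSeries K G))
    (hΦ : IsGroupLike (Φ : NCSeries K G)) : IsGroupLike (circ Ψ Φ : NCSeries K G) := by
  refine hΨ.mul ?_
  change IsGroupLike (autX Ψ (Φ : NCSeries K G))
  rw [IsGroupLike, DeltaX_autX hΨ, hΦ, tensorSqHom_tmulHat]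

theorem IsGroupLike.autXInv {Ψ : (NCSeries K G)ˣ} (hΨ : IsGroupLike (Ψ : NCSeries K G))
    {x : NCSeries K G} (hx : IsGroupLike x) : IsGroupLike (autXInv Ψ x) := by
  -- The tensor square of `aut_Ψ⁻¹` inverts that of `aut_Ψ`, so compatibility with the coproduct
  -- passes from `aut_Ψ` to its inverse.
  have inv : ∀ z : complTensorAlg K (filtX K G),
      tensorSqHom (DoubleShuffle.autXInv Ψ) (autXInv_filt Ψ)
        (tensorSqHom (autX Ψ) (autX_filt Ψ) z) = z := by
    intro z
    apply Subtype.ext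
    refine (tensorSqMap_tensorSqMap _ _ _ _ _).trans ?_
    exact tensorSqMap_of_eq_id _ _ (autXInv_autX Ψ) _
  rw [IsGroupLike, ← inv (DeltaX _), ← DeltaX_autX hΨ, autX_autXInv, hx, tensorSqHom_tmulHat]

/-- The inverse of `Ψ` for the product `⊛`. -/
def circInv (Ψ : (NCSeries K G)ˣ) : (NCSeries K G)ˣ := Units.map (autXInv Ψ).toMonoidHom Ψ⁻¹

theorem circ_circInv (Ψ : (NCSeries K G)ˣ) : circ Ψ (circInv Ψ) = 1 := by
  ext
  change (Ψ : NCSeries K G) * autX Ψ (autXInv Ψ (Ψ⁻¹ : (NCSeries K G)ˣ)) = 1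
  rw [autX_autXInv, Units.mul_inv]

/-- The group of grouplike series, for the product `⊛`. -/
abbrev grpLikeGroup (K : Type*) [CommRing K] (G : Type*) [CommGroup G] : Group (GrpLike K G) :=
  letI : Mul (GrpLike K G) := ⟨fun Ψ Φ => ⟨circ Ψ.1 Φ.1, IsGroupLike.circ Ψ.2 Φ.2⟩⟩
  letI : One (GrpLike K G) := ⟨⟨1, IsGroupLike.one⟩⟩
  letI : Inv (GrpLike K G) := ⟨fun Ψ => ⟨circInv Ψ.1,
    IsGroupLike.autXInv (Ψ := Ψ.1) Ψ.2 (IsGroupLike.inv (u := Ψ.1) Ψ.2)⟩⟩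
  Group.ofRightAxioms (fun Ψ Φ Θ => Subtype.ext (circ_assoc Ψ.1 Φ.1 Θ.1))
    (fun Ψ => Subtype.ext (circ_one Ψ.1)) (fun Ψ => Subtype.ext (circ_circInv Ψ.1))

end Series

/-! ### Coefficients of noncommutative series -/

section Coeff

variable {K : Type*} [CommRing K] {G : Type*}

theorem coeffX_of (w : FreeMonoid (Option G)) (a : FreeX K G) :
    coeffX w (Compl.of (lettersX K G) a) =
      (FreeAlgebra.equivMonoidAlgebraFreeMonoid a).coeff w := rfl

theorem coeffX_eq_zero (w : FreeMonoid (Option G)) (x : NCSeries K G)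
    (hx : x ∈ filtX K G (w.length + 1)) : coeffX w x = 0 := by
  change quotLift (adic (lettersX K G) (w.length + 1)) _ (word_coeff_eq_zero w) (Compl.proj _ (w.length + 1) x) = 0
  rw [Compl.mem_filt.1 hx, map_zero]

/-- The factorizations `w = u * v` in the free monoid are the cuts of `w` into a prefix and a
suffix, one for each length of the prefix. -/
theorem coeff_mul_split (w : FreeMonoid (Option G))
    (x y : MonoidAlgebra K (FreeMonoid (Option G))) :
    (x * y).coeff w = ∑ i ∈ Finset.range (w.length + 1),
      x.coeff (FreeMonoid.ofList (w.toList.take i)) *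
        y.coeff (FreeMonoid.ofList (w.toList.drop i)) := by
  classical
  rw [MonoidAlgebra.coeff_mul_antidiag x y w ((Finset.range (w.length + 1)).image fun i =>
    (FreeMonoid.ofList (w.toList.take i), FreeMonoid.ofList (w.toList.drop i)))]
  · rw [Finset.sum_image]
    intro i hi j hj h
    have h1 := congrArg (fun p => p.1.toList.length) h
    simp only [FreeMonoid.toList_ofList, List.length_take] at h1
    have hi' := Finset.mem_range.1 hi
    have hj' := Finset.mem_range.1 hj
    change i < w.toList.length + 1 at hi'
    change j < w.toList.length + 1 at hj'
    omega
  · rintro ⟨u, v⟩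
    rw [Finset.mem_image]
    constructor
    · rintro ⟨i, _, h⟩
      rw [Prod.mk.injEq] at h
      rw [← h.1, ← h.2, ← FreeMonoid.ofList_append, List.take_append_drop, FreeMonoid.ofList_toList]
    · rintro rfl
      refine ⟨u.length, ?_, ?_⟩
      · rw [Finset.mem_range, FreeMonoid.length_mul]
        dsimp only
        omega
      · change (FreeMonoid.ofList ((u.toList ++ v.toList).take u.toList.length),
          FreeMonoid.ofList ((u.toList ++ v.toList).drop u.toList.length)) = (u, v)
        rw [List.take_left, List.drop_left, FreeMonoid.ofList_toList, FreeMonoid.ofList_toList]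

theorem coeffX_mul (w : FreeMonoid (Option G)) (x y : NCSeries K G) :
    coeffX w (x * y) = ∑ i ∈ Finset.range (w.length + 1),
      coeffX (FreeMonoid.ofList (w.toList.take i)) x *
        coeffX (FreeMonoid.ofList (w.toList.drop i)) y := by
  have hlen1 : ∀ i, (FreeMonoid.ofList (w.toList.take i)).length + 1 ≤ w.length + 1 := fun i => by
    change (w.toList.take i).length + 1 ≤ w.toList.length + 1
    rw [List.length_take]
    omega
  have hlen2 : ∀ i, (FreeMonoid.ofList (w.toList.drop i)).length + 1 ≤ w.length + 1 := fun i => by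
    change (w.toList.drop i).length + 1 ≤ w.toList.length + 1
    rw [List.length_drop]
    omega
  -- Extension by continuity in one variable at a time: here the left factor is a polynomial and the
  -- right one arbitrary; then the right factor is fixed and the left one varies.
  have key1 : ∀ (a : FreeX K G), (coeffX w).comp (LinearMap.mulLeft K (Compl.of _ a)) =
      ∑ i ∈ Finset.range (w.length + 1),
        coeffX (FreeMonoid.ofList (w.toList.take i)) (Compl.of (lettersX K G) a) •
          coeffX (FreeMonoid.ofList (w.toList.drop i)) := by
    intro a
    refine Compl.linearMap_ext _ _ (w.length + 1) (fun x hx => ?_) (fun x hx => ?_) fun b => ?_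
    · exact coeffX_eq_zero w _ (Ideal.mul_mem_left _ _ hx)
    · rw [LinearMap.sum_apply]
      refine Finset.sum_eq_zero fun i _ => ?_
      rw [LinearMap.smul_apply, coeffX_eq_zero _ _ (Compl.filt_anti (hlen2 i) hx), smul_zero]
    · rw [LinearMap.sum_apply, LinearMap.comp_apply, LinearMap.mulLeft_apply, ← map_mul, coeffX_of,
        map_mul, coeff_mul_split]
      rfl
  have key2 : (coeffX w).comp (LinearMap.mulRight K y) =
      ∑ i ∈ Finset.range (w.length + 1),
        coeffX (FreeMonoid.ofList (w.toList.drop i)) y •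
          coeffX (FreeMonoid.ofList (w.toList.take i)) := by
    refine Compl.linearMap_ext _ _ (w.length + 1) (fun x hx => ?_) (fun x hx => ?_) fun a => ?_
    · exact coeffX_eq_zero w _ (Ideal.mul_mem_right _ _ hx)
    · rw [LinearMap.sum_apply]
      refine Finset.sum_eq_zero fun i _ => ?_
      rw [LinearMap.smul_apply, coeffX_eq_zero _ _ (Compl.filt_anti (hlen1 i) hx), smul_zero]
    · have := LinearMap.congr_fun (key1 a) y
      rw [LinearMap.sum_apply] at this ⊢
      refine this.trans (Finset.sum_congr rfl fun i _ => ?_)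
      exact mul_comm _ _
  have := LinearMap.congr_fun key2 x
  rw [LinearMap.sum_apply] at this
  refine this.trans (Finset.sum_congr rfl fun i _ => ?_)
  exact mul_comm _ _

/-- The word `x₀ ^ n`. -/
def wordZero (G : Type*) (n : ℕ) : FreeMonoid (Option G) := FreeMonoid.of none ^ n

theorem toList_wordZero (n : ℕ) : (wordZero G n).toList = List.replicate n none := by
  induction n with
  | zero => rfl
  | succ n ih =>
    rw [wordZero, pow_succ', FreeMonoid.toList_mul, List.replicate_succ, ← ih]
    rfl

theorem wordZero_eq (n : ℕ) : wordZero G n = FreeMonoid.ofList (List.replicate n none) := by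
  rw [← toList_wordZero, FreeMonoid.ofList_toList]

/-- The series `∑ (Ψ | x₀ ^ n) x ^ n`. -/
def abelSeries (Ψ : NCSeries K G) : PowerSeries K := PowerSeries.mk fun n => coeffX (wordZero G n) Ψ

theorem coeff_abelSeries (n : ℕ) (Ψ : NCSeries K G) :
    PowerSeries.coeff n (abelSeries Ψ) = coeffX (wordZero G n) Ψ := PowerSeries.coeff_mk _ _

theorem coeffX_letter (w : FreeMonoid (Option G)) (i : Option G) [Decidable (FreeMonoid.of i = w)] :
    coeffX w (letter K i) = if FreeMonoid.of i = w then 1 else 0 := by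
  classical
  rw [letter, coeffX_of]
  have : FreeAlgebra.equivMonoidAlgebraFreeMonoid (FreeAlgebra.ι K i) =
      MonoidAlgebra.of K _ (FreeMonoid.of i) := by
    simp [FreeAlgebra.equivMonoidAlgebraFreeMonoid]
  rw [this, MonoidAlgebra.of_apply, MonoidAlgebra.coeff_single,
    Finsupp.single_apply]

theorem coeffX_one (w : FreeMonoid (Option G)) [Decidable (1 = w)] :
    coeffX w (1 : NCSeries K G) = if 1 = w then 1 else 0 := by
  classical
  rw [← map_one (Compl.of (lettersX K G)), coeffX_of, map_one, MonoidAlgebra.one_def,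
    MonoidAlgebra.coeff_single,
    Finsupp.single_apply]

/-- Every prefix and every suffix of `x₀ ^ n` is a power of `x₀`. -/
theorem abelSeries_mul (x y : NCSeries K G) :
    abelSeries (x * y) = abelSeries x * abelSeries y := by
  ext n
  rw [coeff_abelSeries, coeffX_mul, PowerSeries.coeff_mul,
    Finset.Nat.sum_antidiagonal_eq_sum_range_succ_mk]
  have hl : (wordZero G n).length = n := by
    change (wordZero G n).toList.length = n
    rw [toList_wordZero, List.length_replicate]
  rw [hl]
  refine Finset.sum_congr rfl fun i hi => ?_
  have hi' : min i n = i := by have := Finset.mem_range.1 hi; omega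
  rw [coeff_abelSeries, coeff_abelSeries, toList_wordZero, List.take_replicate,
    List.drop_replicate, hi', wordZero_eq, wordZero_eq]

/-- The algebra morphism `x₀ ↦ x`, `x_g ↦ 0`. -/
def abelHom (K : Type*) [CommRing K] (G : Type*) : NCSeries K G →ₐ[K] PowerSeries K :=
  AlgHom.ofLinearMap
    { toFun := abelSeries
      map_add' := fun x y => by ext n; simp [coeff_abelSeries]
      map_smul' := fun c x => by ext n; simp [coeff_abelSeries] }
    (by
      classical
      ext n
      refine (coeff_abelSeries (K := K) (G := G) n 1).trans ?_
      rw [coeffX_one, PowerSeries.coeff_one]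
      refine if_congr ?_ rfl rfl
      rw [← FreeMonoid.toList.injective.eq_iff, toList_wordZero, FreeMonoid.toList_one]
      cases n <;> simp [List.replicate_succ])
    abelSeries_mul

theorem coeff_abelHom (n : ℕ) (Ψ : NCSeries K G) :
    PowerSeries.coeff n (abelHom K G Ψ) = coeffX (wordZero G n) Ψ := coeff_abelSeries n Ψ

theorem abelHom_letter_some (g : G) : abelHom K G (letter K (some g)) = 0 := by
  classical
  ext n
  rw [coeff_abelHom, coeffX_letter, if_neg, map_zero]
  intro h
  have h' := congrArg FreeMonoid.toList h
  rw [toList_wordZero, FreeMonoid.toList_of] at h'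
  cases n <;> simp [List.replicate_succ] at h'

/-- The constant term. -/
def constX (K : Type*) [CommRing K] (G : Type*) : NCSeries K G →ₐ[K] K :=
  AlgHom.ofLinearMap (PowerSeries.coeff 0 ∘ₗ (abelHom K G).toLinearMap)
    (by simp) (by simp)

theorem constX_apply (x : NCSeries K G) :
    constX K G x = PowerSeries.constantCoeff (abelHom K G x) := by
  change PowerSeries.coeff 0 (abelHom K G x) = _
  exact PowerSeries.coeff_zero_eq_constantCoeff_apply (abelHom K G x)

theorem constX_eq_coeffX (x : NCSeries K G) : constX K G x = coeffX 1 x := coeff_abelHom 0 x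

theorem constX_eq_zero (x : NCSeries K G) (hx : x ∈ filtX K G 1) : constX K G x = 0 := by
  rw [constX_eq_coeffX]
  exact coeffX_eq_zero _ _ hx

theorem sub_constX_mem (x : NCSeries K G) :
    x - algebraMap K _ (constX K G x) ∈ filtX K G 1 := by
  obtain ⟨c, hc⟩ := exists_sub_algebraMap_mem x
  have := constX_eq_zero _ hc
  rw [map_sub, AlgHom.commutes, Algebra.algebraMap_self_apply, sub_eq_zero] at this
  rwa [this]

theorem limProj_DeltaX_sub (n : ℕ) (x y : NCSeries K G) :
    limProj _ n (DeltaX (x - y)) = limProj _ n (DeltaX x) - limProj _ n (DeltaX y) :=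
  map_sub ((limProj _ n).toLinearMap ∘ₗ (DeltaX (K := K) (G := G)).toLinearMap) x y

/-- Sharper than `limProj_DeltaX`, which would require degree at least `2`: modulo positive degree
in each factor, both terms of the coproduct of a letter vanish. -/
theorem limProj_one_DeltaX (x : NCSeries K G) (hx : x ∈ filtX K G 1) :
    limProj _ 1 (DeltaX x) = 0 := by
  obtain ⟨a, ha, hxa⟩ := Compl.exists_mem_adic_sub_of_mem hx (2 * 1)
  have h1 := limProj_DeltaX 1 _ hxa
  rw [limProj_DeltaX_sub, sub_eq_zero] at h1
  rw [h1]
  -- The filtration that is everything in index `0` and zero afterwards turns the vanishing on the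
  -- letters into vanishing on the ideal that they generate.
  have := map_genIdeal_pow ((limProj _ 1).comp (DeltaX.comp (Compl.of (K := K) (lettersX K G))))
    (lettersX K G) (fun k => if k = 0 then ⊤ else ⊥) (by simp) (by
      intro i j x hx y hy
      by_cases hi : i = 0 <;> by_cases hj : j = 0 <;> simp_all) (by
      rintro _ ⟨i, rfl⟩
      change limProj _ 1 (DeltaX (letter K i)) = 0
      rw [DeltaX_letter]
      change Ideal.Quotient.mk _ (letter K i) ⊗ₜ[K] Ideal.Quotient.mk _ 1 +
        Ideal.Quotient.mk _ 1 ⊗ₜ[K] Ideal.Quotient.mk _ (letter K i) = 0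
      rw [Ideal.Quotient.eq_zero_iff_mem.2 (letter_mem i), TensorProduct.zero_tmul,
        TensorProduct.tmul_zero, add_zero]) 1 a ha
  rw [if_neg one_ne_zero, Submodule.mem_bot] at this
  exact this

/-- Modulo positive degree in each factor, the two sides of the grouplike condition become `c` and
`c * c`, where `c` is the constant term; since `c` is a unit, it is `1`. -/
theorem IsGroupLike.constX_eq_one {Ψ : (NCSeries K G)ˣ} (hΨ : IsGroupLike (Ψ : NCSeries K G)) :
    constX K G Ψ = 1 := by
  set c := constX K G Ψ with hc
  have h1 := limProj_one_DeltaX _ (sub_constX_mem (Ψ : NCSeries K G))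
  rw [limProj_DeltaX_sub, hΨ, AlgHom.commutes, AlgHom.commutes, sub_eq_zero] at h1
  have h2 : Ideal.Quotient.mk (filtX K G 1) (Ψ : NCSeries K G) ⊗ₜ[K]
      Ideal.Quotient.mk (filtX K G 1) (Ψ : NCSeries K G) =
      Ideal.Quotient.mk (filtX K G 1) (algebraMap K _ c) ⊗ₜ[K]
      Ideal.Quotient.mk (filtX K G 1) 1 := h1
  let ε : NCSeries K G ⧸ filtX K G 1 →ₗ[K] K :=
    quotLift (filtX K G 1) (constX K G).toLinearMap constX_eq_zero
  have h3 := congrArg (TensorProduct.lid K K ∘ TensorProduct.map ε ε) h2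
  have h4 : c * c = c * 1 := by
    have e1 : ε (Ideal.Quotient.mk (filtX K G 1) (Ψ : NCSeries K G)) = c := rfl
    have e2 : ε (Ideal.Quotient.mk (filtX K G 1) 1) = 1 := map_one (constX K G)
    have e3 : ε (Ideal.Quotient.mk (filtX K G 1) (algebraMap K _ c)) = c :=
      (constX K G).commutes c
    simpa only [Function.comp_apply, TensorProduct.map_tmul, TensorProduct.lid_tmul, smul_eq_mul,
      e1, e2, e3] using h3
  exact (Ψ.isUnit.map (constX K G)).mul_left_cancel h4

/-- The word `x₀ ^ n x₁`. -/
def wordOne (G : Type*) [One G] (n : ℕ) : FreeMonoid (Option G) :=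
  FreeMonoid.of none ^ n * FreeMonoid.of (some 1)

theorem toList_wordOne [One G] (n : ℕ) :
    (wordOne G n).toList = List.replicate n none ++ [some 1] := by
  rw [wordOne, FreeMonoid.toList_mul, FreeMonoid.toList_of, ← toList_wordZero]
  rfl

theorem wordOne_eq [One G] (n : ℕ) :
    wordOne G n = FreeMonoid.ofList (List.replicate n none ++ [some 1]) := by
  rw [← toList_wordOne, FreeMonoid.ofList_toList]

/-- The series `∑ (Ψ | x₀ ^ n x₁) x ^ n`. -/
def depthOne (K : Type*) [CommRing K] (G : Type*) [One G] : NCSeries K G →ₗ[K] PowerSeries K where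
  toFun Ψ := PowerSeries.mk fun n => coeffX (wordOne G n) Ψ
  map_add' x y := by ext n; simp
  map_smul' c x := by ext n; simp

theorem coeff_depthOne [One G] (n : ℕ) (Ψ : NCSeries K G) :
    PowerSeries.coeff n (depthOne K G Ψ) = coeffX (wordOne G n) Ψ :=
  PowerSeries.coeff_mk n fun n => coeffX (wordOne G n) Ψ

/-- A cut of `x₀ ^ n x₁` either leaves `x₁` in the right factor, with a power of `x₀` on the left,
or leaves the right factor empty. -/
theorem depthOne_mul [One G] (x y : NCSeries K G) : depthOne K G (x * y) =
    abelHom K G x * depthOne K G y + depthOne K G x * PowerSeries.C (constX K G y) := by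
  ext n
  have hl : (wordOne G n).length = n + 1 := by
    change (wordOne G n).toList.length = n + 1
    rw [toList_wordOne, List.length_append, List.length_replicate, List.length_singleton]
  rw [map_add, PowerSeries.coeff_mul_C, coeff_depthOne, coeffX_mul, PowerSeries.coeff_mul,
    Finset.Nat.sum_antidiagonal_eq_sum_range_succ_mk, hl, Finset.sum_range_succ, toList_wordOne,
    coeff_depthOne, constX_eq_coeffX]
  congr 1
  · refine Finset.sum_congr rfl fun i hi => ?_
    have hi' : min i n = i := by have := Finset.mem_range.1 hi; omega
    have hi'' : i ≤ n := by have := Finset.mem_range.1 hi; omega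
    rw [coeff_abelHom, coeff_depthOne, List.take_append_of_le_length (by simpa using hi''),
      List.drop_append_of_le_length (by simpa using hi''), List.take_replicate,
      List.drop_replicate, hi', wordZero_eq, wordOne_eq]
  · rw [List.take_of_length_le (by simp), List.drop_of_length_le (by simp), ← wordOne_eq,
      FreeMonoid.ofList_nil]

variable [CommGroup G]

/-- The image of `x_g` under `aut_Ψ` still contains the factor `x_g`, which `abelHom` kills. -/
theorem abelHom_autX (Ψ : (NCSeries K G)ˣ) (x : NCSeries K G) :
    abelHom K G (autX Ψ x) = abelHom K G x := by
  have halg : ((abelHom K G).comp (autX Ψ)).comp (Compl.of (lettersX K G)) =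
      (abelHom K G).comp (Compl.of _) := by
    refine FreeAlgebra.hom_ext (funext fun i => ?_)
    change abelHom K G (autX Ψ (letter K i)) = abelHom K G (letter K i)
    rw [autX_letter]
    cases i with
    | none => rfl
    | some g => rw [autXLetter_some, map_mul, map_mul, abelHom_letter_some, mul_zero, zero_mul]
  ext n
  refine LinearMap.congr_fun (Compl.linearMap_ext
    (PowerSeries.coeff n ∘ₗ (abelHom K G).toLinearMap ∘ₗ (autX Ψ).toLinearMap)
    (PowerSeries.coeff n ∘ₗ (abelHom K G).toLinearMap) (n + 1) ?_ ?_ fun a => ?_) x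
  · intro x hx
    refine (coeff_abelHom n _).trans (coeffX_eq_zero _ _ ?_)
    have : (wordZero G n).length = n := by
      change (wordZero G n).toList.length = n
      rw [toList_wordZero, List.length_replicate]
    rw [this]
    exact autX_filt Ψ _ _ hx
  · intro x hx
    refine (coeff_abelHom n _).trans (coeffX_eq_zero _ _ ?_)
    have : (wordZero G n).length = n := by
      change (wordZero G n).toList.length = n
      rw [toList_wordZero, List.length_replicate]
    rwa [this]
  · exact congrArg (PowerSeries.coeff n) (DFunLike.congr_fun halg a)

theorem constX_autX (Ψ : (NCSeries K G)ˣ) (x : NCSeries K G) :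
    constX K G (autX Ψ x) = constX K G x := by
  rw [constX_apply, constX_apply, abelHom_autX]

theorem depthOne_letter_of_ne (i : Option G) (hi : i ≠ some 1) :
    depthOne K G (letter K i) = 0 := by
  classical
  ext n
  rw [coeff_depthOne, coeffX_letter, if_neg, map_zero]
  intro h
  have h' := congrArg FreeMonoid.toList h
  rw [toList_wordOne, FreeMonoid.toList_of] at h'
  cases n <;> simp [List.replicate_succ] at h'
  exact hi h'

/-- Among the letters only `x₁` contributes. Its image is `Ψ⁻¹ x₁ Ψ`, as `t_1` is the identity; here
the prefix `Ψ⁻¹` counts through its powers of `x₀`, and the suffix `Ψ` only through its constant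
term. Both sides obey the same product rule, since `aut_Ψ` changes neither `abelHom` nor `constX`.
-/
theorem depthOne_autX_of {Ψ : (NCSeries K G)ˣ} (hΨ : constX K G (Ψ : NCSeries K G) = 1)
    (a : FreeX K G) : depthOne K G (autX Ψ (Compl.of _ a)) =
      depthOne K G (Compl.of _ a) * abelHom K G ((Ψ⁻¹ : (NCSeries K G)ˣ) : NCSeries K G) := by
  have h1 : depthOne K G (1 : NCSeries K G) = 0 := by
    have := depthOne_mul (1 : NCSeries K G) 1
    simpa using this
  induction a using FreeAlgebra.induction with
  | grade0 r =>
    rw [AlgHom.commutes, AlgHom.commutes, Algebra.algebraMap_eq_smul_one, map_smul, h1, smul_zero,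
      zero_mul]
  | grade1 i =>
    change depthOne K G (autX Ψ (letter K i)) = depthOne K G (letter K i) * _
    rw [autX_letter]
    cases i with
    | none => rw [autXLetter_none, depthOne_letter_of_ne _ (by simp), zero_mul]
    | some g =>
      have hε : constX K G (letter K (some g)) = 0 := constX_eq_zero _ (letter_mem _)
      rw [autXLetter_some, depthOne_mul, map_mul, abelHom_letter_some, mul_zero, zero_mul, zero_add,
        depthOne_mul, hε, map_zero, mul_zero, add_zero]
      by_cases hg : g = 1
      · subst hg
        rw [tAct_one, tAct_one, hΨ, map_one, mul_one, mul_comm]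
      · rw [depthOne_letter_of_ne _ (by simpa using hg), mul_zero, zero_mul, zero_mul]
  | mul a b ha hb =>
    rw [map_mul, map_mul, depthOne_mul, depthOne_mul, ha, hb, abelHom_autX, constX_autX]
    ring
  | add a b ha hb => rw [map_add, map_add, map_add, map_add, ha, hb, add_mul]

theorem depthOne_autX {Ψ : (NCSeries K G)ˣ} (hΨ : constX K G (Ψ : NCSeries K G) = 1)
    (x : NCSeries K G) : depthOne K G (autX Ψ x) =
      depthOne K G x * abelHom K G ((Ψ⁻¹ : (NCSeries K G)ˣ) : NCSeries K G) := by
  have hlen : ∀ i, (wordOne G i).length + 1 = i + 2 := fun i => by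
    change (wordOne G i).toList.length + 1 = i + 2
    rw [toList_wordOne, List.length_append, List.length_replicate, List.length_singleton]
  ext n
  -- Degree `n + 2` suffices for continuity, as the words `x₀ ^ i x₁` with `i ≤ n` have length at
  -- most `n + 1`.
  refine LinearMap.congr_fun (Compl.linearMap_ext
    (PowerSeries.coeff n ∘ₗ depthOne K G ∘ₗ (autX Ψ).toLinearMap)
    (PowerSeries.coeff n ∘ₗ LinearMap.mulRight K
      (abelHom K G ((Ψ⁻¹ : (NCSeries K G)ˣ) : NCSeries K G)) ∘ₗ depthOne K G)
    (n + 2) ?_ ?_ fun a => ?_) x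
  · intro x hx
    refine (coeff_depthOne n _).trans (coeffX_eq_zero _ _ ?_)
    rw [hlen]
    exact autX_filt Ψ _ _ hx
  · intro x hx
    change PowerSeries.coeff n (depthOne K G x * _) = 0
    rw [PowerSeries.coeff_mul]
    refine Finset.sum_eq_zero fun p hp => ?_
    have := Finset.HasAntidiagonal.mem_antidiagonal.1 hp
    rw [coeff_depthOne, coeffX_eq_zero _ _ (Compl.filt_anti _ hx), zero_mul]
    rw [hlen]
    omega
  · exact congrArg (PowerSeries.coeff n) (depthOne_autX_of hΨ a)

/-- In `Ψ aut_Ψ(Φ)`, the factor `abelHom Ψ` produced by the product rule cancels the factor `abelHom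
Ψ⁻¹` produced by `aut_Ψ`. This additivity makes `Γ` multiplicative. -/
theorem depthOne_circ {Ψ Φ : (NCSeries K G)ˣ} (hΨ : constX K G (Ψ : NCSeries K G) = 1)
    (hΦ : constX K G (Φ : NCSeries K G) = 1) :
    depthOne K G (circ Ψ Φ : NCSeries K G) =
      depthOne K G (Ψ : NCSeries K G) + depthOne K G (Φ : NCSeries K G) := by
  have h : abelHom K G (Ψ : NCSeries K G) *
      abelHom K G ((Ψ⁻¹ : (NCSeries K G)ˣ) : NCSeries K G) = 1 := by
    rw [← map_mul, Units.mul_inv, map_one]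
  rw [circ_val, depthOne_mul, depthOne_autX hΨ, constX_autX, hΦ, map_one, mul_one, mul_left_comm, h,
    mul_one, add_comm]

end Coeff

/-! ### Multiplicativity of `Γ` -/

section Gamma

variable {K : Type*} [CommRing K] [Algebra ℚ K]

theorem constantCoeff_exp_subst {f : PowerSeries K} (hf : PowerSeries.constantCoeff f = 0) :
    PowerSeries.constantCoeff ((PowerSeries.exp K).subst f) = 1 := by
  refine (PowerSeries.constantCoeff_subst
    (PowerSeries.HasSubst.of_constantCoeff_zero' hf) _).trans ?_
  have h' : MvPowerSeries.constantCoeff f = 0 := hf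
  rw [finsum_eq_single _ 0]
  · simp
  · intro d hd
    simp [h', hd]

/-- A power series with constant term `1` is determined by its logarithmic derivative. -/
theorem eq_of_derivative_eq_mul {f g h : PowerSeries K} (hf : PowerSeries.derivative K f = f * h)
    (hg : PowerSeries.derivative K g = g * h) (hf0 : PowerSeries.constantCoeff f = 1)
    (hg0 : PowerSeries.constantCoeff g = 1) : f = g := by
  have : IsAddTorsionFree K := IsAddTorsionFree.of_module_rat K
  obtain ⟨u, rfl⟩ : IsUnit g := by
    rw [PowerSeries.isUnit_iff_constantCoeff, hg0]
    exact isUnit_one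
  -- The quotient `f / g` has zero derivative and constant term `1`; over a torsion-free ring it is
  -- therefore `1`.
  have key : f * ((u⁻¹ : (PowerSeries K)ˣ) : PowerSeries K) = 1 := by
    refine PowerSeries.derivative.ext ?_ ?_
    · rw [Derivation.leibniz, PowerSeries.derivative_inv, hf, hg, PowerSeries.derivative_one]
      have : (u : PowerSeries K) * ((u⁻¹ : (PowerSeries K)ˣ) : PowerSeries K) = 1 := u.mul_inv
      simp only [smul_eq_mul]
      linear_combination (-f * h * ((u⁻¹ : (PowerSeries K)ˣ) : PowerSeries K)) * this
    · have : PowerSeries.constantCoeff (u : PowerSeries K) *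
          PowerSeries.constantCoeff ((u⁻¹ : (PowerSeries K)ˣ) : PowerSeries K) = 1 := by
        rw [← map_mul, Units.mul_inv, map_one]
      rw [hg0, one_mul] at this
      rw [map_mul, hf0, this, map_one, mul_one]
  exact (Units.mul_inv_eq_one (u := u)).1 key

/-- Both sides have constant term `1` and logarithmic derivative `(f + g)'`. -/
theorem exp_subst_add {f g : PowerSeries K} (hf : PowerSeries.constantCoeff f = 0)
    (hg : PowerSeries.constantCoeff g = 0) :
    (PowerSeries.exp K).subst (f + g) =
      (PowerSeries.exp K).subst f * (PowerSeries.exp K).subst g := by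
  have hfg : PowerSeries.constantCoeff (f + g) = 0 := by rw [map_add, hf, hg, add_zero]
  refine eq_of_derivative_eq_mul (h := PowerSeries.derivative K (f + g)) ?_ ?_
    (constantCoeff_exp_subst hfg) ?_
  · rw [PowerSeries.derivative_subst (PowerSeries.HasSubst.of_constantCoeff_zero' hfg),
      PowerSeries.derivative_exp]
  · rw [Derivation.leibniz, PowerSeries.derivative_subst
      (PowerSeries.HasSubst.of_constantCoeff_zero' hf), PowerSeries.derivative_subst
      (PowerSeries.HasSubst.of_constantCoeff_zero' hg), PowerSeries.derivative_exp, map_add]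
    simp only [smul_eq_mul]
    ring
  · rw [map_mul, constantCoeff_exp_subst hf, constantCoeff_exp_subst hg, mul_one]

variable {G : Type*} [CommGroup G]

theorem constantCoeff_logGamma (Ψ : NCSeries K G) :
    PowerSeries.constantCoeff (logGamma Ψ) = 0 := by
  rw [← PowerSeries.coeff_zero_eq_constantCoeff_apply, logGamma, PowerSeries.coeff_mk]
  simp

theorem logGamma_circ {Ψ Φ : (NCSeries K G)ˣ} (hΨ : constX K G (Ψ : NCSeries K G) = 1)
    (hΦ : constX K G (Φ : NCSeries K G) = 1) :
    logGamma (circ Ψ Φ : NCSeries K G) =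
      logGamma (Ψ : NCSeries K G) + logGamma (Φ : NCSeries K G) := by
  ext n
  rw [map_add, logGamma, logGamma, logGamma, PowerSeries.coeff_mk, PowerSeries.coeff_mk,
    PowerSeries.coeff_mk]
  split_ifs with h
  · have := congrArg (PowerSeries.coeff (n - 1)) (depthOne_circ hΨ hΦ)
    rw [map_add, coeff_depthOne, coeff_depthOne, coeff_depthOne] at this
    rw [← mul_add]
    exact congrArg _ this
  · rw [add_zero]

theorem Gamma_circ {Ψ Φ : (NCSeries K G)ˣ} (hΨ : constX K G (Ψ : NCSeries K G) = 1)
    (hΦ : constX K G (Φ : NCSeries K G) = 1) :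
    Gamma (circ Ψ Φ : NCSeries K G) = Gamma (Ψ : NCSeries K G) * Gamma (Φ : NCSeries K G) := by
  ext1
  change (PowerSeries.exp K).subst (logGamma _) = (PowerSeries.exp K).subst (logGamma _) *
    (PowerSeries.exp K).subst (logGamma _)
  rw [logGamma_circ hΨ hΦ, exp_subst_add (constantCoeff_logGamma _) (constantCoeff_logGamma _)]

end Gamma

/-! ### The actions on `V`, `W` and `M` -/

section Crossed

variable {K : Type*} [CommRing K] {G : Type*} [CommGroup G]

theorem VAlg.hom_ext {B : Type*} [Ring B] [Algebra K B] {f g : VAlg K G →ₐ[K] B}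
    (h : ∀ x, f (VAlg.gen K x) = g (VAlg.gen K x)) : f = g :=
  RingQuot.ringQuot_ext' K f g (FreeAlgebra.hom_ext (funext h))

theorem VHat.hom_ext {f g : VHat K G →ₐ[K] VHat K G}
    (hf : ∀ n, ∀ x ∈ filtV K G n, f x ∈ filtV K G n)
    (hg : ∀ n, ∀ x ∈ filtV K G n, g x ∈ filtV K G n)
    (h : ∀ x, f (genV K x) = g (genV K x)) : f = g := by
  refine Compl.endo_ext f g hf hg fun a => ?_
  have : f.comp (Compl.of _) = g.comp (Compl.of _) := VAlg.hom_ext h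
  exact DFunLike.congr_fun this a

theorem beta_letter (i : Option G) : beta (letter K i) = betaLetter K i :=
  substSeries_letter _ _ _

theorem beta_filt (n : ℕ) : ∀ x ∈ filtX K G n, beta x ∈ filtV K G n := substSeries_filt _ _ n

theorem gV_mul_inv (g : G) : gV K g * gV K g⁻¹ = 1 := by
  rw [gV_mul, mul_inv_cancel, gV_one]

theorem gV_inv_mul (g : G) : gV K g⁻¹ * gV K g = 1 := by
  rw [gV_mul, inv_mul_cancel, gV_one]

/-- The unit `g` of `V`. -/
def gU (K : Type*) [CommRing K] {G : Type*} [CommGroup G] (g : G) : (VHat K G)ˣ :=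
  ⟨gV K g, gV K g⁻¹, gV_mul_inv g, gV_inv_mul g⟩

theorem Ad_filt (u : (VHat K G)ˣ) (n : ℕ) (x : VHat K G) (hx : x ∈ filtV K G n) :
    Ad (K := K) u x ∈ filtV K G n :=
  Ideal.mul_mem_right _ _ (Ideal.mul_mem_left _ _ hx)

/-- In `V` the automorphism `t_g` becomes inner. On `x₀` this uses that `g` commutes with `e₀`, and
on `x_h` that `G` is commutative. -/
theorem beta_tAct (g : G) (x : NCSeries K G) :
    beta (tAct g x) = gV K g * beta x * gV K g⁻¹ := by
  have key : (beta (K := K)).comp (tAct g) = (Ad (K := K) (gU K g)).comp beta := by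
    refine series_ext _ _ (comp_filt beta_filt (tAct_filt g)) (comp_filt (Ad_filt _) beta_filt)
      fun i => ?_
    rw [AlgHom.comp_apply, AlgHom.comp_apply, tAct_letter, beta_letter, beta_letter, Ad_apply]
    cases i with
    | none =>
      change e0 K G = gV K g * e0 K G * gV K g⁻¹
      rw [gV_comm, mul_assoc, gV_mul_inv, mul_one]
    | some h =>
      change -(gV K (g * h) * e1 K G * gV K (g * h)⁻¹) =
        gV K g * -(gV K h * e1 K G * gV K h⁻¹) * gV K g⁻¹
      rw [← gV_mul, mul_inv, ← gV_mul, gV_mul, gV_mul, mul_comm g⁻¹, ← gV_mul, ← gV_mul]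
      noncomm_ring
  rw [← AlgHom.comp_apply, key, AlgHom.comp_apply]
  rfl

/-- On `x_g`, `beta_tAct` turns the conjugation by `t_g(Ψ)` into the conjugate by `g` of the one
defining the image of `e₁`. -/
theorem autV0_beta (Ψ : (NCSeries K G)ˣ) (x : NCSeries K G) :
    autV0 Ψ (beta x) = beta (autX Ψ x) := by
  have key : (autV0 Ψ).comp beta = beta.comp (autX Ψ) := by
    refine series_ext _ _ (comp_filt (fun _ _ => autV0_filt Ψ) beta_filt)
      (comp_filt beta_filt (autX_filt Ψ)) fun i => ?_
    rw [AlgHom.comp_apply, AlgHom.comp_apply, autX_letter, beta_letter]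
    cases i with
    | none =>
      rw [autXLetter_none, beta_letter]
      exact autV0_gen Ψ .e0
    | some g =>
      rw [autXLetter_some, map_mul, map_mul, beta_letter, beta_tAct, beta_tAct]
      simp only [betaLetter, map_neg, map_mul, autV0_gen, autV0Gen]
      change -(gV K g * (beta ((Ψ⁻¹ : (NCSeries K G)ˣ) : NCSeries K G) * e1 K G *
        beta (Ψ : NCSeries K G)) * gV K g⁻¹) = _
      -- A product of conjugates by `g` is the conjugate of the product; the variable `d` plays no
      -- role.
      have h : ∀ a b c d : VHat K G, gV K g * a * gV K g⁻¹ * -(gV K g * b * gV K g⁻¹) *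
          (gV K g * c * gV K g⁻¹) = -(gV K g * (a * b * c) * gV K g⁻¹) := by
        intro a b c _
        have h1 : ∀ y, gV K g⁻¹ * (gV K g * y) = y := fun y => by
          rw [← mul_assoc, gV_inv_mul, one_mul]
        simp only [mul_assoc, mul_neg, neg_mul, h1]
      exact (h _ _ _ 0).symm
  rw [← AlgHom.comp_apply, key, AlgHom.comp_apply]

theorem betaU_circ (Ψ Φ : (NCSeries K G)ˣ) :
    betaU (circ Ψ Φ) = betaU Ψ * Units.map (autV0 Ψ).toMonoidHom (betaU Φ) := by
  ext1
  change beta (circ Ψ Φ : NCSeries K G) = beta (Ψ : NCSeries K G) * autV0 Ψ (beta (Φ : NCSeries K G))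
  rw [circ_val, map_mul, autV0_beta]

theorem autV0_circ (Ψ Φ : (NCSeries K G)ˣ) (v : VHat K G) :
    autV0 (circ Ψ Φ) v = autV0 Ψ (autV0 Φ v) := by
  have key : autV0 (circ Ψ Φ) = (autV0 Ψ).comp (autV0 Φ) := by
    refine VHat.hom_ext (fun _ _ => autV0_filt _)
      (comp_filt (fun _ _ => autV0_filt Ψ) (fun _ _ => autV0_filt Φ)) fun x => ?_
    rw [AlgHom.comp_apply, autV0_gen, autV0_gen]
    cases x with
    | e0 => exact (autV0_gen Ψ .e0).symm
    | of g => exact (autV0_gen Ψ (.of g)).symm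
    | e1 =>
      simp only [autV0Gen, map_mul, autV0_gen]
      rw [betaU_circ, mul_inv_rev, Units.val_mul, Units.val_mul]
      simp only [mul_assoc]
      rfl
  rw [key, AlgHom.comp_apply]

theorem autV0_one (v : VHat K G) : autV0 (1 : (NCSeries K G)ˣ) v = v := by
  have key : autV0 (1 : (NCSeries K G)ˣ) = AlgHom.id K (VHat K G) := by
    refine VHat.hom_ext (fun _ _ => autV0_filt _) (fun _ _ h => h) fun x => ?_
    rw [autV0_gen, AlgHom.id_apply]
    cases x with
    | e0 => rfl
    | of g => rfl
    | e1 =>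
      have h : betaU (1 : (NCSeries K G)ˣ) = 1 := map_one _
      rw [autV0Gen, h]
      simp
  rw [key, AlgHom.id_apply]

variable [Algebra ℚ K]

theorem gammaU_circ {Ψ Φ : (NCSeries K G)ˣ} (hΨ : constX K G (Ψ : NCSeries K G) = 1)
    (hΦ : constX K G (Φ : NCSeries K G) = 1) : gammaU (circ Ψ Φ) = gammaU Ψ * gammaU Φ := by
  rw [gammaU, Gamma_circ hΨ hΦ, map_mul]
  rfl

/-- Since `1 ⊛ 1 = 1`, this unit is equal to its own square. -/
theorem gammaU_one : gammaU (1 : (NCSeries K G)ˣ) = 1 := by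
  have h1 : constX K G ((1 : (NCSeries K G)ˣ) : NCSeries K G) = 1 := map_one _
  have h := gammaU_circ h1 h1
  rw [circ_one] at h
  exact left_eq_mul.1 h

/-- `Γ_Φ(-e₁)` is a series in `-e₁`, and `Ad_{β(Ψ)} ∘ a_Ψ` fixes `e₁`. This lets `γ_Φ` pass to the
left of `β(Ψ)` in the cocycle identity. -/
theorem autV0_gammaU (Ψ Φ : (NCSeries K G)ˣ) :
    (betaU Ψ : VHat K G) * autV0 Ψ (gammaU Φ : VHat K G) = gammaU Φ * betaU Ψ := by
  have h : autV1 Ψ (gammaU Φ : VHat K G) = gammaU Φ :=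
    map_evalSeries _ _ (autV1 Ψ) (fun n x hx => Ad_filt _ n _ (autV0_filt Ψ hx))
      (by rw [map_neg, autV1_e1]) _
  change (betaU Ψ : VHat K G) * autV0 Ψ (gammaU Φ) * ((betaU Ψ)⁻¹ : (VHat K G)ˣ) = _ at h
  exact (Units.mul_inv_eq_iff_eq_mul (betaU Ψ)).1 h

/-- The unit `Γ_Ψ(-e₁)⁻¹ β(Ψ ⊗ 1)` of `V`. -/
def twistU (Ψ : (NCSeries K G)ˣ) : (VHat K G)ˣ := (gammaU Ψ)⁻¹ * betaU Ψ

/-- The cocycle identity behind both action laws: `β` is a cocycle, `γ` is multiplicative,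
`autV0_gammaU` exchanges `β(Ψ) a_Ψ(γ_Φ)` with `γ_Φ β(Ψ)`, and the `γ`'s commute as series in the
same element. -/
theorem twistU_circ {Ψ Φ : (NCSeries K G)ˣ} (hΨ : constX K G (Ψ : NCSeries K G) = 1)
    (hΦ : constX K G (Φ : NCSeries K G) = 1) :
    twistU (circ Ψ Φ) = twistU Ψ * Units.map (autV0 Ψ).toMonoidHom (twistU Φ) := by
  have h : betaU Ψ * Units.map (autV0 Ψ).toMonoidHom (gammaU Φ) = gammaU Φ * betaU Ψ := by
    ext1
    exact autV0_gammaU Ψ Φ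
  have hc : gammaU Ψ * gammaU Φ = gammaU Φ * gammaU Ψ := by
    rw [gammaU, gammaU, ← map_mul, ← map_mul, mul_comm]
  rw [twistU, twistU, twistU, gammaU_circ hΨ hΦ, betaU_circ, map_mul, map_inv]
  rw [hc, mul_inv_rev, mul_assoc, mul_assoc]
  congr 1
  rw [← mul_assoc, ← mul_assoc]
  congr 1
  rw [inv_mul_eq_iff_eq_mul, ← mul_assoc, ← h, mul_assoc, mul_inv_cancel, mul_one]

theorem twistU_one : twistU (1 : (NCSeries K G)ˣ) = 1 := by
  have h : betaU (1 : (NCSeries K G)ˣ) = 1 := map_one _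
  rw [twistU, gammaU_one, h, inv_one, mul_one]

theorem gammaAutV1_apply (Ψ : (NCSeries K G)ˣ) (v : VHat K G) :
    gammaAutV1 Ψ v = twistU Ψ * autV0 Ψ v * ((twistU Ψ)⁻¹ : (VHat K G)ˣ) := by
  change Ad (K := K) (gammaU Ψ)⁻¹ (Ad (K := K) (betaU Ψ) (autV0 Ψ v)) = _
  rw [← Ad_mul]
  rfl

theorem gammaAutM10_mk (Ψ : (NCSeries K G)ˣ) (v : VHat K G) :
    gammaAutM10 Ψ ((relM K G).mkQ v) = (relM K G).mkQ (twistU Ψ * autV0 Ψ v) := by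
  change (((gammaU Ψ)⁻¹ : (VHat K G)ˣ) : VHat K G) •
    (relM K G).mkQ ((betaU Ψ : VHat K G) * autV0 Ψ v) = _
  rw [← map_smul, smul_eq_mul, ← mul_assoc]
  rfl

theorem gammaAutV1_circ {Ψ Φ : (NCSeries K G)ˣ} (hΨ : constX K G (Ψ : NCSeries K G) = 1)
    (hΦ : constX K G (Φ : NCSeries K G) = 1) (v : VHat K G) :
    gammaAutV1 (circ Ψ Φ) v = gammaAutV1 Ψ (gammaAutV1 Φ v) := by
  rw [gammaAutV1_apply, gammaAutV1_apply, gammaAutV1_apply, twistU_circ hΨ hΦ, autV0_circ,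
    map_mul, map_mul, mul_inv_rev, Units.val_mul, Units.val_mul]
  simp only [mul_assoc]
  rfl

theorem gammaAutW1_circ {Ψ Φ : (NCSeries K G)ˣ} (hΨ : constX K G (Ψ : NCSeries K G) = 1)
    (hΦ : constX K G (Φ : NCSeries K G) = 1) (w : WHat K G) :
    gammaAutW1 (circ Ψ Φ) w = gammaAutW1 Ψ (gammaAutW1 Φ w) :=
  Subtype.ext (gammaAutV1_circ hΨ hΦ w.1)

theorem gammaAutM10_circ {Ψ Φ : (NCSeries K G)ˣ} (hΨ : constX K G (Ψ : NCSeries K G) = 1)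
    (hΦ : constX K G (Φ : NCSeries K G) = 1) (m : MHat K G) :
    gammaAutM10 (circ Ψ Φ) m = gammaAutM10 Ψ (gammaAutM10 Φ m) := by
  obtain ⟨v, rfl⟩ := (relM K G).mkQ_surjective m
  rw [gammaAutM10_mk, gammaAutM10_mk, gammaAutM10_mk, twistU_circ hΨ hΦ, autV0_circ,
    map_mul (autV0 Ψ), Units.val_mul, mul_assoc]
  rfl

theorem gammaAutW1_one (w : WHat K G) : gammaAutW1 (1 : (NCSeries K G)ˣ) w = w := by
  apply Subtype.ext
  change gammaAutV1 1 w.1 = w.1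
  rw [gammaAutV1_apply, twistU_one, autV0_one]
  simp

theorem gammaAutM10_one (m : MHat K G) : gammaAutM10 (1 : (NCSeries K G)ˣ) m = m := by
  obtain ⟨v, rfl⟩ := (relM K G).mkQ_surjective m
  rw [gammaAutM10_mk, twistU_one, autV0_one, Units.val_one, one_mul]

/-- Writing `τ` for `twistU Ψ` and `a` for `autV0 Ψ`, one has `τ a(v u) = (τ a(v) τ⁻¹) (τ a(u))`. -/
theorem gammaAutM10_smul (Ψ : (NCSeries K G)ˣ) (v : VHat K G) (m : MHat K G) :
    gammaAutM10 Ψ (v • m) = gammaAutV1 Ψ v • gammaAutM10 Ψ m := by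
  obtain ⟨u, rfl⟩ := (relM K G).mkQ_surjective m
  rw [← map_smul, gammaAutM10_mk, gammaAutM10_mk, gammaAutV1_apply, ← map_smul, smul_eq_mul,
    smul_eq_mul, map_mul (autV0 Ψ)]
  congr 1
  simp only [mul_assoc, Units.inv_mul_cancel_left]

end Crossed

/-! ### Linear functionals on `V` with prescribed restriction to `W` -/

section Functional

section Pairing

variable {K : Type*} [CommRing K] {G : Type*} {T : Type*} [Ring T] [Algebra K T] (φ : ℕ × G → T)

/-- The map `x ↦ ∑ φ i x_i`. -/
def pairing : ((ℕ × G) →₀ T) →ₗ[K] T := Finsupp.lsum ℕ fun i => LinearMap.mulLeft K (φ i)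

theorem pairing_single (i : ℕ × G) (t : T) :
    pairing (K := K) φ (Finsupp.single i t) = φ i * t := by
  simp [pairing]

/-- The map `(x, t) ↦ ∑ φ i x_i + t`. -/
def pairingAdd : ((ℕ × G) →₀ T) × T →ₗ[K] T := (pairing φ).coprod LinearMap.id

theorem pairingAdd_apply (y : ((ℕ × G) →₀ T) × T) :
    pairingAdd (K := K) φ y = pairing (K := K) φ y.1 + y.2 := rfl

/-- Right multiplication by an element of `T`. -/
def rightMul (s : T) : Module.End K (((ℕ × G) →₀ T) × T) :=
  (Finsupp.mapRange.linearMap (LinearMap.mulRight K s)).prodMap (LinearMap.mulRight K s)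

theorem pairingAdd_rightMul (s : T) (y : ((ℕ × G) →₀ T) × T) :
    pairingAdd (K := K) φ (rightMul (K := K) s y) = pairingAdd (K := K) φ y * s := by
  obtain ⟨x, t⟩ := y
  have h : pairing (K := K) φ (Finsupp.mapRange.linearMap (LinearMap.mulRight K s) x) =
      pairing (K := K) φ x * s := by
    induction x using Finsupp.induction_linear with
    | zero => simp
    | add x y hx hy => rw [map_add, map_add, map_add, hx, hy, add_mul]
    | single i t =>
      rw [Finsupp.mapRange.linearMap_apply, Finsupp.mapRange_single, pairing_single, pairing_single,
        LinearMap.mulRight_apply, mul_assoc]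
  rw [pairingAdd_apply, pairingAdd_apply, add_mul, ← h]
  rfl

theorem rightMul_single (s : T) (i : ℕ × G) (t : T) :
    rightMul (K := K) s (Finsupp.single i t, 0) = (Finsupp.single i (t * s), 0) := by
  refine Prod.ext ?_ (zero_mul s)
  change Finsupp.mapRange.linearMap (LinearMap.mulRight K s) (Finsupp.single i t) = _
  rw [Finsupp.mapRange.linearMap_apply, Finsupp.mapRange_single]
  rfl

section Filtration

variable (H : ℕ → Submodule K T)

/-- The filtration of the induced module. -/
def repFilt (j : ℕ) : Submodule K (((ℕ × G) →₀ T) × T) where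
  -- The basis vector of index `(n, g)` stands for `e₀ ^ n g e₁`, of degree `n + 1`, so its
  -- coefficient needs only the degree `j - 1 - n`; when `j ≤ n + 1` the truncated subtraction gives
  -- `H 0`.
  carrier := {y | (∀ i, y.1 i ∈ H (j - 1 - i.1)) ∧ y.2 ∈ H j}
  add_mem' hx hy := ⟨fun i => add_mem (hx.1 i) (hy.1 i), add_mem hx.2 hy.2⟩
  zero_mem' := ⟨fun _ => zero_mem _, zero_mem _⟩
  smul_mem' c _ hx := ⟨fun i => Submodule.smul_mem _ c (hx.1 i), Submodule.smul_mem _ c hx.2⟩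

variable {H}

theorem single_mem_repFilt {j : ℕ} {i : ℕ × G} {t : T} (ht : t ∈ H (j - 1 - i.1)) :
    ((Finsupp.single i t, 0) : ((ℕ × G) →₀ T) × T) ∈ repFilt H j := by
  classical
  refine ⟨fun k => ?_, zero_mem _⟩
  rw [Finsupp.single_apply]
  split_ifs with h
  · rwa [← h]
  · exact zero_mem _

theorem mapDomain_mem_repFilt {j k : ℕ} (f : ℕ × G → ℕ × G) {y : ((ℕ × G) →₀ T) × T}
    (hy : y ∈ repFilt H j) (hf : ∀ i t, t ∈ H (j - 1 - i.1) → t ∈ H (k - 1 - (f i).1)) :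
    ((y.1.mapDomain f, 0) : ((ℕ × G) →₀ T) × T) ∈ repFilt H k := by
  have h : ((y.1.mapDomain f, 0) : ((ℕ × G) →₀ T) × T) =
      y.1.sum fun i t => (Finsupp.single (f i) t, 0) := by
    change LinearMap.inl K ((ℕ × G) →₀ T) T (y.1.mapDomain f) = _
    rw [Finsupp.mapDomain, map_finsuppSum]
    rfl
  rw [h]
  exact Submodule.sum_mem _ fun i _ => single_mem_repFilt (hf i _ (hy.1 i))

theorem pairingAdd_mem (hanti : Antitone H)
    (hmul : ∀ i j, ∀ x ∈ H i, ∀ y ∈ H j, x * y ∈ H (i + j)) (hφ : ∀ i, φ i ∈ H (i.1 + 1)) {j : ℕ} {y : ((ℕ × G) →₀ T) × T} (hy : y ∈ repFilt H j) :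
    pairingAdd (K := K) φ y ∈ H j := by
  refine add_mem ?_ hy.2
  refine Submodule.sum_mem _ fun i _ => ?_
  exact hanti (by omega) (hmul _ _ _ (hφ i) _ (hy.1 i))

theorem repFilt_anti (hanti : Antitone H) {i j : ℕ} (h : i ≤ j) {y : ((ℕ × G) →₀ T) × T}
    (hy : y ∈ repFilt H j) : y ∈ repFilt H i :=
  ⟨fun k => hanti (by omega) (hy.1 k), hanti h hy.2⟩

/-- The algebra of filtered endomorphisms of the induced module. -/
def filtEnd (H : ℕ → Submodule K T) : Subalgebra K (Module.End K (((ℕ × G) →₀ T) × T)) where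
  carrier := {ψ | ∀ j, ∀ y ∈ repFilt H j, ψ y ∈ repFilt H j}
  mul_mem' := fun ha hb j y hy => ha j _ (hb j y hy)
  add_mem' := fun ha hb j y hy => add_mem (ha j y hy) (hb j y hy)
  algebraMap_mem' := fun c j y hy => by
    rw [Module.algebraMap_end_apply]
    exact Submodule.smul_mem _ c hy

end Filtration

end Pairing


variable {K : Type*} [CommRing K] {G : Type*} [CommGroup G]

theorem VAlg.mk_surjective : Function.Surjective (VAlg.mk (K := K) (G := G)) :=
  RingQuot.mkAlgHom_surjective K (Rel K G)

theorem VAlg.induction {P : VAlg K G → Prop} (algebraMap : ∀ c : K, P (algebraMap K _ c))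
    (gen : ∀ x, P (VAlg.gen K x)) (mul : ∀ a b, P a → P b → P (a * b))
    (add : ∀ a b, P a → P b → P (a + b)) (v : VAlg K G) : P v := by
  obtain ⟨a, rfl⟩ := VAlg.mk_surjective v
  induction a using FreeAlgebra.induction with
  | grade0 r =>
    rw [AlgHom.commutes]
    exact algebraMap r
  | grade1 x => exact gen x
  | mul a b ha hb =>
    rw [map_mul]
    exact mul _ _ ha hb
  | add a b ha hb =>
    rw [map_add]
    exact add _ _ ha hb

section Rep

variable {T : Type*} [Ring T] [Algebra K T] (φ : ℕ × G → T)

/-- The action of the generators of `V` on the module induced by a family of elements of `T`. -/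
def repGen : Gen G → Module.End K (((ℕ × G) →₀ T) × T)
  -- The vector `(0, 1)` plays the role of `1_M`: it is killed by `e₀` and fixed by `G`, and the
  -- basis vector of index `(n, g)` is `e₀ ^ n g e₁ · (0, 1)`. The action of `e₁` sends `y` to `e₁ ·
  -- (0, 1)` multiplied on the right by the value of the pairing at `y`.
  | .e0 => (Finsupp.lmapDomain T K fun i => (i.1 + 1, i.2)).prodMap 0
  | .e1 => LinearMap.inl K _ _ ∘ₗ Finsupp.lsingle (0, 1) ∘ₗ pairingAdd φ
  | .of g => (Finsupp.lmapDomain T K fun i => (i.1, g * i.2)).prodMap LinearMap.id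

theorem repGen_e0 (y : ((ℕ × G) →₀ T) × T) :
    repGen (K := K) φ .e0 y = (y.1.mapDomain fun i => (i.1 + 1, i.2), 0) := rfl

theorem repGen_e1 (y : ((ℕ × G) →₀ T) × T) :
    repGen (K := K) φ .e1 y = (Finsupp.single (0, 1) (pairingAdd (K := K) φ y), 0) := rfl

theorem repGen_of (g : G) (y : ((ℕ × G) →₀ T) × T) :
    repGen (K := K) φ (.of g) y = (y.1.mapDomain fun i => (i.1, g * i.2), y.2) := rfl

theorem repGen_rel (a b : FreeAlgebra K (Gen G)) (h : Rel K G a b) :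
    FreeAlgebra.lift K (repGen (K := K) φ) a = FreeAlgebra.lift K (repGen (K := K) φ) b := by
  obtain ⟨g, h⟩ | _ | g := h
  · simp only [map_mul, FreeAlgebra.lift_ι_apply]
    refine LinearMap.ext fun y => ?_
    rw [Module.End.mul_apply, repGen_of, repGen_of, repGen_of, ← Finsupp.mapDomain_comp]
    congr 2
    funext i
    simp [mul_assoc]
  · simp only [map_one, FreeAlgebra.lift_ι_apply]
    refine LinearMap.ext fun y => ?_
    rw [repGen_of]
    simp only [one_mul, Module.End.one_apply]
    exact Prod.ext (Finsupp.mapDomain_id).symm rfl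
  · simp only [map_mul, FreeAlgebra.lift_ι_apply]
    refine LinearMap.ext fun y => ?_
    rw [Module.End.mul_apply, Module.End.mul_apply, repGen_of, repGen_e0, repGen_e0, repGen_of,
      ← Finsupp.mapDomain_comp, ← Finsupp.mapDomain_comp]
    rfl

/-- The action of `V`, before completion, on the module induced by a family of elements of `T`. -/
def rep : VAlg K G →ₐ[K] Module.End K (((ℕ × G) →₀ T) × T) := VAlg.lift (repGen (K := K) φ) (repGen_rel φ)

theorem rep_gen (x : Gen G) : rep φ (VAlg.gen K x) = repGen φ x := VAlg.lift_gen _ _ _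

/-- The action of `V` is linear for the right `T`-module structure; this holds on the generators. -/
theorem rep_rightMul (s : T) (v : VAlg K G) (y : ((ℕ × G) →₀ T) × T) :
    rep φ v (rightMul (K := K) s y) = rightMul (K := K) s (rep φ v y) := by
  have hmap : ∀ (f : ℕ × G → ℕ × G) (x : (ℕ × G) →₀ T),
      (Finsupp.mapRange.linearMap (LinearMap.mulRight K s) x).mapDomain f =
        Finsupp.mapRange.linearMap (LinearMap.mulRight K s) (x.mapDomain f) := by
    intro f x
    induction x using Finsupp.induction_linear with
    | zero => simp
    | add x y hx hy => rw [map_add, Finsupp.mapDomain_add, hx, hy, Finsupp.mapDomain_add, map_add]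
    | single i t =>
      rw [Finsupp.mapRange.linearMap_apply, Finsupp.mapRange_single, Finsupp.mapDomain_single,
        Finsupp.mapDomain_single, Finsupp.mapRange.linearMap_apply, Finsupp.mapRange_single]
  induction v using VAlg.induction generalizing y with
  | algebraMap c =>
    rw [AlgHom.commutes, Module.algebraMap_end_apply, Module.algebraMap_end_apply, map_smul]
  | gen x =>
    rw [rep_gen]
    cases x with
    | e0 =>
      rw [repGen_e0, repGen_e0]
      exact Prod.ext (hmap _ _) (zero_mul s).symm
    | e1 =>
      rw [repGen_e1, repGen_e1, pairingAdd_rightMul, rightMul_single]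
    | of g =>
      rw [repGen_of, repGen_of]
      exact Prod.ext (hmap _ _) rfl
  | mul a b ha hb => rw [map_mul, Module.End.mul_apply, Module.End.mul_apply, hb, ha]
  | add a b ha hb => rw [map_add, LinearMap.add_apply, LinearMap.add_apply, ha, hb, map_add]

/-- The functional `v ↦ ⟨φ, v · (0, 1)⟩`. -/
def repFun : VAlg K G →ₗ[K] T :=
  pairingAdd φ ∘ₗ LinearMap.applyₗ ((0, 1) : ((ℕ × G) →₀ T) × T) ∘ₗ (rep φ).toLinearMap

theorem repFun_apply (v : VAlg K G) :
    repFun φ v = pairingAdd (K := K) φ (rep φ v (0, 1)) := rfl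

theorem repFun_one : repFun (K := K) φ 1 = 1 := by
  rw [repFun_apply, map_one, Module.End.one_apply, pairingAdd_apply, map_zero, zero_add]

theorem repFun_mul_e0 (v : VAlg K G) : repFun φ (v * VAlg.gen K .e0) = 0 := by
  rw [repFun_apply, map_mul, Module.End.mul_apply, rep_gen, repGen_e0, Finsupp.mapDomain_zero,
    Prod.mk_zero_zero, map_zero, map_zero]

theorem repFun_mul_of (v : VAlg K G) (g : G) : repFun φ (v * VAlg.gen K (.of g)) = repFun φ v := by
  rw [repFun_apply, map_mul, Module.End.mul_apply, rep_gen, repGen_of, Finsupp.mapDomain_zero]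
  rfl

theorem rep_e1_one :
    rep (K := K) φ (VAlg.gen K .e1) (0, 1) = (Finsupp.single (0, 1) 1, 0) := by
  rw [rep_gen, repGen_e1, pairingAdd_apply, map_zero, zero_add]

/-- By construction `e₁ y = (e₁ · (0, 1)) ⟨φ, y⟩`. For `y = u · (0, 1)` the scalar `⟨φ, y⟩` is the
value of the functional at `u`, and right `T`-linearity carries it out of the action of `v` and of
the pairing. -/
theorem repFun_mul_e1_mul (v u : VAlg K G) :
    repFun φ (v * VAlg.gen K .e1 * u) = repFun φ (v * VAlg.gen K .e1) * repFun φ u := by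
  have h1 : ∀ y, rep φ (VAlg.gen K .e1) y =
      rightMul (K := K) (pairingAdd (K := K) φ y) (rep φ (VAlg.gen K .e1) (0, 1)) := by
    intro y
    rw [rep_e1_one, rightMul_single, rep_gen, repGen_e1, one_mul]
  rw [repFun_apply, map_mul, map_mul, Module.End.mul_apply, Module.End.mul_apply, h1,
    rep_rightMul, pairingAdd_rightMul, repFun_apply, repFun_apply, map_mul, Module.End.mul_apply]

theorem repFun_word (n : ℕ) (g : G) :
    repFun φ (VAlg.gen K .e0 ^ n * VAlg.gen K (.of g) * VAlg.gen K .e1) = φ (n, g) := by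
  have h0 : ∀ n, rep φ (VAlg.gen K .e0 ^ n) (Finsupp.single (0, g) 1, 0) =
      (Finsupp.single (n, g) (1 : T), 0) := by
    intro n
    induction n with
    | zero => rw [pow_zero, map_one, Module.End.one_apply]
    | succ n ih =>
      rw [pow_succ', map_mul, Module.End.mul_apply, ih, rep_gen, repGen_e0,
        Finsupp.mapDomain_single]
  rw [repFun_apply, map_mul, map_mul, Module.End.mul_apply, Module.End.mul_apply, rep_e1_one,
    rep_gen, repGen_of, Finsupp.mapDomain_single, mul_one, h0, pairingAdd_apply, pairing_single, mul_one, add_zero]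

end Rep

end Functional

/-! ### Degree estimates for the induced module -/

section FilteredRep

variable {K : Type*} [CommRing K] {G : Type*} [CommGroup G] {T : Type*} [Ring T] [Algebra K T]
  {φ : ℕ × G → T} {H : ℕ → Submodule K T}

theorem repGen_of_mem (g : G) {j : ℕ} {y : ((ℕ × G) →₀ T) × T} (hy : y ∈ repFilt H j) :
    repGen (K := K) φ (.of g) y ∈ repFilt H j := by
  rw [repGen_of]
  exact ⟨(mapDomain_mem_repFilt (fun i => (i.1, g * i.2)) hy fun _ _ h => h).1, hy.2⟩

theorem repGen_e0_mem {j : ℕ} {y : ((ℕ × G) →₀ T) × T} (hy : y ∈ repFilt H j) :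
    repGen (K := K) φ .e0 y ∈ repFilt H (j + 1) := by
  rw [repGen_e0]
  refine mapDomain_mem_repFilt _ hy fun i t ht => ?_
  rwa [show j + 1 - 1 - (i.1 + 1) = j - 1 - i.1 by omega]

theorem repGen_e1_mem (hanti : Antitone H)
    (hmul : ∀ i j, ∀ x ∈ H i, ∀ y ∈ H j, x * y ∈ H (i + j)) (hφ : ∀ i, φ i ∈ H (i.1 + 1)) {j : ℕ}
    {y : ((ℕ × G) →₀ T) × T} (hy : y ∈ repFilt H j) :
    repGen (K := K) φ .e1 y ∈ repFilt H (j + 1) := by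
  rw [repGen_e1]
  exact single_mem_repFilt (pairingAdd_mem φ hanti hmul hφ hy)

theorem rep_mem_filtEnd (hanti : Antitone H)
    (hmul : ∀ i j, ∀ x ∈ H i, ∀ y ∈ H j, x * y ∈ H (i + j)) (hφ : ∀ i, φ i ∈ H (i.1 + 1))
    (v : VAlg K G) : rep φ v ∈ filtEnd (G := G) H := by
  induction v using VAlg.induction with
  | algebraMap c =>
    rw [AlgHom.commutes]
    exact algebraMap_mem _ _
  | gen x =>
    rw [rep_gen]
    intro j y hy
    cases x with
    | e0 => exact repFilt_anti hanti (Nat.le_succ j) (repGen_e0_mem hy)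
    | e1 => exact repFilt_anti hanti (Nat.le_succ j) (repGen_e1_mem hanti hmul hφ hy)
    | of g => exact repGen_of_mem g hy
  | mul a b ha hb =>
    rw [map_mul]
    exact mul_mem ha hb
  | add a b ha hb =>
    rw [map_add]
    exact add_mem ha hb

/-- The elements raising the filtration by `1` form a two-sided ideal, because all of `V` acts by
filtered maps. It contains `e₀` and `e₁`, hence the ideal that they generate; powers follow by
induction. -/
theorem rep_mem_repFilt (hanti : Antitone H)
    (hmul : ∀ i j, ∀ x ∈ H i, ∀ y ∈ H j, x * y ∈ H (i + j)) (hφ : ∀ i, φ i ∈ H (i.1 + 1))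
    {n : ℕ} {v : VAlg K G} (hv : v ∈ adic (degOne K G) n) {j : ℕ} {y : ((ℕ × G) →₀ T) × T}
    (hy : y ∈ repFilt H j) : rep φ v y ∈ repFilt H (j + n) := by
  have h0 : ∀ (v : VAlg K G) {j} {y : ((ℕ × G) →₀ T) × T}, y ∈ repFilt H j →
      rep φ v y ∈ repFilt H j := fun v j y hy => rep_mem_filtEnd hanti hmul hφ v j y hy
  have h1 : ∀ a ∈ genIdeal (degOne K G), ∀ {j} {y : ((ℕ × G) →₀ T) × T}, y ∈ repFilt H j →
      rep φ a y ∈ repFilt H (j + 1) := by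
    let J : TwoSidedIdeal (VAlg K G) := TwoSidedIdeal.mk'
      {a | ∀ j, ∀ y ∈ repFilt H j, rep φ a y ∈ repFilt H (j + 1)}
      (fun j y _ => by
        rw [map_zero]
        exact zero_mem _)
      (fun {a b} ha hb j y hy => by
        rw [map_add]
        exact add_mem (ha j y hy) (hb j y hy))
      (fun {a} ha j y hy => by
        rw [map_neg]
        exact neg_mem (ha j y hy))
      (fun {a b} hb j y hy => by
        rw [map_mul]
        exact h0 a (hb j y hy))
      (fun {a b} ha j y hy => by
        rw [map_mul]
        exact ha j _ (h0 b hy))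
    have hJ : TwoSidedIdeal.span (degOne K G) ≤ J := by
      refine TwoSidedIdeal.span_le.2 ?_
      rintro _ (rfl | rfl)
      · refine (TwoSidedIdeal.mem_mk' _ _ _ _ _ _ _).2 fun j y hy => ?_
        rw [rep_gen]
        exact repGen_e0_mem hy
      · refine (TwoSidedIdeal.mem_mk' _ _ _ _ _ _ _).2 fun j y hy => ?_
        rw [rep_gen]
        exact repGen_e1_mem hanti hmul hφ hy
    intro a ha j y hy
    exact (TwoSidedIdeal.mem_mk' _ _ _ _ _ _ _).1 (hJ (TwoSidedIdeal.mem_asIdeal.1 ha)) j y hy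
  induction n generalizing v j y with
  | zero => exact h0 v hy
  | succ n ih =>
    rw [adic, Submodule.pow_succ] at hv
    refine Submodule.smul_induction_on hv (fun r hr t ht => ?_) (fun a b ha hb => ?_)
    · rw [smul_eq_mul, map_mul, add_comm n, ← add_assoc]
      exact ih hr (h1 t ht hy)
    · rw [map_add]
      exact add_mem ha hb

theorem repFun_mem (hanti : Antitone H) (h0 : H 0 = ⊤)
    (hmul : ∀ i j, ∀ x ∈ H i, ∀ y ∈ H j, x * y ∈ H (i + j)) (hφ : ∀ i, φ i ∈ H (i.1 + 1))
    {n : ℕ} {v : VAlg K G} (hv : v ∈ adic (degOne K G) n) : repFun φ v ∈ H n := by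
  have h1 : ((0, 1) : ((ℕ × G) →₀ T) × T) ∈ repFilt H 0 :=
    ⟨fun _ => zero_mem _, h0 ▸ Submodule.mem_top⟩
  have := pairingAdd_mem φ hanti hmul hφ (rep_mem_repFilt hanti hmul hφ hv h1)
  rwa [zero_add] at this

end FilteredRep

/-! ### Crossed functionals on the completion, and morphisms on `W` -/

section Functional

variable {K : Type*} [CommRing K] {G : Type*} [CommGroup G] {D : Type*} [Ring D] [Algebra K D]
  {C : ℕ → Type*} [∀ n, Ring (C n)] [∀ n, Algebra K (C n)] {p : ∀ n, D →ₐ[K] C n}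

/-- A functional on `V`, with values in an algebra, that restricts to an algebra morphism on `W` and
factors through `M`. -/
structure IsCrossed {T : Type*} [Ring T] [Algebra K T] (F : VHat K G →ₗ[K] T) : Prop where
  map_one : F 1 = 1
  map_mul_e0 : ∀ v, F (v * e0 K G) = 0
  map_mul_gV : ∀ v g, F (v * gV K g) = F v
  map_mul_e1_mul : ∀ v u, F (v * e1 K G * u) = F (v * e1 K G) * F u

/-- The functional `repFun` raises no degree problem: it sends degree `σ n` into `H (σ n)`, which
vanishes in the component of index `n`, so it extends by continuity. The identities pass to the
completion by density. -/
theorem exists_isCrossed (H : ℕ → Submodule K (limAlg p)) (hanti : Antitone H) (h0 : H 0 = ⊤)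
    (hmul : ∀ i j, ∀ x ∈ H i, ∀ y ∈ H j, x * y ∈ H (i + j)) (σ : ℕ → ℕ) (hσ : Monotone σ)
    (hH : ∀ n, ∀ x ∈ H (σ n), limProj p n x = 0) (φ : ℕ × G → limAlg p)
    (hφ : ∀ i, φ i ∈ H (i.1 + 1)) : ∃ F : VHat K G →ₗ[K] limAlg p,
      (∀ n, ∀ v ∈ filtV K G (σ n), limProj p n (F v) = 0) ∧ IsCrossed F ∧
      ∀ n g, F (e0 K G ^ n * gV K g * e1 K G) = φ (n, g) := by
  let F : VHat K G →ₗ[K] limAlg p := extendLin (degOne K G) (repFun φ) σ hσ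
    fun n a ha => hH n _ (repFun_mem hanti h0 hmul hφ ha)
  have hF : ∀ a, F (Compl.of _ a) = repFun φ a := fun a => extendLin_of _ _ _ a
  have hFσ : ∀ n, ∀ v ∈ filtV K G (σ n), limProj p n (F v) = 0 := fun n v hv =>
    limProj_extendLin _ _ _ hv
  let P : ∀ n, limAlg p →ₗ[K] C n := fun n => (limProj p n).toLinearMap
  refine ⟨F, hFσ, ⟨?_, ?_, ?_, ?_⟩, ?_⟩
  · rw [← map_one (Compl.of (degOne K G)), hF, repFun_one]
  · intro v
    refine limAlg_ext fun n => ?_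
    refine LinearMap.congr_fun (Compl.linearMap_ext (P n ∘ₗ F ∘ₗ LinearMap.mulRight K (e0 K G)) 0
      (σ n) (fun x hx => hFσ n _ (Ideal.mul_mem_right _ _ hx)) (fun _ _ => rfl) fun a => ?_) v
    change limProj p n (F (Compl.of _ a * Compl.of _ (VAlg.gen K .e0))) = 0
    rw [← map_mul, hF, repFun_mul_e0, map_zero]
  · intro v g
    refine limAlg_ext fun n => ?_
    refine LinearMap.congr_fun (Compl.linearMap_ext (P n ∘ₗ F ∘ₗ LinearMap.mulRight K (gV K g))
      (P n ∘ₗ F) (σ n) (fun x hx => hFσ n _ (Ideal.mul_mem_right _ _ hx)) (hFσ n) fun a => ?_) v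
    change limProj p n (F (Compl.of _ a * Compl.of _ (VAlg.gen K (.of g)))) =
      limProj p n (F (Compl.of _ a))
    rw [← map_mul, hF, repFun_mul_of, hF]
  · intro v u
    refine limAlg_ext fun n => ?_
    -- The identity is bilinear in `v` and `u`; density is used first in `u`, with `v` in the dense
    -- subalgebra, then in `v`.
    have h1 : ∀ a, limProj p n (F (Compl.of _ a * e1 K G * u)) =
        limProj p n (F (Compl.of _ a * e1 K G) * F u) := by
      intro a
      refine LinearMap.congr_fun (Compl.linearMap_ext
        (P n ∘ₗ F ∘ₗ LinearMap.mulLeft K (Compl.of _ a * e1 K G))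
        (P n ∘ₗ LinearMap.mulLeft K (F (Compl.of _ a * e1 K G)) ∘ₗ F) (σ n)
        (fun x hx => hFσ n _ (Ideal.mul_mem_left _ _ hx)) (fun x hx => ?_) fun b => ?_) u
      · change limProj p n (_ * F x) = 0
        rw [map_mul, hFσ n x hx, mul_zero]
      · change limProj p n (F (Compl.of _ a * Compl.of _ (VAlg.gen K .e1) * Compl.of _ b)) =
          limProj p n (F (Compl.of _ a * Compl.of _ (VAlg.gen K .e1)) * F (Compl.of _ b))
        rw [← map_mul, ← map_mul, hF, hF, hF, repFun_mul_e1_mul]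
    have h2 := LinearMap.congr_fun (Compl.linearMap_ext
      (P n ∘ₗ F ∘ₗ LinearMap.mulRight K (e1 K G * u))
      (P n ∘ₗ LinearMap.mulRight K (F u) ∘ₗ F ∘ₗ LinearMap.mulRight K (e1 K G)) (σ n)
      (fun x hx => hFσ n _ (Ideal.mul_mem_right _ _ hx)) (fun x hx => by
        change limProj p n (F (x * e1 K G) * F u) = 0
        rw [map_mul, hFσ n _ (Ideal.mul_mem_right _ _ hx), zero_mul]) fun a => by
        change limProj p n (F (Compl.of _ a * (e1 K G * u))) = _
        rw [← mul_assoc]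
        exact h1 a) v
    rw [mul_assoc]
    exact h2
  · intro n g
    change F (Compl.of _ (VAlg.gen K .e0) ^ n * Compl.of _ (VAlg.gen K (.of g)) *
      Compl.of _ (VAlg.gen K .e1)) = _
    rw [← map_pow, ← map_mul, ← map_mul, hF, repFun_word]

/-- The restriction to `W` of a crossed functional. -/
def IsCrossed.hom {T : Type*} [Ring T] [Algebra K T] {F : VHat K G →ₗ[K] T} (hF : IsCrossed F) :
    WHat K G →ₐ[K] T :=
  AlgHom.ofLinearMap (F ∘ₗ (WHat K G).val.toLinearMap) hF.map_one fun w w' => by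
    obtain ⟨c, v, h⟩ := w.2
    change F (w.1 * w'.1) = F w.1 * F w'.1
    rw [h, add_mul, map_add, map_add, hF.map_mul_e1_mul, add_mul, Algebra.algebraMap_eq_smul_one,
      smul_mul_assoc, one_mul, map_smul, map_smul, hF.map_one, smul_mul_assoc, one_mul]

theorem IsCrossed.hom_apply {T : Type*} [Ring T] [Algebra K T] {F : VHat K G →ₗ[K] T}
    (hF : IsCrossed F) (w : WHat K G) : hF.hom w = F w.1 := rfl

/-- Two algebra morphisms on `W` that agree on the `z_{n,g}` are equal, if they are continuous. -/
theorem WHat.hom_ext {f g : WHat K G →ₐ[K] limAlg p}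
    (hf : ∀ n, ∃ m, ∀ w ∈ filtW K G m, limProj p n (f w) = 0)
    (hg : ∀ n, ∃ m, ∀ w ∈ filtW K G m, limProj p n (g w) = 0)
    (h : ∀ n g', 1 ≤ n → f (zW K n g') = g (zW K n g')) : f = g := by
  let Z : Subalgebra K (WHat K G) := AlgHom.equalizer f g
  have hZ : ∀ w : WHat K G, w ∈ Z ↔ f w = g w := fun w => Iff.rfl
  let wd : ℕ → G → VHat K G := fun n g' => e0 K G ^ n * gV K g' * e1 K G
  have hwd : ∀ n g', ∃ z ∈ Z, (z : VHat K G) = wd n g' := by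
    intro n g'
    refine ⟨-zW K (n + 1) g', neg_mem (h _ _ (by omega)), ?_⟩
    change -(-(e0 K G ^ (n + 1 - 1) * gV K g' * e1 K G)) = _
    rw [neg_neg]
    rfl
  -- The span of the `e₀ ^ n g e₁ z`, for `z` in the equalizer, is stable under left multiplication
  -- by the generators of `V` and contains `e₁`. So it contains `a e₁` for every `a` before
  -- completion, and the equalizer is dense in `W`.
  let Y : Submodule K (VHat K G) :=
    Submodule.span K {x | ∃ n g', ∃ z ∈ Z, x = wd n g' * (z : VHat K G)}
  have hYZ : Y ≤ (Subalgebra.toSubmodule Z).map (WHat K G).val.toLinearMap := by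
    refine Submodule.span_le.2 ?_
    rintro _ ⟨n, g', z, hz, rfl⟩
    obtain ⟨y, hy, hyw⟩ := hwd n g'
    exact ⟨y * z, Z.mul_mem hy hz, by rw [← hyw]; rfl⟩
  have hstab : ∀ a : VAlg K G, ∀ y ∈ Y, Compl.of _ a * y ∈ Y := by
    intro a
    induction a using VAlg.induction with
    | algebraMap c =>
      intro y hy
      rw [AlgHom.commutes, ← Algebra.smul_def]
      exact Y.smul_mem c hy
    | gen x =>
      suffices hle : Y ≤ Y.comap (LinearMap.mulLeft K (Compl.of _ (VAlg.gen K x))) from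
        fun y hy => hle hy
      refine Submodule.span_le.2 ?_
      rintro _ ⟨n, g', z, hz, rfl⟩
      change genV K x * (wd n g' * (z : VHat K G)) ∈ Y
      cases x with
      | e0 =>
        refine Submodule.subset_span ⟨n + 1, g', z, hz, ?_⟩
        simp only [wd, pow_succ', mul_assoc]
      | e1 =>
        obtain ⟨y, hy, hyw⟩ := hwd n g'
        refine Submodule.subset_span ⟨0, 1, y * z, mul_mem hy hz, ?_⟩
        change _ = wd 0 1 * ((y : VHat K G) * z)
        rw [hyw]
        simp only [wd, pow_zero, gV_one, one_mul]
      | of k =>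
        refine Submodule.subset_span ⟨n, k * g', z, hz, ?_⟩
        have hc : gV K k * e0 K G ^ n = e0 K G ^ n * gV K k :=
          Commute.pow_right (gV_comm k : Commute _ _) n
        simp only [wd, ← gV_mul, mul_assoc]
        rw [← mul_assoc (gV K k), hc, mul_assoc]
    | mul a b ha hb =>
      intro y hy
      rw [map_mul, mul_assoc]
      exact ha _ (hb _ hy)
    | add a b ha hb =>
      intro y hy
      rw [map_add, add_mul]
      exact add_mem (ha _ hy) (hb _ hy)
  have he1 : e1 K G ∈ Y := by
    refine Submodule.subset_span ⟨0, 1, 1, one_mem _, ?_⟩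
    change e1 K G = wd 0 1 * 1
    simp only [wd, pow_zero, gV_one, one_mul, mul_one]
  refine AlgHom.ext fun w => limAlg_ext fun n => ?_
  obtain ⟨m, hm⟩ := hf n
  obtain ⟨m', hm'⟩ := hg n
  obtain ⟨c, v, hw⟩ := w.2
  obtain ⟨a, ha⟩ := Compl.exists_sub_of_mem v (max m m')
  obtain ⟨z, hz, hza⟩ := hYZ (hstab a _ he1)
  have hz' : f z = g z := hz
  have hdiff : (w - (algebraMap K _ c + z)) ∈ filtW K G (max m m') := by
    change w.1 - (algebraMap K _ c + z.1) ∈ filtV K G (max m m')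
    have e : z.1 = Compl.of _ a * e1 K G := hza
    rw [hw, e, add_sub_add_left_eq_sub, ← sub_mul]
    exact Ideal.mul_mem_right _ _ ha
  have h1 := hm _ (Compl.filt_anti (le_max_left _ _) hdiff)
  have h2 := hm' _ (Compl.filt_anti (le_max_right _ _) hdiff)
  have key : ∀ k : WHat K G →ₐ[K] limAlg p, limProj p n (k (w - (algebraMap K _ c + z))) = 0 →
      limProj p n (k w) = limProj p n (algebraMap K _ c) + limProj p n (k z) := by
    intro k hk
    have e : (limProj p n).comp k (w - (algebraMap K _ c + z)) = 0 := hk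
    rw [map_sub, sub_eq_zero, map_add, AlgHom.commutes] at e
    rw [AlgHom.commutes]
    exact e
  rw [key f h1, key g h2, hz']

end Functional

/-! ### The filtration of a completed tensor square by the total degree -/

section TotalDegree

variable {K : Type*} [CommRing K] {A : Type*} [Ring A] [Algebra K A] (F : ℕ → Ideal A)
  [∀ n, (F n).IsTwoSided]

/-- The part of total degree at least `k` of `A / F m ⊗ A / F m`. -/
def totalSpan (K : Type*) [CommRing K] {A : Type*} [Ring A] [Algebra K A] (F : ℕ → Ideal A)
    [∀ n, (F n).IsTwoSided] (k m : ℕ) : Submodule K ((A ⧸ F m) ⊗[K] (A ⧸ F m)) :=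
  Submodule.span K {x | ∃ i j a b, k ≤ i + j ∧ a ∈ F i ∧ b ∈ F j ∧
    x = Ideal.Quotient.mk (F m) a ⊗ₜ[K] Ideal.Quotient.mk (F m) b}

/-- The part of total degree at least `k` of the completed tensor square. -/
def totalFilt (K : Type*) [CommRing K] {A : Type*} [Ring A] [Algebra K A] (F : ℕ → Ideal A)
    [∀ n, (F n).IsTwoSided] (k : ℕ) : Submodule K (complTensorAlg K F) :=
  ⨅ m, (totalSpan K F k m).comap (limProj _ m).toLinearMap

theorem mem_totalFilt {k : ℕ} {x : complTensorAlg K F} :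
    x ∈ totalFilt K F k ↔ ∀ m, limProj _ m x ∈ totalSpan K F k m := by
  rw [totalFilt, Submodule.mem_iInf]
  rfl

theorem totalFilt_anti : Antitone (totalFilt K F) := by
  intro k l h x hx
  rw [mem_totalFilt] at hx ⊢
  refine fun m => Submodule.span_mono ?_ (hx m)
  rintro _ ⟨i, j, a, b, hij, ha, hb, rfl⟩
  exact ⟨i, j, a, b, h.trans hij, ha, hb, rfl⟩

theorem tmulHat_mem_totalFilt {i j : ℕ} {a b : A} (ha : a ∈ F i) (hb : b ∈ F j) :
    tmulHat F a b ∈ totalFilt K F (i + j) := by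
  rw [mem_totalFilt]
  exact fun m => Submodule.subset_span ⟨i, j, a, b, le_rfl, ha, hb, rfl⟩

variable {F}

theorem totalFilt_zero (h0 : F 0 = ⊤) : totalFilt K F 0 = ⊤ := by
  rw [eq_top_iff]
  intro x _
  rw [mem_totalFilt]
  intro m
  have : totalSpan K F 0 m = ⊤ := by
    rw [eq_top_iff, ← TensorProduct.span_tmul_eq_top]
    refine Submodule.span_mono ?_
    rintro _ ⟨a, b, rfl⟩
    obtain ⟨a, rfl⟩ := Ideal.Quotient.mk_surjective a
    obtain ⟨b, rfl⟩ := Ideal.Quotient.mk_surjective b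
    exact ⟨0, 0, a, b, le_rfl, h0 ▸ Submodule.mem_top, h0 ▸ Submodule.mem_top, rfl⟩
  rw [this]
  exact Submodule.mem_top

theorem totalFilt_mul (hmul : ∀ i j, ∀ x ∈ F i, ∀ y ∈ F j, x * y ∈ F (i + j)) (k l : ℕ) :
    ∀ x ∈ totalFilt K F k, ∀ y ∈ totalFilt K F l, x * y ∈ totalFilt K F (k + l) := by
  intro x hx y hy
  rw [mem_totalFilt] at hx hy ⊢
  intro m
  rw [map_mul]
  have hxy := Submodule.mul_mem_mul (hx m) (hy m)
  rw [totalSpan, totalSpan, Submodule.span_mul_span] at hxy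
  refine Submodule.span_le.2 ?_ hxy
  rintro _ ⟨_, ⟨i₁, j₁, a, b, h, ha, hb, rfl⟩, _, ⟨i₂, j₂, c, d, h', hc, hd, rfl⟩, rfl⟩
  refine Submodule.subset_span ⟨i₁ + i₂, j₁ + j₂, a * c, b * d, by omega, hmul _ _ _ ha _ hc,
    hmul _ _ _ hb _ hd, ?_⟩
  rw [map_mul, map_mul]
  exact Algebra.TensorProduct.tmul_mul_tmul _ _ _ _

/-- If `i + j ≥ 2n`, then `i ≥ n` or `j ≥ n`. This converts the total degree, which is
multiplicative, into vanishing of the components that define the topology. -/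
theorem limProj_eq_zero_of_mem_totalFilt (hanti : Antitone F) (n : ℕ) (x : complTensorAlg K F)
    (hx : x ∈ totalFilt K F (2 * n)) : limProj _ n x = 0 := by
  rw [mem_totalFilt] at hx
  have hbot : totalSpan K F (2 * n) n ≤ ⊥ := by
    refine Submodule.span_le.2 ?_
    rintro _ ⟨i, j, a, b, h, ha, hb, rfl⟩
    obtain hi | hj : n ≤ i ∨ n ≤ j := by omega
    · rw [Ideal.Quotient.eq_zero_iff_mem.2 (hanti hi ha), TensorProduct.zero_tmul]
      exact zero_mem _
    · rw [Ideal.Quotient.eq_zero_iff_mem.2 (hanti hj hb), TensorProduct.tmul_zero]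
      exact zero_mem _
  exact (Submodule.mem_bot K).1 (hbot (hx n))

end TotalDegree

/-! ### The coproduct of `W` -/

section DeltaW

/-- There is an algebra morphism on `W` with prescribed values on the `z_{n,g}`. -/
theorem exists_hom_WHat {K : Type*} [CommRing K] {G : Type*} [CommGroup G]
    {D : Type*} [Ring D] [Algebra K D] {C : ℕ → Type*} [∀ n, Ring (C n)] [∀ n, Algebra K (C n)]
    {p : ∀ n, D →ₐ[K] C n} (H : ℕ → Submodule K (limAlg p)) (hanti : Antitone H) (h0 : H 0 = ⊤)
    (hmul : ∀ i j, ∀ x ∈ H i, ∀ y ∈ H j, x * y ∈ H (i + j)) (σ : ℕ → ℕ) (hσ : Monotone σ)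
    (hH : ∀ n, ∀ x ∈ H (σ n), limProj p n x = 0) (φ : ℕ × G → limAlg p)
    (hφ : ∀ i, φ i ∈ H (i.1 + 1)) : ∃ f : WHat K G →ₐ[K] limAlg p,
      (∀ n, ∀ w ∈ filtW K G (σ n), limProj p n (f w) = 0) ∧
      ∀ n g, f (zW K (n + 1) g) = φ (n, g) := by
  -- The sign compensates for the one in `z_{n+1,g} = -e₀ ^ n g e₁`.
  obtain ⟨F, hFσ, hF, hFφ⟩ := exists_isCrossed H hanti h0 hmul σ hσ hH (fun i => -φ i)
    fun i => neg_mem (hφ i)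
  refine ⟨hF.hom, fun n w hw => hFσ n w.1 hw, fun n g => ?_⟩
  rw [hF.hom_apply]
  change F (-(e0 K G ^ n * gV K g * e1 K G)) = φ (n, g)
  rw [map_neg, hFφ, neg_neg]

variable {K : Type*} [CommRing K] {G : Type*} [CommGroup G]

theorem filtW_zero : filtW K G 0 = ⊤ := by
  rw [eq_top_iff]
  exact fun w _ => Compl.filt_zero w.1

theorem filtW_anti : Antitone (filtW K G) := fun _ _ h _ hw => Compl.filt_anti h hw

theorem filtW_mul (i j : ℕ) : ∀ x ∈ filtW K G i, ∀ y ∈ filtW K G j, x * y ∈ filtW K G (i + j) :=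
  fun _ hx _ hy => Compl.filt_mul hx hy

theorem zW_mem (n : ℕ) (g : G) (hn : 1 ≤ n) : zW K n g ∈ filtW K G n := by
  change -(e0 K G ^ (n - 1) * gV K g * e1 K G) ∈ filtV K G n
  have := Compl.filt_mul (Ideal.mul_mem_right (gV K g) _ (Compl.filt_pow (e0_mem (K := K)) (n - 1)))
    (e1_mem (K := K) (G := G))
  rw [Nat.sub_add_cancel hn] at this
  exact neg_mem this

/-- The value of the coproduct of `W` on `z_{n,g}`. -/
def deltaGen (K : Type*) [CommRing K] {G : Type*} [CommGroup G] [Fintype G] (n : ℕ) (g : G) :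
    complTensorAlg K (filtW K G) :=
  tmulHat (filtW K G) (zW K n g) 1 + tmulHat (filtW K G) 1 (zW K n g) +
    ∑ k ∈ Finset.Ico 1 n, ∑ h : G, tmulHat (filtW K G) (zW K k h) (zW K (n - k) (g * h⁻¹))

theorem deltaGen_mem [Fintype G] (n : ℕ) (g : G) (hn : 1 ≤ n) :
    deltaGen K n g ∈ totalFilt K (filtW K G) n := by
  have h1 : (1 : WHat K G) ∈ filtW K G 0 := Compl.filt_zero _
  refine add_mem (add_mem ?_ ?_) (Submodule.sum_mem _ fun k hk => Submodule.sum_mem _ fun h _ => ?_)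
  · exact tmulHat_mem_totalFilt (i := n) (j := 0) _ (zW_mem n g hn) h1
  · have := tmulHat_mem_totalFilt (K := K) (filtW K G) h1 (zW_mem n g hn)
    rwa [zero_add] at this
  · rw [Finset.mem_Ico] at hk
    have := tmulHat_mem_totalFilt (K := K) (filtW K G) (zW_mem k h hk.1)
      (zW_mem (n - k) (g * h⁻¹) (by omega))
    rwa [show k + (n - k) = n by omega] at this

/-- The prescribed value on `z_{n,g}` has total degree at least `n`, so the total-degree filtration
meets the requirements of `exists_hom_WHat`. -/
theorem exists_isDeltaW (K : Type*) [CommRing K] (G : Type*) [CommGroup G] [Fintype G] :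
    ∃ D : WHat K G →ₐ[K] complTensorAlg K (filtW K G),
      (∀ n, ∀ w ∈ filtW K G (2 * n), (D w).1 n = 0) ∧ IsDeltaW D := by
  obtain ⟨D, hD, hφ⟩ := exists_hom_WHat (totalFilt K (filtW K G)) (totalFilt_anti _)
    (totalFilt_zero filtW_zero) (totalFilt_mul filtW_mul) (fun n => 2 * n)
    (fun _ _ h => Nat.mul_le_mul_left 2 h) (limProj_eq_zero_of_mem_totalFilt filtW_anti)
    (fun i : ℕ × G => deltaGen K (i.1 + 1) i.2) (fun i => deltaGen_mem _ _ (Nat.succ_pos _))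
  refine ⟨D, hD, fun n => ⟨2 * n, hD n⟩, fun n g hn => ?_⟩
  obtain ⟨n, rfl⟩ := Nat.exists_eq_add_of_le' hn
  exact hφ n g

theorem IsDeltaW.unique [Fintype G] {D D' : WHat K G →ₐ[K] complTensorAlg K (filtW K G)}
    (hD : IsDeltaW D) (hD' : IsDeltaW D') : D = D' :=
  WHat.hom_ext hD.1 hD'.1 fun n g hn => (hD.2 n g hn).trans (hD'.2 n g hn).symm

end DeltaW

/-! ### The isomorphism between `W` and `M` -/

section Module

variable {K : Type*} [CommRing K] {G : Type*} [CommGroup G]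

/-- The crossed functional with values in `V` that sends each `e₀ ^ n g e₁` to itself restricts on
`W` to an algebra morphism agreeing with the inclusion on the `z_{n,g}`. As it kills `relM`, it
shows that `W` meets `relM` trivially. -/
theorem exists_retraction (K : Type*) [CommRing K] (G : Type*) [CommGroup G] :
    ∃ F : VHat K G →ₗ[K] VHat K G, (∀ n, ∀ v ∈ filtV K G n, F v ∈ filtV K G n) ∧
      IsCrossed F ∧ ∀ w : WHat K G, F w.1 = w.1 := by
  have h : ∃ F : VHat K G →ₗ[K] VHat K G, (∀ n, ∀ v ∈ filtV K G n, F v ∈ filtV K G n) ∧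
      IsCrossed F ∧ ∀ n (g : G), F (e0 K G ^ n * gV K g * e1 K G) =
        e0 K G ^ n * gV K g * e1 K G := by
    refine exists_isCrossed (p := fun n => Ideal.Quotient.mkₐ K (adic (degOne K G) n))
      (fun k => (filtV K G k).restrictScalars K) (fun _ _ h _ hx => Compl.filt_anti h hx) ?_
      (fun _ _ _ hx _ hy => Compl.filt_mul hx hy) id monotone_id (fun n x hx => hx)
      (fun i : ℕ × G => (e0 K G ^ i.1 * gV K i.2 * e1 K G : VHat K G)) fun i => ?_
    · exact eq_top_iff.2 fun x _ => Compl.filt_zero x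
    · exact Compl.filt_mul (Ideal.mul_mem_right _ _ (Compl.filt_pow e0_mem _)) e1_mem
  obtain ⟨F, hσ, hF, hφ⟩ := h
  refine ⟨F, hσ, hF, fun w => ?_⟩
  have key : hF.hom = (WHat K G).val := by
    refine WHat.hom_ext (p := fun n => Ideal.Quotient.mkₐ K (adic (degOne K G) n))
      (fun n => ⟨n, fun w hw => hσ n w.1 hw⟩) (fun n => ⟨n, fun w hw => hw⟩) fun n g hn => ?_
    change F (-(e0 K G ^ (n - 1) * gV K g * e1 K G)) = -(e0 K G ^ (n - 1) * gV K g * e1 K G)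
    rw [map_neg, hφ]
  exact DFunLike.congr_fun key w

theorem IsCrossed.eq_zero_of_mem_relM {T : Type*} [Ring T] [Algebra K T] {F : VHat K G →ₗ[K] T}
    (hF : IsCrossed F) {x : VHat K G} (hx : x ∈ relM K G) : F x = 0 := by
  -- `F` is not `V`-linear, so the induction over the left ideal needs all left multiples at once.
  suffices h : ∀ a, F (a * x) = 0 by simpa using h 1
  induction hx using Submodule.span_induction with
  | mem x hx =>
    intro a
    obtain rfl | ⟨g, _, rfl⟩ := hx
    · exact hF.map_mul_e0 a
    · rw [mul_sub, map_sub, hF.map_mul_gV, mul_one, sub_self]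
  | zero => simp
  | add x y _ _ hx hy =>
    intro a
    rw [mul_add, map_add, hx, hy, add_zero]
  | smul b x _ hx =>
    intro a
    rw [smul_eq_mul, ← mul_assoc]
    exact hx _

theorem gV_sub_one_mem (g : G) : gV K g - 1 ∈ relM K G := by
  by_cases hg : g = 1
  · rw [hg, gV_one, sub_self]
    exact zero_mem _
  · exact Submodule.subset_span (Or.inr ⟨g, hg, rfl⟩)

theorem e0_mem_relM : e0 K G ∈ relM K G := Submodule.subset_span (Or.inl rfl)

theorem actOneM_eq (w : WHat K G) : actOneM K G w = (relM K G).mkQ w.1 := by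
  rw [actOneM_apply, oneM, ← map_smul, smul_eq_mul, mul_one]

theorem actOneM_one : actOneM K G 1 = oneM K G := by
  rw [actOneM_apply]
  exact one_smul _ _

theorem exists_actOneM_of (a : VAlg K G) :
    ∃ w : WHat K G, Compl.of _ a - w.1 ∈ relM K G := by
  -- Stronger claim suited to induction: left multiplication by the algebra before completion sends
  -- `W` into `W + relM`. On `c + v e₁`, the generator `e₀` leaves the error `c e₀`, the generator
  -- `g` leaves `c (g - 1)`, and `e₁` leaves none.
  suffices h : ∀ a : VAlg K G, ∀ w : WHat K G, ∃ w' : WHat K G,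
      Compl.of _ a * w.1 - w'.1 ∈ relM K G by
    obtain ⟨w, hw⟩ := h a 1
    refine ⟨w, ?_⟩
    have e : Compl.of _ a * (1 : WHat K G).1 = Compl.of _ a := mul_one _
    rwa [e] at hw
  clear a
  intro a
  induction a using VAlg.induction with
  | algebraMap c =>
    intro w
    refine ⟨algebraMap K _ c * w, ?_⟩
    rw [AlgHom.commutes]
    change algebraMap K _ c * w.1 - algebraMap K _ c * w.1 ∈ _
    rw [sub_self]
    exact zero_mem _
  | gen x =>
    intro w
    change ∃ w' : WHat K G, genV K x * w.1 - w'.1 ∈ relM K G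
    obtain ⟨c, v, hw⟩ := w.2
    cases x with
    | e0 =>
      refine ⟨⟨e0 K G * v * e1 K G, 0, e0 K G * v, by simp⟩, ?_⟩
      rw [hw, mul_add, ← Algebra.commutes, ← mul_assoc, add_sub_cancel_right]
      exact (relM K G).smul_mem _ e0_mem_relM
    | e1 =>
      refine ⟨⟨e1 K G * w.1, 0, algebraMap K _ c + e1 K G * v, ?_⟩, ?_⟩
      · rw [hw, mul_add, ← Algebra.commutes, map_zero, zero_add, add_mul, mul_assoc]
      · rw [sub_self]
        exact zero_mem _
    | of g =>
      refine ⟨⟨algebraMap K _ c + gV K g * v * e1 K G, c, gV K g * v, rfl⟩, ?_⟩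
      have e : gV K g * w.1 - (algebraMap K _ c + gV K g * v * e1 K G) =
          algebraMap K _ c * (gV K g - 1) := by
        rw [hw, mul_add, ← Algebra.commutes, mul_sub, mul_one, ← mul_assoc]
        abel
      rw [e]
      exact (relM K G).smul_mem _ (gV_sub_one_mem g)
  | mul a b ha hb =>
    intro w
    obtain ⟨w', h'⟩ := hb w
    obtain ⟨w'', h''⟩ := ha w'
    refine ⟨w'', ?_⟩
    have := add_mem ((relM K G).smul_mem (Compl.of _ a) h') h''
    rwa [smul_eq_mul, mul_sub, ← mul_assoc, ← map_mul, sub_add_sub_cancel] at this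
  | add a b ha hb =>
    intro w
    obtain ⟨w', h'⟩ := ha w
    obtain ⟨w'', h''⟩ := hb w
    refine ⟨w' + w'', ?_⟩
    have := add_mem h' h''
    rw [map_add, add_mul]
    rwa [← add_sub_add_comm] at this

variable [Fintype G]

/-- The left ideal generated by `e₀` and the `e₁ g` is already two-sided: right multiplication by
`h` permutes the `e₁ g` and commutes with `e₀`, while right multiplication by `e₀` or `e₁` lands in
it trivially. -/
theorem exists_eq_of_mem_genIdeal {a : VAlg K G} (ha : a ∈ genIdeal (degOne K G)) :
    ∃ (x : VAlg K G) (y : G → VAlg K G), a = x * VAlg.gen K .e0 +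
      ∑ g, y g * (VAlg.gen K .e1 * VAlg.gen K (.of g)) := by
  have hmul : ∀ g h : G, VAlg.gen K (.of g) * VAlg.gen K (.of h) = VAlg.gen K (.of (g * h)) := by
    intro g h
    simpa [VAlg.gen] using VAlg.mk_rel (K := K) (Rel.mul g h)
  have hone : VAlg.gen K (.of (1 : G)) = 1 := by
    simpa [VAlg.gen] using (VAlg.mk_rel (K := K) (G := G) Rel.one).symm
  have hcomm : ∀ g : G, VAlg.gen K (.of g) * VAlg.gen K .e0 =
      VAlg.gen K .e0 * VAlg.gen K (.of g) := by
    intro g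
    simpa [VAlg.gen] using VAlg.mk_rel (K := K) (Rel.comm g)
  let P : VAlg K G → Prop := fun a => ∃ (x : VAlg K G) (y : G → VAlg K G),
    a = x * VAlg.gen K .e0 + ∑ g, y g * (VAlg.gen K .e1 * VAlg.gen K (.of g))
  have hadd : ∀ a b, P a → P b → P (a + b) := by
    rintro _ _ ⟨x, y, rfl⟩ ⟨x', y', rfl⟩
    refine ⟨x + x', y + y', ?_⟩
    simp only [add_mul, Pi.add_apply, Finset.sum_add_distrib]
    abel
  have hl : ∀ a b, P b → P (a * b) := by
    rintro a _ ⟨x, y, rfl⟩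
    refine ⟨a * x, fun g => a * y g, ?_⟩
    simp only [mul_add, Finset.mul_sum, mul_assoc]
  have h0 : ∀ x, P (x * VAlg.gen K .e0) := fun x => ⟨x, 0, by simp⟩
  have h1 : ∀ (x : VAlg K G) (g : G), P (x * (VAlg.gen K .e1 * VAlg.gen K (.of g))) := by
    classical
    intro x g
    refine ⟨0, Pi.single g x, ?_⟩
    rw [zero_mul, zero_add, Finset.sum_eq_single g]
    · rw [Pi.single_eq_same]
    · intro h _ hh
      rw [Pi.single_eq_of_ne hh, zero_mul]
    · simp
  have hsum : ∀ (s : Finset G) (f : G → VAlg K G), (∀ g, P (f g)) → P (∑ g ∈ s, f g) := by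
    intro s f hf
    exact Finset.sum_induction _ P hadd ⟨0, 0, by simp⟩ fun g _ => hf g
  have hr : ∀ b a, P a → P (a * b) := by
    intro b
    induction b using VAlg.induction with
    | algebraMap c =>
      intro a ha
      rw [← Algebra.commutes]
      exact hl _ _ ha
    | gen i =>
      rintro _ ⟨x, y, rfl⟩
      cases i with
      | e0 => exact h0 _
      | e1 =>
        have := h1 (x * VAlg.gen K .e0 +
          ∑ g, y g * (VAlg.gen K .e1 * VAlg.gen K (.of g))) 1
        rwa [hone, mul_one] at this
      | of h =>
        rw [add_mul, Finset.sum_mul, mul_assoc, ← hcomm, ← mul_assoc]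
        refine hadd _ _ (h0 _) (hsum _ _ fun g => ?_)
        rw [mul_assoc, mul_assoc, hmul]
        exact h1 _ _
    | mul b c hb hc =>
      intro a ha
      rw [← mul_assoc]
      exact hc _ (hb _ ha)
    | add b c hb hc =>
      intro a ha
      rw [mul_add]
      exact hadd _ _ (hb _ ha) (hc _ ha)
  let J : TwoSidedIdeal (VAlg K G) := TwoSidedIdeal.mk' {a | P a} ⟨0, 0, by simp⟩
    (fun {a b} ha hb => hadd a b ha hb) (fun {a} ha => by
      have := hl (-1) a ha
      rwa [neg_one_mul] at this)
    (fun {a b} hb => hl a b hb) (fun {a b} ha => hr b a ha)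
  have hJ : TwoSidedIdeal.span (degOne K G) ≤ J := by
    refine TwoSidedIdeal.span_le.2 ?_
    rintro _ (rfl | rfl)
    · refine (TwoSidedIdeal.mem_mk' _ _ _ _ _ _ _).2 ?_
      have := h0 1
      rwa [one_mul] at this
    · refine (TwoSidedIdeal.mem_mk' _ _ _ _ _ _ _).2 ?_
      have := h1 1 1
      rwa [one_mul, hone, mul_one] at this
  have hmem : a ∈ J := hJ (TwoSidedIdeal.mem_asIdeal.1 ha)
  exact (TwoSidedIdeal.mem_mk' {a | P a} _ _ _ _ _ a).1 hmem

/-- The control on the degree of the coefficients makes the successive approximations in the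
completion converge. -/
theorem exists_eq_of_mem_adic_succ {n : ℕ} {a : VAlg K G} (ha : a ∈ adic (degOne K G) (n + 1)) :
    ∃ (x : VAlg K G) (y : G → VAlg K G), x ∈ adic (degOne K G) n ∧
      (∀ g, y g ∈ adic (degOne K G) n) ∧ a = x * VAlg.gen K .e0 +
      ∑ g, y g * (VAlg.gen K .e1 * VAlg.gen K (.of g)) := by
  rw [adic, Submodule.pow_succ] at ha
  refine Submodule.smul_induction_on ha (fun r hr t ht => ?_) ?_
  · obtain ⟨x, y, rfl⟩ := exists_eq_of_mem_genIdeal ht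
    refine ⟨r * x, fun g => r * y g, Ideal.mul_mem_right x (adic (degOne K G) n) hr,
      fun g => Ideal.mul_mem_right (y g) (adic (degOne K G) n) hr, ?_⟩
    simp only [smul_eq_mul, mul_add, Finset.mul_sum, mul_assoc]
  · rintro _ _ ⟨x, y, hx, hy, rfl⟩ ⟨x', y', hx', hy', rfl⟩
    refine ⟨x + x', y + y', add_mem hx hx', fun g => add_mem (hy g) (hy' g), ?_⟩
    simp only [add_mul, Pi.add_apply, Finset.sum_add_distrib]
    abel

/-- An element of positive degree of `V` is the sum of a multiple of `e₀` and of multiples of the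
`e₁ g`. -/
theorem exists_eq_of_mem_filtV_one {v : VHat K G} (hv : v ∈ filtV K G 1) :
    ∃ (x : VHat K G) (y : G → VHat K G),
      v = x * e0 K G + ∑ g, y g * (e1 K G * gV K g) := by
  have hstep : ∀ (n : ℕ) (v : VHat K G), v ∈ filtV K G (n + 1) →
      ∃ (x : VHat K G) (y : G → VHat K G), x ∈ filtV K G n ∧ (∀ g, y g ∈ filtV K G n) ∧
        v - (x * e0 K G + ∑ g, y g * (e1 K G * gV K g)) ∈ filtV K G (n + 2) := by
    intro n v hv
    obtain ⟨a, ha, hva⟩ := Compl.exists_mem_adic_sub_of_mem hv (n + 2)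
    obtain ⟨x, y, hx, hy, rfl⟩ := exists_eq_of_mem_adic_succ ha
    refine ⟨Compl.of _ x, fun g => Compl.of _ (y g), Compl.of_mem_filt_iff.2 hx,
      fun g => Compl.of_mem_filt_iff.2 (hy g), ?_⟩
    rw [map_add, map_mul, map_sum] at hva
    simp only [map_mul] at hva
    exact hva
  choose! X Y hX hY hR using hstep
  -- Successive remainders: `r n` has degree at least `n + 1`, and its decomposition has
  -- coefficients of degree at least `n`. Summing these coefficients over `n` gives those of `v`,
  -- the index set `G` being finite.
  let r : ℕ → VHat K G := fun n => Nat.rec v (fun n u =>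
    u - (X n u * e0 K G + ∑ g, Y n u g * (e1 K G * gV K g))) n
  have hr : ∀ n, r (n + 1) =
      r n - (X n (r n) * e0 K G + ∑ g, Y n (r n) g * (e1 K G * gV K g)) := fun n => rfl
  have hr' : ∀ n, r n ∈ filtV K G (n + 1) := by
    intro n
    induction n with
    | zero => exact hv
    | succ n ih =>
      rw [hr]
      exact hR n _ ih
  obtain ⟨x, hx⟩ := Compl.exists_sum (fun n => X n (r n)) fun n => hX n _ (hr' n)
  choose y hy using fun g => Compl.exists_sum (fun n => Y n (r n) g) fun n => hY n _ (hr' n) g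
  refine ⟨x, y, Compl.eq_of_sub_mem fun n => ?_⟩
  have h1 : v - ((∑ i ∈ Finset.range n, X i (r i)) * e0 K G +
      ∑ g, (∑ i ∈ Finset.range n, Y i (r i) g) * (e1 K G * gV K g)) = r n := by
    induction n with
    | zero => simp [r]
    | succ n ih =>
      rw [hr]
      refine Eq.trans ?_ (congrArg (· - (X n (r n) * e0 K G +
        ∑ g, Y n (r n) g * (e1 K G * gV K g))) ih)
      simp only [Finset.sum_range_succ, add_mul, Finset.sum_add_distrib]
      abel
  have h2 : (x - ∑ i ∈ Finset.range n, X i (r i)) * e0 K G +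
      ∑ g, (y g - ∑ i ∈ Finset.range n, Y i (r i) g) * (e1 K G * gV K g) ∈ filtV K G n :=
    add_mem (Ideal.mul_mem_right _ _ (hx n))
      (Submodule.sum_mem _ fun g _ => Ideal.mul_mem_right _ _ (hy g n))
  have h3 := sub_mem (Compl.filt_anti (Nat.le_succ n) (hr' n)) h2
  rw [← h1] at h3
  convert h3 using 1
  simp only [sub_mul, Finset.sum_sub_distrib]
  abel

/-- `relM` is an algebraic span, not a closure, so density alone does not suffice. After
approximation modulo degree `1`, the rest is exactly `x e₀ + ∑ y_g e₁ g`, which is congruent to `(∑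
y_g) e₁ ∈ W` modulo `relM`. -/
theorem actOneM_surjective : Function.Surjective (actOneM K G) := by
  intro m
  obtain ⟨v, rfl⟩ := (relM K G).mkQ_surjective m
  suffices h : ∃ w : WHat K G, v - w.1 ∈ relM K G by
    obtain ⟨w, hw⟩ := h
    refine ⟨w, ?_⟩
    rw [actOneM_eq, eq_comm, ← sub_eq_zero, ← map_sub]
    exact (Submodule.Quotient.mk_eq_zero _).2 hw
  obtain ⟨a, ha⟩ := Compl.exists_sub_of_mem v 1
  obtain ⟨w, hw⟩ := exists_actOneM_of a
  obtain ⟨x, y, hxy⟩ := exists_eq_of_mem_filtV_one ha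
  refine ⟨w + ⟨(∑ g, y g) * e1 K G, 0, ∑ g, y g, by simp⟩, ?_⟩
  have h1 : x * e0 K G + ∑ g, y g * e1 K G * (gV K g - 1) ∈ relM K G :=
    add_mem ((relM K G).smul_mem x e0_mem_relM)
      (Submodule.sum_mem _ fun g _ => (relM K G).smul_mem _ (gV_sub_one_mem g))
  convert add_mem hw h1 using 1
  change v - (w.1 + (∑ g, y g) * e1 K G) = _
  rw [eq_add_of_sub_eq hxy]
  simp only [mul_sub, mul_one, Finset.sum_sub_distrib, Finset.sum_mul, mul_assoc]
  abel

/-- The inverse of the isomorphism `w ↦ w · 1_M` between `W` and `M` respects the filtrations. -/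
theorem exists_actOneM_inv (K : Type*) [CommRing K] (G : Type*) [CommGroup G] [Fintype G] :
    ∃ R : MHat K G →ₗ[K] WHat K G, (∀ n, ∀ m ∈ filtM K G n, R m ∈ filtW K G n) ∧
      (∀ w, R (actOneM K G w) = w) ∧ ∀ m, actOneM K G (R m) = m := by
  obtain ⟨F, hσ, hF, hw⟩ := exists_retraction K G
  -- The inverse is induced by the retraction `F`; this gives injectivity and, as `F` respects the
  -- filtration of `V`, so does the inverse.
  have hker : ∀ (w : WHat K G) (v : VHat K G), actOneM K G w = (relM K G).mkQ v → w.1 = F v := by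
    intro w v h
    rw [actOneM_eq, ← sub_eq_zero, ← map_sub] at h
    have := hF.eq_zero_of_mem_relM ((Submodule.Quotient.mk_eq_zero _).1 h)
    rwa [map_sub, hw, sub_eq_zero] at this
  have hinj : Function.Injective (actOneM K G) := by
    intro w w' h
    apply Subtype.ext
    rw [hker w w'.1 (h.trans (actOneM_eq w')), hw]
  let E := LinearEquiv.ofBijective (actOneM K G) ⟨hinj, actOneM_surjective⟩
  refine ⟨E.symm.toLinearMap, ?_, E.symm_apply_apply, E.apply_symm_apply⟩
  rintro n _ ⟨v, hv, rfl⟩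
  have h : actOneM K G (E.symm ((relM K G).mkQ v)) = (relM K G).mkQ v := E.apply_symm_apply _
  change (E.symm ((relM K G).mkQ v)).1 ∈ filtV K G n
  rw [hker _ _ h]
  exact hσ n v hv

end Module

/-! ### Stabilizers -/

section Stabilizer

variable {K : Type*} [CommRing K]

/-- The stabilizer of a map `Δ` from a filtered module to its completed tensor square, for a group
action. -/
def tensorSqStab {S A : Type*} [Ring S] [Algebra K S] [AddCommGroup A] [Module K A] [Module S A]
    [IsScalarTower K S A] {F : ℕ → Submodule S A} {Γ : Type*} [Group Γ] (α : Γ → A →ₗ[K] A)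
    (hα : ∀ γ n, ∀ a ∈ F n, α γ a ∈ F n) (h1 : ∀ a, α 1 a = a)
    (hmul : ∀ γ δ a, α (γ * δ) a = α γ (α δ a)) (Δ : A → TensorSeq K F) : Subgroup Γ where
  carrier := {γ | ∀ a, tensorSqMap (α γ) (hα γ) (Δ a) = Δ (α γ a)}
  one_mem' a := by rw [tensorSqMap_of_eq_id _ _ h1, h1]
  mul_mem' {γ δ} hγ hδ a := by
    rw [hmul, ← hγ, ← hδ, tensorSqMap_tensorSqMap]
    exact tensorSqMap_congr _ _ (LinearMap.ext (hmul γ δ)) _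
  inv_mem' {γ} hγ a := by
    have h2 : ∀ a, α γ⁻¹ (α γ a) = a := fun a => by rw [← hmul, inv_mul_cancel, h1]
    have h3 : α γ (α γ⁻¹ a) = a := by rw [← hmul, mul_inv_cancel, h1]
    have h := hγ (α γ⁻¹ a)
    rw [h3] at h
    rw [← h, tensorSqMap_tensorSqMap]
    exact tensorSqMap_of_eq_id _ _ h2 _

/-- If the right multiple of an algebra endomorphism by a unit is compatible with a coproduct, so
is the endomorphism. -/
theorem tensorSqMap_eq_of_mulRight {A : Type*} [Ring A] [Algebra K A] {F : ℕ → Ideal A}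
    [∀ n, (F n).IsTwoSided] (D : A →ₐ[K] complTensorAlg K F) (f : A →ₐ[K] A)
    (hf : ∀ n, ∀ a ∈ F n, f a ∈ F n) {u : A} (hu : IsUnit u)
    (hfu : ∀ n, ∀ a ∈ F n, ((LinearMap.mulRight K u).comp f.toLinearMap) a ∈ F n)
    (h : ∀ a, tensorSqMap (F := F) (F' := F) ((LinearMap.mulRight K u).comp f.toLinearMap) hfu
      (D a).1 = (D (f a * u)).1) (a : A) :
    tensorSqMap (F := F) (F' := F) f.toLinearMap hf (D a).1 = (D (f a)).1 := by
  have hr : ∀ n, ∀ a ∈ F n, LinearMap.mulRight K u a ∈ F n :=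
    fun n a ha => Ideal.mul_mem_right u (F n) ha
  -- The hypothesis rewritten in the algebra: the tensor square of right multiplication by `u` is
  -- right multiplication by `u ⊗ u`.
  have key : ∀ a, tensorSqHom f hf (D a) * tmulHat F u u = D (f a) * D u := by
    intro a
    rw [← map_mul]
    apply Subtype.ext
    rw [← tensorSqMap_mulRight u hr, tensorSqHom_val]
    exact (tensorSqMap_tensorSqMap f.toLinearMap hf (LinearMap.mulRight K u) hr _).trans (h a)
  -- At `a = 1` the identity says that `u` is grouplike, `u ⊗ u = D u`; this common factor is a unit
  -- and cancels.
  have h1 := key 1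
  rw [map_one, map_one, map_one, map_one, one_mul, one_mul] at h1
  have h2 := key a
  rw [h1] at h2
  exact congrArg Subtype.val ((hu.map D).mul_right_cancel h2)

end Stabilizer

/-! ### The coproduct of `M` -/

section DeltaM

variable {K : Type*} [CommRing K] {G : Type*} [CommGroup G] [Fintype G]

/-- The coproduct of `W` is transported along the filtered isomorphism `w ↦ w · 1_M`. -/
theorem exists_isDeltaM (D : WHat K G →ₐ[K] complTensorAlg K (filtW K G))
    (hD : ∀ n, ∃ m, ∀ w ∈ filtW K G m, (D w).1 n = 0) :
    ∃ D' : MHat K G →ₗ[K] complTensor K (filtM K G), IsDeltaM D D' := by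
  obtain ⟨R, hR, hRa, -⟩ := exists_actOneM_inv K G
  let T : MHat K G →ₗ[K] TensorSeq K (filtM K G) :=
    (tensorSqMap (actOneM K G) actOneM_filt).comp
      ((complTensorAlg K (filtW K G)).val.toLinearMap.comp (D.toLinearMap.comp R))
  have hT : ∀ m, T m = tensorSqMap (actOneM K G) actOneM_filt (D (R m)).1 := fun m => rfl
  refine ⟨T.codRestrict _ fun m => tensorSqMap_mem _ actOneM_filt (D (R m)).2, fun n => ?_,
    fun w => ?_⟩
  · obtain ⟨m, hm⟩ := hD n
    refine ⟨m, fun x hx => ?_⟩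
    change TensorProduct.map _ _ ((D (R x)).1 n) = 0
    rw [hm _ (hR m x hx), map_zero]
  · change T (actOneM K G w) = _
    rw [hT, hRa]

theorem IsDeltaM.unique {D : WHat K G →ₐ[K] complTensorAlg K (filtW K G)}
    {D₁ D₂ : MHat K G →ₗ[K] complTensor K (filtM K G)} (h₁ : IsDeltaM D D₁)
    (h₂ : IsDeltaM D D₂) : D₁ = D₂ := by
  refine LinearMap.ext fun m => ?_
  obtain ⟨w, rfl⟩ := actOneM_surjective m
  exact Subtype.ext ((h₁.2 w).trans (h₂.2 w).symm)

end DeltaM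

/-! ### Comparison of the actions on `W` and `M` -/

section Action

variable {K : Type*} [CommRing K] [Algebra ℚ K] {G : Type*} [CommGroup G]

theorem gammaAutM10_actOneM {Ψ : (NCSeries K G)ˣ} {u : WHat K G}
    (hu : gammaAutM10 Ψ (oneM K G) = actOneM K G u) (w : WHat K G) :
    gammaAutM10 Ψ (actOneM K G w) = actOneM K G (gammaAutW1 Ψ w * u) := by
  rw [actOneM_apply, gammaAutM10_smul, hu, actOneM_apply, actOneM_apply, smul_smul]
  rfl

variable [Fintype G]

/-- Let `v` represent the image of `1_M` under the map attached to `Φ`. Composing the two actions in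
both orders gives `A_Ψ(v) u = 1` and `A_Φ(u) v = 1`; applying `A_Ψ` to the latter gives `u A_Ψ(v) =
1`. -/
theorem isUnit_of_gammaAutM10_oneM {Ψ Φ : (NCSeries K G)ˣ}
    (hΨ : constX K G (Ψ : NCSeries K G) = 1) (hΦ : constX K G (Φ : NCSeries K G) = 1)
    (h : circ Ψ Φ = 1) (h' : circ Φ Ψ = 1) {u : WHat K G}
    (hu : gammaAutM10 Ψ (oneM K G) = actOneM K G u) : IsUnit u := by
  obtain ⟨R, -, hR, -⟩ := exists_actOneM_inv K G
  have hinj : Function.Injective (actOneM K G) := Function.LeftInverse.injective hR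
  obtain ⟨v, hv⟩ := actOneM_surjective (gammaAutM10 Φ (oneM K G))
  have h1 : gammaAutW1 Ψ v * u = 1 := by
    apply hinj
    rw [← gammaAutM10_actOneM hu, hv, ← gammaAutM10_circ hΨ hΦ, h, gammaAutM10_one, actOneM_one]
  have h2 : gammaAutW1 Φ u * v = 1 := by
    apply hinj
    rw [← gammaAutM10_actOneM hv.symm, ← hu, ← gammaAutM10_circ hΦ hΨ, h', gammaAutM10_one,
      actOneM_one]
  have h3 := congrArg (gammaAutW1 Ψ) h2
  rw [map_mul, ← gammaAutW1_circ hΨ hΦ, h, gammaAutW1_one, map_one] at h3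
  exact ⟨⟨u, gammaAutW1 Ψ v, h3, h1⟩, rfl⟩

/-- Transported to `W`, the condition on `M` says that `w ↦ A_Ψ(w) u` is compatible with the
coproduct of `W`, where `u · 1_M` is the image of `1_M`; the unit `u` is then removed by
`tensorSqMap_eq_of_mulRight`. The series `Φ` is the inverse of `Ψ` for `⊛` and serves only to show
that `u` is a unit. -/
theorem mem_stabW_of_mem_stabM {DW : WHat K G →ₐ[K] complTensorAlg K (filtW K G)}
    {DM : MHat K G →ₗ[K] complTensor K (filtM K G)} (hDM : IsDeltaM DW DM) {Ψ Φ : GrpLike K G}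
    (h : circ Ψ.1 Φ.1 = 1) (h' : circ Φ.1 Ψ.1 = 1) (hΨ : Ψ ∈ stabM DM) : Ψ ∈ stabW DW := by
  obtain ⟨R, hRF, hR, -⟩ := exists_actOneM_inv K G
  obtain ⟨u, hu⟩ := actOneM_surjective (gammaAutM10 Ψ.1 (oneM K G))
  have hunit : IsUnit u := isUnit_of_gammaAutM10_oneM (IsGroupLike.constX_eq_one Ψ.2)
    (IsGroupLike.constX_eq_one Φ.2) h h' hu.symm
  have hfu : ∀ n, ∀ w ∈ filtW K G n,
      ((LinearMap.mulRight K u).comp (gammaAutW1 Ψ.1).toLinearMap) w ∈ filtW K G n :=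
    fun n w hw => Ideal.mul_mem_right u (filtW K G n) (gammaAutW1_filt Ψ.1 n w hw)
  refine tensorSqMap_eq_of_mulRight DW (gammaAutW1 Ψ.1) (gammaAutW1_filt Ψ.1) hunit hfu fun w => ?_
  have hRact : ∀ x : TensorSeq K (filtW K G),
      tensorSqMap R hRF (tensorSqMap (actOneM K G) actOneM_filt x) = x := fun x => by
    rw [tensorSqMap_tensorSqMap]
    exact tensorSqMap_of_eq_id _ _ hR x
  -- The stabilizer condition is evaluated at `w · 1_M` and pulled back to `W` by the tensor square
  -- of the inverse isomorphism `R`.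
  have key := congrArg (tensorSqMap R hRF) (hΨ (actOneM K G w))
  rw [gammaAutM10_actOneM hu.symm, hDM.2, hDM.2, hRact, tensorSqMap_tensorSqMap,
    tensorSqMap_tensorSqMap] at key
  rw [← key]
  refine tensorSqMap_congr _ _ (LinearMap.ext fun w => ?_) _
  change gammaAutW1 Ψ.1 w * u = R (gammaAutM10 Ψ.1 (actOneM K G w))
  rw [gammaAutM10_actOneM hu.symm, hR]

end Action

end

end DoubleShuffle

theorem theorem2 (K : Type*) [CommRing K] [Algebra ℚ K] (G : Type*) [CommGroup G] [Fintype G] :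
    ∃ (_ : Group (GrpLike K G))
      (ΔW : WHat K G →ₐ[K] complTensorAlg K (filtW K G))
      (ΔM : MHat K G →ₗ[K] complTensor K (filtM K G))
      (StabM StabW : Subgroup (GrpLike K G)),
      (∀ Ψ Φ : GrpLike K G, ((Ψ * Φ).1 : NCSeries K G) = circledast Ψ.1 Φ.1) ∧
      (IsDeltaW ΔW ∧ ∀ D, IsDeltaW D → D = ΔW) ∧
      (IsDeltaM ΔW ΔM ∧ ∀ D, IsDeltaM ΔW D → D = ΔM) ∧
      (StabM : Set (GrpLike K G)) = stabM ΔM ∧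
      (StabW : Set (GrpLike K G)) = stabW ΔW ∧
      StabM ≤ StabW := by
  obtain ⟨ΔW, -, hW⟩ := exists_isDeltaW K G
  obtain ⟨ΔM, hM⟩ := exists_isDeltaM ΔW hW.1
  let := grpLikeGroup K G
  -- Constant term `1` is the only consequence of grouplikeness that the two action laws need.
  have hc : ∀ Ψ : GrpLike K G, constX K G (Ψ.1 : NCSeries K G) = 1 :=
    fun Ψ => IsGroupLike.constX_eq_one Ψ.2
  refine ⟨grpLikeGroup K G, ΔW, ΔM,
    tensorSqStab (fun Ψ : GrpLike K G => gammaAutM10 Ψ.1) (fun Ψ => gammaAutM10_filt Ψ.1)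
      gammaAutM10_one (fun Ψ Φ => gammaAutM10_circ (hc Ψ) (hc Φ)) fun m => (ΔM m).1,
    tensorSqStab (fun Ψ : GrpLike K G => (gammaAutW1 Ψ.1).toLinearMap)
      (fun Ψ => gammaAutW1_filt Ψ.1) gammaAutW1_one
      (fun Ψ Φ => gammaAutW1_circ (hc Ψ) (hc Φ)) fun w => (ΔW w).1,
    fun _ _ => rfl, ⟨hW, fun D hD => hD.unique hW⟩, ⟨hM, fun D hD => hD.unique hM⟩, rfl, rfl,
    fun Ψ hΨ => ?_⟩
  exact mem_stabW_of_mem_stabM hM (congrArg Subtype.val (mul_inv_cancel Ψ))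
    (congrArg Subtype.val (inv_mul_cancel Ψ)) hΨ
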